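/- Let $\Gamma$ be a finite connected metric graph (loops and multiple edges allowed), each edge $e$ being identified with an interval $[0,\ell_e]$, $\ell_e>0$. Let $H=-d^2/dx^2$ be its Neumann–Kirchhoff Laplacian: its domain consists of the functions $f\in\bigoplus_e H^2(e)$ that are continuous at every vertex and satisfy $\sum_{e\in\mathcal E_v}\nabla f_e(v)=0$ at every vertex $v$, where $\mathcal E_v$ is the set of edge ends at $v$ (so a loop is counted twice in it and in $\deg v=|\mathcal E_v|$) and $\nabla f_e(v)$ is the derivative of $f_e$ at $v$ directed from $v$ into $e$. For an eigenvalue $\lambda$ of $H$, let $n(\lambda)$ and $N(\lambda)$ be the first and the last place where $\lambda$ appears in the list $\lambda_1\le\lambda_2\le\dots$ of the eigenvalues of $H$, repeated according to multiplicity. Let $(\lambda,f)$ be an eigenpair of $H$, with $f$ real-valued and not vanishing at any vertex of degree larger than two. Then the set $\mathcal P=\{x\in\Gamma: f(x)=0\}$ of nodal points is finite. Regard the nodal points as vertices of $\Gamma$, let $\Gamma_0^f$ be the graph obtained by cutting $\Gamma$ at all points of $\mathcal P$, let $\nu_0(f)$ be the number of its connected components (the nodal domains of $f$), and let $\beta$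 denote the first Betti number of a graph. For real $\mu$ such that, for $\xi=0$, the boundary value problem $$-g''=\mu g \text{ on every edge},\qquad g_e(v)=\xi(v)\ \ (v\in\mathcal P,\ e\in\mathcal E_v),\qquad g \text{ satisfies the Neumann–Kirchhoff conditions at all vertices } v\notin\mathcal P$$ has only the zero solution, it has a unique solution $g^\xi$ for each $\xi\in\mathbb C^{\mathcal P}$; the two-sided Dirichlet-to-Neumann map $\Lambda_0^f(\mu):\mathbb C^{\mathcal P}\to\mathbb C^{\mathcal P}$ is then defined by $(\Lambda_0^f(\mu)\xi)(v)=-\sum_{e\in\mathcal E_v}\nabla g^\xi_e(v)$. For a self-adjoint operator $\Lambda$ on $\mathbb C^{\mathcal P}$ let $\operatorname{Mor}\Lambda$ and $\operatorname{Pos}\Lambda$ be the numbers of its negative and of its positive eigenvalues, counted with multiplicity. Then for all sufficiently small $\varepsilon>0$ the maps $\Lambda_0^f(\lambda+\varepsilon)$ and $\Lambda_0^f(\lambda-\varepsilon)$ are well defined, self-adjoint and invertible, and $$N(\lambda)-\nu_0(f)=\operatorname{Mor}\Lambda_0^f(\lambda+\varepsilon),\qquad n(\lambda)-1=\operatorname{Mor}\Lambda_0^f(\lambda-\varepsilon),$$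 $$n(\lambda)-\nu_0(f)=\beta(\Gamma)-\beta(\Gamma_0^f)-\operatorname{Pos}\Lambda_0^f(\lambda-\varepsilon).$$ -/

import Mathlib

/-- A metric graph with vertex set `V` and edge set `E` (loops and multiple edges are allowed).
The edge `e` is identified with the interval `[0, len e]`, with `0` at the vertex `src e` and
`len e` at the vertex `tgt e`. -/
structure MetricGraph (V E : Type*) where
  src : E → V
  tgt : E → V
  len : E → ℝ
  len_pos : ∀ e, 0 < len e

namespace MetricGraph

/-- `F ∈ H²(0, ℓ)` (represented by a `C¹` function on `[0, ℓ]`), with weak second derivative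
`g ∈ L²(0, ℓ)`: the derivative of `F` is absolutely continuous, with derivative `g`. -/
def HasSecondDeriv (ℓ : ℝ) (F g : ℝ → ℂ) : Prop :=
  DifferentiableOn ℝ F (Set.Icc 0 ℓ) ∧
  MeasureTheory.MemLp g 2 (MeasureTheory.volume.restrict (Set.Icc 0 ℓ)) ∧
  ∀ x ∈ Set.Icc 0 ℓ,
    derivWithin F (Set.Icc 0 ℓ) x = derivWithin F (Set.Icc 0 ℓ) 0 + ∫ t in (0 : ℝ)..x, g t

section Basic

variable {V E : Type*} (G : MetricGraph V E)

/-- The ends of edges: `(e, false)` is the initial end of `e`, `(e, true)` is its terminal end.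
`endpoint h` is the vertex at which the end `h` lies. -/
def endpoint (h : E × Bool) : V := if h.2 then G.tgt h.1 else G.src h.1

/-- The degree of a vertex; both ends of a loop are counted. -/
noncomputable def degree (v : V) : ℕ := Nat.card {h : E × Bool // G.endpoint h = v}

/-- The value `f_e(v)` at an end of the edge `e`. -/
def endValue {R : Type*} (f : E → ℝ → R) (h : E × Bool) : R :=
  if h.2 then f h.1 (G.len h.1) else f h.1 0

/-- The outgoing derivative `∇f_e(v)` at an end of the edge `e`, directed from the vertex
into the edge. -/
noncomputable def outDeriv (f : E → ℝ → ℂ) (h : E × Bool) : ℂ :=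
  if h.2 then -derivWithin (f h.1) (Set.Icc 0 (G.len h.1)) (G.len h.1)
  else derivWithin (f h.1) (Set.Icc 0 (G.len h.1)) 0

/-- `u` and `v` are the initial and the terminal vertex of some edge. -/
def Joined (u v : V) : Prop := ∃ e, G.src e = u ∧ G.tgt e = v

/-- The graph is non-empty and any two vertices are connected by a path of edges. -/
def Connected : Prop := Nonempty V ∧ ∀ u v, Relation.EqvGen G.Joined u v

/-- The number of connected components. -/
noncomputable def numComponents : ℕ := Nat.card (Quot G.Joined)

/-- The simplicial boundary map from chains of edges to chains of vertices. -/
noncomputable def boundary : (E →₀ ℚ) →ₗ[ℚ] (V →₀ ℚ) :=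
  Finsupp.linearCombination ℚ fun e => Finsupp.single (G.tgt e) 1 - Finsupp.single (G.src e) 1

/-- The first Betti number, that is, the dimension of the space of cycles. -/
noncomputable def betti : ℕ := Module.finrank ℚ (LinearMap.ker G.boundary)

open Classical in
/-- The graph cut at the vertices of `B`: each vertex of `B` is replaced by as many vertices of
degree one as there are ends of edges at it. -/
noncomputable def cut (B : Finset V) :
    MetricGraph ({v : V // v ∉ B} ⊕ {h : E × Bool // G.endpoint h ∈ B}) E where
  src e := if hb : G.endpoint (e, false) ∈ B then Sum.inr ⟨(e, false), hb⟩
    else Sum.inl ⟨G.endpoint (e, false), hb⟩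
  tgt e := if hb : G.endpoint (e, true) ∈ B then Sum.inr ⟨(e, true), hb⟩
    else Sum.inl ⟨G.endpoint (e, true), hb⟩
  len := G.len
  len_pos := G.len_pos

/-- A subdivision of a metric graph: finitely many interior points
`pt e 0 < pt e 1 < ...` on every edge `e`. -/
structure Subdivision where
  num : E → ℕ
  pt : ∀ e, Fin (num e) → ℝ
  strictMono : ∀ e, StrictMono (pt e)
  mem_Ioo : ∀ e i, pt e i ∈ Set.Ioo 0 (G.len e)

/-- The position of the initial point of the `i`-th part of the edge `e`. -/
def Subdivision.left {G : MetricGraph V E} (S : G.Subdivision) (e : E) :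
    Fin (S.num e + 1) → ℝ :=
  Fin.cases 0 (S.pt e)

/-- The position of the terminal point of the `i`-th part of the edge `e`. -/
def Subdivision.right {G : MetricGraph V E} (S : G.Subdivision) (e : E) :
    Fin (S.num e + 1) → ℝ :=
  Fin.lastCases (G.len e) (S.pt e)

theorem Subdivision.left_lt_right {G : MetricGraph V E} (S : G.Subdivision) (e : E)
    (i : Fin (S.num e + 1)) : S.left e i < S.right e i := by
  unfold Subdivision.left Subdivision.right
  induction i using Fin.cases with
  | zero =>
    generalize hz : (0 : Fin (S.num e + 1)) = z
    induction z using Fin.lastCases with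
    | last =>
      rw [Fin.lastCases_last, ← hz, Fin.cases_zero]
      exact G.len_pos e
    | cast j =>
      rw [Fin.lastCases_castSucc, ← hz, Fin.cases_zero]
      exact (S.mem_Ioo e j).1
  | succ j =>
    rw [Fin.cases_succ]
    generalize hz : j.succ = z
    induction z using Fin.lastCases with
    | last => simpa using (S.mem_Ioo e j).2
    | cast k =>
      rw [Fin.lastCases_castSucc]
      apply S.strictMono e
      have := congrArg Fin.val hz
      simp at this
      rw [Fin.lt_def]
      omega

/-- The metric graph with additional vertices of degree two at the points of the subdivision. -/
noncomputable def subdivide (S : G.Subdivision) :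
    MetricGraph (V ⊕ Σ e, Fin (S.num e)) (Σ e, Fin (S.num e + 1)) where
  src p := Fin.cases (motive := fun _ => V ⊕ Σ e, Fin (S.num e))
    (Sum.inl (G.src p.1)) (fun j => Sum.inr ⟨p.1, j⟩) p.2
  tgt p := Fin.lastCases (motive := fun _ => V ⊕ Σ e, Fin (S.num e))
    (Sum.inl (G.tgt p.1)) (fun j => Sum.inr ⟨p.1, j⟩) p.2
  len p := S.right p.1 p.2 - S.left p.1 p.2
  len_pos p := sub_pos.mpr (S.left_lt_right p.1 p.2)

end Basic

theorem HasSecondDeriv.add {ℓ : ℝ} {F F' g g' : ℝ → ℂ} (hF : HasSecondDeriv ℓ F g)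
    (hF' : HasSecondDeriv ℓ F' g') : HasSecondDeriv ℓ (F + F') (g + g') := by
  refine ⟨hF.1.add hF'.1, hF.2.1.add hF'.2.1, fun x hx => ?_⟩
  have h0 : (0 : ℝ) ∈ Set.Icc 0 ℓ := ⟨le_rfl, hx.1.trans hx.2⟩
  have key : ∀ {u : ℝ → ℂ},
      MeasureTheory.MemLp u 2 (MeasureTheory.volume.restrict (Set.Icc 0 ℓ)) →
      IntervalIntegrable u MeasureTheory.volume 0 x := by
    intro u hu
    rw [intervalIntegrable_iff_integrableOn_Icc_of_le hx.1]
    have : MeasureTheory.IntegrableOn u (Set.Icc 0 ℓ) := hu.integrable (by norm_num)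
    exact this.mono_set (Set.Icc_subset_Icc_right hx.2)
  rw [derivWithin_add (hF.1 x hx) (hF'.1 x hx), derivWithin_add (hF.1 0 h0) (hF'.1 0 h0),
    hF.2.2 x hx, hF'.2.2 x hx]
  simp only [Pi.add_apply]
  rw [intervalIntegral.integral_add (key hF.2.1) (key hF'.2.1)]
  ring

theorem HasSecondDeriv.const_smul {ℓ : ℝ} {F g : ℝ → ℂ} (c : ℂ) (hF : HasSecondDeriv ℓ F g) :
    HasSecondDeriv ℓ (c • F) (c • g) := by
  refine ⟨hF.1.const_smul c, hF.2.1.const_smul c, fun x hx => ?_⟩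
  have h0 : (0 : ℝ) ∈ Set.Icc 0 ℓ := ⟨le_rfl, hx.1.trans hx.2⟩
  rw [derivWithin_const_smul c (hF.1 x hx), derivWithin_const_smul c (hF.1 0 h0), hF.2.2 x hx]
  simp only [Pi.smul_apply]
  rw [intervalIntegral.integral_smul, smul_add]

section Operators

variable {V E : Type*} [Fintype E] (G : MetricGraph V E)

open Classical in
/-- The sum of the outgoing derivatives of `f` at the vertex `v`, over all ends of edges
at `v`. -/
noncomputable def outDerivSum (f : E → ℝ → ℂ) (v : V) : ℂ :=
  ∑ h : E × Bool with G.endpoint h = v, G.outDeriv f h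

/-- The Neumann-Kirchhoff Laplacian `H = -d²/dx²`: `f` belongs to its domain, that is, `f` is
in `H²` on every edge, is continuous at every vertex and satisfies current conservation at every
vertex; and `H f = w` in `L²`. -/
structure IsLaplacian (f w : E → ℝ → ℂ) : Prop where
  sobolev : ∀ e, HasSecondDeriv (G.len e) (f e) (-w e)
  continuous : ∀ h h', G.endpoint h = G.endpoint h' → G.endValue f h = G.endValue f h'
  kirchhoff : ∀ v, G.outDerivSum f v = 0

theorem IsLaplacian.add {G : MetricGraph V E} {f f' w w' : E → ℝ → ℂ} (hf : G.IsLaplacian f w)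
    (hf' : G.IsLaplacian f' w') : G.IsLaplacian (f + f') (w + w') := by
  refine ⟨fun e => ?_, fun h h' hh => ?_, fun v => ?_⟩
  · have := (hf.sobolev e).add (hf'.sobolev e)
    rwa [← neg_add] at this
  · have h1 := hf.continuous h h' hh
    have h2 := hf'.continuous h h' hh
    have key : ∀ k, G.endValue (f + f') k = G.endValue f k + G.endValue f' k := by
      intro k; unfold endValue; split_ifs <;> rfl
    rw [key, key, h1, h2]
  · have key : ∀ k, G.outDeriv (f + f') k = G.outDeriv f k + G.outDeriv f' k := by
      intro k
      have hp := (G.len_pos k.1).le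
      unfold outDeriv
      simp only [Pi.add_apply]
      rw [derivWithin_add ((hf.sobolev k.1).1 _ ⟨hp, le_rfl⟩)
          ((hf'.sobolev k.1).1 _ ⟨hp, le_rfl⟩),
        derivWithin_add ((hf.sobolev k.1).1 _ ⟨le_rfl, hp⟩) ((hf'.sobolev k.1).1 _ ⟨le_rfl, hp⟩)]
      split_ifs <;> ring
    have h1 := hf.kirchhoff v
    have h2 := hf'.kirchhoff v
    unfold outDerivSum at *
    simp only [key, Finset.sum_add_distrib, h1, h2, add_zero]

theorem IsLaplacian.const_smul {G : MetricGraph V E} {f w : E → ℝ → ℂ} (c : ℂ)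
    (hf : G.IsLaplacian f w) : G.IsLaplacian (c • f) (c • w) := by
  refine ⟨fun e => ?_, fun h h' hh => ?_, fun v => ?_⟩
  · have := (hf.sobolev e).const_smul c
    rwa [smul_neg] at this
  · have h1 := hf.continuous h h' hh
    have key : ∀ k, G.endValue (c • f) k = c * G.endValue f k := by
      intro k; unfold endValue; split_ifs <;> rfl
    rw [key, key, h1]
  · have key : ∀ k, G.outDeriv (c • f) k = c * G.outDeriv f k := by
      intro k
      have hp := (G.len_pos k.1).le
      unfold outDeriv
      simp only [Pi.smul_apply]
      rw [derivWithin_const_smul c ((hf.sobolev k.1).1 _ ⟨hp, le_rfl⟩),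
        derivWithin_const_smul c ((hf.sobolev k.1).1 _ ⟨le_rfl, hp⟩)]
      simp only [smul_eq_mul]
      split_ifs <;> ring
    have h1 := hf.kirchhoff v
    unfold outDerivSum at *
    simp only [key, ← Finset.mul_sum, h1, mul_zero]

/-- The eigenspace `ker (H - μ)`. Its elements are functions on the edges `[0, len e]`,
written as functions on `ℝ` that vanish outside of `[0, len e]`. -/
noncomputable def eigenspace (μ : ℝ) : Submodule ℂ (E → ℝ → ℂ) where
  carrier := {f | (∀ e, ∀ x ∉ Set.Icc 0 (G.len e), f e x = 0) ∧ G.IsLaplacian f ((μ : ℂ) • f)}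
  add_mem' {f f'} hf hf' := by
    refine ⟨fun e x hx => by simp [hf.1 e x hx, hf'.1 e x hx], ?_⟩
    rw [smul_add]
    exact hf.2.add hf'.2
  zero_mem' := by
    refine ⟨fun _ _ _ => rfl, ⟨fun e => ⟨?_, ?_, ?_⟩, ?_, ?_⟩⟩
    · exact differentiableOn_const 0
    · simp
    · intro x _
      simp
    · intro h h' _
      simp [endValue]
    · intro v
      simp [outDerivSum, outDeriv]
  smul_mem' c f hf := by
    refine ⟨fun e x hx => by simp [hf.1 e x hx], ?_⟩
    rw [smul_comm]
    exact hf.2.const_smul c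

/-- The multiplicity of `μ` as an eigenvalue of `H` (zero if `μ` is not an eigenvalue). -/
noncomputable def multiplicity (μ : ℝ) : ℕ∞ := Cardinal.toENat (Module.rank ℂ (G.eigenspace μ))

/-- The eigenvalues of `H` repeated according to their multiplicities: the pair `(μ, i)` stands
for the `i`-th copy of the eigenvalue `μ`. -/
def spectralEntries : Set (ℝ × ℕ) := {p | (p.2 : ℕ∞) < G.multiplicity p.1}

/-- The place of the entry `p` in the list of all eigenvalues in non-decreasing order, repeated
according to multiplicities; places are numbered from `1`. -/
noncomputable def place (p : ℝ × ℕ) : ℕ∞ :=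
  {q | q ∈ G.spectralEntries ∧ toLex q ≤ toLex p}.encard

/-- `n(μ)`: the first place where `μ` appears in the ordered list of eigenvalues. -/
noncomputable def firstPlace (μ : ℝ) : ℕ∞ :=
  ⨅ p ∈ {p | p ∈ G.spectralEntries ∧ p.1 = μ}, G.place p

/-- `N(μ)`: the last place where `μ` appears in the ordered list of eigenvalues. -/
noncomputable def lastPlace (μ : ℝ) : ℕ∞ :=
  ⨆ p ∈ {p | p ∈ G.spectralEntries ∧ p.1 = μ}, G.place p

/-- `(μ, f)` is an eigenpair of the Neumann-Kirchhoff Laplacian, with `f` real-valued. Only the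
values of `f e` on `[0, len e]` matter. -/
def IsRealEigenpair (μ : ℝ) (f : E → ℝ → ℝ) : Prop :=
  G.IsLaplacian (fun e x => (f e x : ℂ)) (fun e x => (μ : ℂ) * (f e x : ℂ)) ∧
  ∃ e, ∃ x ∈ Set.Icc 0 (G.len e), f e x ≠ 0

/-- The boundary value problem with the Dirichlet data `ξ` on the set `B` of vertices:
`-f'' = μ f` on every edge, `f_e(v) = ξ(v)` for `v ∈ B`, and Neumann-Kirchhoff conditions at the
vertices outside of `B`. -/
structure IsDirichletSolution (B : Finset V) (μ : ℝ) (ξ : B → ℂ) (f : E → ℝ → ℂ) : Prop where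
  equation : ∀ e, HasSecondDeriv (G.len e) (f e) (fun x => -((μ : ℂ) * f e x))
  dirichlet : ∀ h, ∀ hb : G.endpoint h ∈ B, G.endValue f h = ξ ⟨G.endpoint h, hb⟩
  continuous : ∀ h h', G.endpoint h ∉ B → G.endpoint h = G.endpoint h' →
    G.endValue f h = G.endValue f h'
  kirchhoff : ∀ v, v ∉ B → G.outDerivSum f v = 0

/-- The two-sided Dirichlet-to-Neumann map of the vertex set `B` at `μ` is well defined and is
given, in the standard basis of `ℂ^B`, by the matrix `Λ`. -/
structure IsDtN (B : Finset V) (μ : ℝ) (Λ : Matrix B B ℂ) : Prop where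
  unique : ∀ f, G.IsDirichletSolution B μ 0 f → ∀ e, ∀ x ∈ Set.Icc 0 (G.len e), f e x = 0
  map_eq : ∀ ξ : B → ℂ, ∃ f, G.IsDirichletSolution B μ ξ f ∧
    ∀ v : B, Λ.mulVec ξ v = -G.outDerivSum f v

/-- The nodal points of `f` inside the edge `e`. -/
def edgeZeros (f : E → ℝ → ℝ) (e : E) : Set ℝ := {x ∈ Set.Ioo 0 (G.len e) | f e x = 0}

/-- The subdivision of the graph at the nodal points of `f` that are inside edges. -/
noncomputable def nodalSubdivision (f : E → ℝ → ℝ) (hfin : ∀ e, (G.edgeZeros f e).Finite) :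
    G.Subdivision where
  num e := (hfin e).toFinset.card
  pt e := (hfin e).toFinset.orderEmbOfFin rfl
  strictMono e := ((hfin e).toFinset.orderEmbOfFin rfl).strictMono
  mem_Ioo e i := ((hfin e).mem_toFinset.mp ((hfin e).toFinset.orderEmbOfFin_mem rfl i)).1

/-- The graph with additional vertices at the nodal points of `f` inside edges. -/
noncomputable abbrev nodalGraph (f : E → ℝ → ℝ) (hfin : ∀ e, (G.edgeZeros f e).Finite) :=
  G.subdivide (G.nodalSubdivision f hfin)

open Classical in
/-- The set of all nodal points of `f`, as a set of vertices of `nodalGraph`: the old vertices at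
which `f` vanishes and all additional vertices. -/
noncomputable def nodalPoints [Fintype V] (f : E → ℝ → ℝ) (hfin : ∀ e, (G.edgeZeros f e).Finite) :
    Finset (V ⊕ Σ e, Fin ((G.nodalSubdivision f hfin).num e)) :=
  Finset.univ.filter fun p =>
    Sum.elim (fun v => ∃ h, G.endpoint h = v ∧ G.endValue f h = 0) (fun _ => True) p

/-- The graph cut at all nodal points of `f`; its connected components are the nodal domains. -/
noncomputable abbrev nodalCut [Fintype V] (f : E → ℝ → ℝ) (hfin : ∀ e, (G.edgeZeros f e).Finite) :=
  (G.nodalGraph f hfin).cut (G.nodalPoints f hfin)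

end Operators

open Classical in
/-- The Morse index: the number of negative eigenvalues, counted with multiplicities. -/
noncomputable def morseIndex {n : Type*} [Fintype n] {Λ : Matrix n n ℂ}
    (hΛ : Λ.IsHermitian) : ℕ :=
  (Finset.univ.filter fun i => hΛ.eigenvalues i < 0).card

open Classical in
/-- The positive index: the number of positive eigenvalues, counted with multiplicities. -/
noncomputable def positiveIndex {n : Type*} [Fintype n] {Λ : Matrix n n ℂ}
    (hΛ : Λ.IsHermitian) : ℕ :=
  (Finset.univ.filter fun i => 0 < hΛ.eigenvalues i).card

end MetricGraph

/-! Take the nodal points as vertices and, in addition, mark the midpoint of every edge of the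
resulting graph. Let M(μ) be the Dirichlet-to-Neumann matrix of the set of all vertices and
midpoints (`vertexMatrix`). It is a regular Hermitian matrix as long as no half edge has a Dirichlet
eigenvalue up to μ. The midpoints are needed because λ is a Dirichlet eigenvalue of any edge with
two nodal ends, so that a matrix on the vertices alone would have a pole at λ. Since f has no zero
inside an edge of the nodal graph, such an edge carries at most half a wave, and λ lies in the open
range where M is regular.

The kernel of M(μ) is isomorphic to the eigenspace of H at μ (`multiplicity_eq_nullity`,
`multiplicity_subdivide`). The family M is continuous, strictly decreasing, and positive definite
for μ < 0. Hence its Morse index at μ counts the eigenvalues below μ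
(`IsDecreasingFamily.encard_eq_index`), and Mor M(λ-ε) = n(λ)-1, Mor M(λ+ε) = N(λ).

Let D(μ) be the block of M(μ) outside of the nodal points (`innerMatrix`), which is again a
decreasing family. The function f vanishes at the nodal points and keeps its sign on each nodal
domain. Dividing by f writes the form of D(λ) as a sum of squares, so D(λ) is nonnegative and its
kernel is spanned by the restrictions of f to the nodal domains
(`IsGroundState.nullity_innerMatrix`). Therefore Mor D(λ-ε) = 0 and Mor D(λ+ε) = ν₀.

The two-sided Dirichlet-to-Neumann map Λ is the Schur complement of D in M (`exists_isDtN`), so Mor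
M = Mor Λ + Mor D. This gives the first two formulas. For the third, Λ(λ-ε) is invertible, so Mor +
Pos = |𝒫|; and all nodal points have degree two, so the Euler characteristic gives β(Γ₀) = β(Γ) - 1
- |𝒫| + ν₀ (`betti_cut_subdivide`). -/

namespace MetricGraph

/-! ### Indices of Hermitian matrices and of decreasing families -/

section HermitianForms

open Matrix Filter Topology

variable {n : Type*} [Fintype n] {A : Matrix n n ℂ}

/-- The quadratic form of a matrix. -/
noncomputable def quadForm (A : Matrix n n ℂ) (x : n → ℂ) : ℝ := (star x ⬝ᵥ A *ᵥ x).re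

/-- The dimension of the kernel of a square matrix. -/
noncomputable def nullity (A : Matrix n n ℂ) : ℕ := Module.finrank ℂ (LinearMap.ker A.mulVecLin)

theorem quadForm_smul (A : Matrix n n ℂ) (c : ℂ) (x : n → ℂ) :
    quadForm A (c • x) = ‖c‖ ^ 2 * quadForm A x := by
  unfold quadForm
  rw [mulVec_smul, star_smul, smul_dotProduct, dotProduct_smul, smul_smul, smul_eq_mul,
    Complex.star_def, ← Complex.normSq_eq_conj_mul_self, Complex.re_ofReal_mul,
    Complex.normSq_eq_norm_sq]

theorem quadForm_neg (A : Matrix n n ℂ) (x : n → ℂ) : quadForm (-A) x = -quadForm A x := by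
  simp [quadForm, neg_mulVec]

open Classical in
theorem exists_quadForm_eq_sum (hA : A.IsHermitian) :
    ∃ U : (n → ℂ) ≃ₗ[ℂ] (n → ℂ), ∀ y,
      quadForm A (U y) = ∑ i, hA.eigenvalues i * ‖y i‖ ^ 2 := by
  set u : Matrix n n ℂ := (hA.eigenvectorUnitary : Matrix n n ℂ) with hu
  have h1 : star u * u = 1 := Unitary.coe_star_mul_self _
  have h2 : u * star u = 1 := Unitary.coe_mul_star_self _
  have hs : A = u * diagonal (RCLike.ofReal ∘ hA.eigenvalues) * star u := by
    conv_lhs => rw [hA.spectral_theorem, Unitary.conjStarAlgAut_apply]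
  refine ⟨LinearEquiv.ofLinearMap u.mulVecLin (star u).mulVecLin ?_ ?_, fun y => ?_⟩
  · rw [← mulVecLin_mul, h2, mulVecLin_one]
  · rw [← mulVecLin_mul, h1, mulVecLin_one]
  · have key : star (u *ᵥ y) ⬝ᵥ A *ᵥ (u *ᵥ y) =
        star y ⬝ᵥ diagonal (RCLike.ofReal ∘ hA.eigenvalues) *ᵥ y := by
      rw [star_mulVec, ← dotProduct_mulVec, mulVec_mulVec, mulVec_mulVec]
      congr 2
      conv_lhs => rw [hs]
      rw [← star_eq_conjTranspose]
      calc _ = (star u * u) * diagonal (RCLike.ofReal ∘ hA.eigenvalues) * (star u * u) := by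
            simp only [mul_assoc]
        _ = _ := by rw [h1, one_mul, mul_one]
    simp only [quadForm, LinearEquiv.coe_ofLinearMap, mulVecLin_apply]
    rw [key]
    simp only [dotProduct, Complex.re_sum, mulVec_diagonal, Function.comp, Pi.star_apply]
    refine Finset.sum_congr rfl fun i _ => ?_
    rw [mul_left_comm, Complex.star_def, ← Complex.normSq_eq_conj_mul_self]
    change ((hA.eigenvalues i : ℂ) * _).re = _
    rw [Complex.re_ofReal_mul, Complex.ofReal_re, Complex.normSq_eq_norm_sq]

open Classical in
/-- The number of eigenvalues with the property `p`. -/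
noncomputable def indexOf (hA : A.IsHermitian) (p : ℝ → Prop) : ℕ :=
  (Finset.univ.filter fun i => p (hA.eigenvalues i)).card

theorem indexOf_add_indexOf_not (hA : A.IsHermitian) (p : ℝ → Prop) :
    indexOf hA p + indexOf hA (fun t => ¬ p t) = Fintype.card n := by
  classical
  unfold indexOf
  rw [Finset.card_filter_add_card_filter_not, Finset.card_univ]

-- The subspace is spanned by the eigenvectors whose eigenvalue satisfies `p`; `y` is the vector of
-- coordinates of `x` in the eigenbasis.
open Classical in
theorem exists_spectral_subspace (hA : A.IsHermitian) (p : ℝ → Prop) :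
    ∃ W : Submodule ℂ (n → ℂ), Module.finrank ℂ W = indexOf hA p ∧
      ∀ x ∈ W, x ≠ 0 → ∃ y : n → ℂ, y ≠ 0 ∧ (∀ i, y i ≠ 0 → p (hA.eigenvalues i)) ∧
        quadForm A x = ∑ i, hA.eigenvalues i * ‖y i‖ ^ 2 := by
  obtain ⟨U, hU⟩ := exists_quadForm_eq_sum hA
  let L : ({i // p (hA.eigenvalues i)} → ℂ) →ₗ[ℂ] (n → ℂ) :=
    Function.ExtendByZero.linearMap ℂ Subtype.val
  have hL : ∀ z, L z = Function.extend Subtype.val z 0 := fun z => rfl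
  have hinj : Function.Injective (U.toLinearMap ∘ₗ L) := by
    refine U.injective.comp fun z w hzw => ?_
    rw [hL, hL] at hzw
    exact Function.extend_injective Subtype.val_injective (0 : n → ℂ) hzw
  refine ⟨LinearMap.range (U.toLinearMap ∘ₗ L), ?_, ?_⟩
  · rw [LinearMap.finrank_range_of_inj hinj, Module.finrank_fintype_fun_eq_card,
      Fintype.card_subtype, indexOf]
  · rintro _ ⟨z, rfl⟩ hz
    refine ⟨L z, fun h0 => hz (by simp [h0]), fun i hi => ?_, ?_⟩
    · by_contra hp
      refine hi ?_
      rw [hL]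
      refine Function.extend_apply' _ _ _ ?_
      rintro ⟨a, rfl⟩
      exact hp a.2
    · exact hU _

theorem exists_subspace_neg (hA : A.IsHermitian) :
    ∃ W : Submodule ℂ (n → ℂ), Module.finrank ℂ W = indexOf hA (· < 0) ∧
      ∀ x ∈ W, x ≠ 0 → quadForm A x < 0 := by
  obtain ⟨W, hW, h⟩ := exists_spectral_subspace hA (· < 0)
  refine ⟨W, hW, fun x hx hx0 => ?_⟩
  obtain ⟨y, hy0, hy, hq⟩ := h x hx hx0
  obtain ⟨i, hi⟩ := Function.ne_iff.mp hy0
  rw [hq]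
  refine Finset.sum_neg' (fun j _ => ?_) ⟨i, Finset.mem_univ i, ?_⟩
  · by_cases hj : y j = 0
    · simp [hj]
    · exact mul_nonpos_of_nonpos_of_nonneg (hy j hj).le (by positivity)
  · have : 0 < ‖y i‖ := norm_pos_iff.mpr hi
    exact mul_neg_of_neg_of_pos (hy i hi) (by positivity)

theorem exists_subspace_pos (hA : A.IsHermitian) :
    ∃ W : Submodule ℂ (n → ℂ), Module.finrank ℂ W = indexOf hA (0 < ·) ∧
      ∀ x ∈ W, x ≠ 0 → 0 < quadForm A x := by
  obtain ⟨W, hW, h⟩ := exists_spectral_subspace hA (0 < ·)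
  refine ⟨W, hW, fun x hx hx0 => ?_⟩
  obtain ⟨y, hy0, hy, hq⟩ := h x hx hx0
  obtain ⟨i, hi⟩ := Function.ne_iff.mp hy0
  rw [hq]
  refine Finset.sum_pos' (fun j _ => ?_) ⟨i, Finset.mem_univ i, ?_⟩
  · by_cases hj : y j = 0
    · simp [hj]
    · exact mul_nonneg (hy j hj).le (by positivity)
  · have : 0 < ‖y i‖ := norm_pos_iff.mpr hi
    exact mul_pos (hy i hi) (by positivity)

theorem exists_subspace_nonneg (hA : A.IsHermitian) :
    ∃ W : Submodule ℂ (n → ℂ), Module.finrank ℂ W = indexOf hA (fun t => ¬ t < 0) ∧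
      ∀ x ∈ W, 0 ≤ quadForm A x := by
  obtain ⟨W, hW, h⟩ := exists_spectral_subspace hA (fun t => ¬ t < 0)
  refine ⟨W, hW, fun x hx => ?_⟩
  by_cases hx0 : x = 0
  · simp [hx0, quadForm]
  obtain ⟨y, -, hy, hq⟩ := h x hx hx0
  rw [hq]
  refine Finset.sum_nonneg fun j _ => ?_
  by_cases hj : y j = 0
  · simp [hj]
  · exact mul_nonneg (not_lt.mp (hy j hj)) (by positivity)

theorem exists_subspace_nonpos (hA : A.IsHermitian) :
    ∃ W : Submodule ℂ (n → ℂ), Module.finrank ℂ W = indexOf hA (fun t => ¬ 0 < t) ∧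
      ∀ x ∈ W, quadForm A x ≤ 0 := by
  obtain ⟨W, hW, h⟩ := exists_spectral_subspace hA (fun t => ¬ 0 < t)
  refine ⟨W, hW, fun x hx => ?_⟩
  by_cases hx0 : x = 0
  · simp [hx0, quadForm]
  obtain ⟨y, -, hy, hq⟩ := h x hx hx0
  rw [hq]
  refine Finset.sum_nonpos fun j _ => ?_
  by_cases hj : y j = 0
  · simp [hj]
  · exact mul_nonpos_of_nonpos_of_nonneg (not_lt.mp (hy j hj)) (by positivity)

theorem finrank_add_le_card_of_disjoint {W W' : Submodule ℂ (n → ℂ)}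
    (h : ∀ x ∈ W, x ∈ W' → x = 0) :
    Module.finrank ℂ W + Module.finrank ℂ W' ≤ Fintype.card n := by
  have := Submodule.finrank_add_finrank_le_of_disjoint
    (Submodule.disjoint_def.mpr fun x hx hx' => h x hx hx')
  rwa [Module.finrank_fintype_fun_eq_card] at this

/-- A negative definite subspace meets the spectral subspace of the nonnegative eigenvalues only in
zero, which bounds its dimension. The next two lemmas are variants of this. -/
theorem finrank_le_morseIndex (hA : A.IsHermitian) {W : Submodule ℂ (n → ℂ)}
    (hW : ∀ x ∈ W, x ≠ 0 → quadForm A x < 0) : Module.finrank ℂ W ≤ indexOf hA (· < 0) := by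
  obtain ⟨W', hW', h⟩ := exists_subspace_nonneg hA
  have h1 := finrank_add_le_card_of_disjoint (W := W) (W' := W') fun x hx hx' => by
    by_contra h0
    exact absurd (hW x hx h0) (not_lt.mpr (h x hx'))
  have h2 := indexOf_add_indexOf_not hA (· < 0)
  omega

theorem finrank_le_positiveIndex (hA : A.IsHermitian) {W : Submodule ℂ (n → ℂ)}
    (hW : ∀ x ∈ W, x ≠ 0 → 0 < quadForm A x) : Module.finrank ℂ W ≤ indexOf hA (0 < ·) := by
  obtain ⟨W', hW', h⟩ := exists_subspace_nonpos hA
  have h1 := finrank_add_le_card_of_disjoint (W := W) (W' := W') fun x hx hx' => by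
    by_contra h0
    exact absurd (hW x hx h0) (not_lt.mpr (h x hx'))
  have h2 := indexOf_add_indexOf_not hA (0 < ·)
  omega

theorem finrank_add_morseIndex_le (hA : A.IsHermitian) {W : Submodule ℂ (n → ℂ)}
    (hW : ∀ x ∈ W, 0 ≤ quadForm A x) :
    Module.finrank ℂ W + indexOf hA (· < 0) ≤ Fintype.card n := by
  obtain ⟨W', hW', h⟩ := exists_subspace_neg hA
  have h1 := finrank_add_le_card_of_disjoint (W := W) (W' := W') fun x hx hx' => by
    by_contra h0
    exact absurd (h x hx' h0) (not_lt.mpr (hW x hx))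
  omega

theorem indexOf_neg_eq_zero (hA : A.IsHermitian) (h : ∀ x, 0 ≤ quadForm A x) :
    indexOf hA (· < 0) = 0 := by
  have := finrank_add_morseIndex_le hA (W := ⊤) fun x _ => h x
  rw [finrank_top, Module.finrank_fintype_fun_eq_card] at this
  omega

theorem nullity_eq_indexOf (hA : A.IsHermitian) : nullity A = indexOf hA (· = 0) := by
  classical
  have h1 := LinearMap.finrank_range_add_finrank_ker A.mulVecLin
  have h2 := hA.rank_eq_card_non_zero_eigs
  rw [Module.finrank_fintype_fun_eq_card] at h1
  have h3 := indexOf_add_indexOf_not hA (· = 0)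
  rw [Matrix.rank, Fintype.card_subtype] at h2
  have h4 : indexOf hA (fun t => ¬ t = 0) = 
      (Finset.univ.filter fun i => hA.eigenvalues i ≠ 0).card := by
    unfold indexOf
    congr!
  unfold nullity
  omega

theorem indexOf_add_nullity_add (hA : A.IsHermitian) :
    indexOf hA (· < 0) + nullity A + indexOf hA (0 < ·) = Fintype.card n := by
  classical
  rw [nullity_eq_indexOf hA, ← indexOf_add_indexOf_not hA (0 < ·), add_comm, add_left_cancel_iff]
  unfold indexOf
  rw [← Finset.card_union_of_disjoint]
  · congr 1
    ext i
    simp [le_iff_lt_or_eq]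
  · rw [Finset.disjoint_filter]
    intro i _ h
    exact h.ne

theorem bijective_mulVec_of_nullity_eq_zero (h : nullity A = 0) :
    Function.Bijective A.mulVec := by
  have h1 : Function.Injective A.mulVecLin := by
    rw [← LinearMap.ker_eq_bot]
    exact Submodule.finrank_eq_zero.mp h
  exact ⟨h1, LinearMap.injective_iff_surjective.mp h1⟩

/-- Negativity on the unit sphere of `W` is an open condition on `t` because the sphere is compact;
scaling extends it to all of `W`. -/
theorem eventually_quadForm_neg {M : ℝ → Matrix n n ℂ} {t₀ : ℝ} (hM : ContinuousAt M t₀)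
    {W : Submodule ℂ (n → ℂ)} (hW : ∀ x ∈ W, x ≠ 0 → quadForm (M t₀) x < 0) :
    ∀ᶠ t in 𝓝 t₀, ∀ x ∈ W, x ≠ 0 → quadForm (M t) x < 0 := by
  have hK : IsCompact ((W : Set (n → ℂ)) ∩ Metric.sphere 0 1) :=
    (isCompact_sphere 0 1).inter_left W.closed_of_finiteDimensional
  have hcont : Continuous fun p : Matrix n n ℂ × (n → ℂ) => quadForm p.1 p.2 := by
    unfold quadForm
    exact Complex.continuous_re.comp
      ((continuous_snd.star).dotProduct (continuous_fst.matrix_mulVec continuous_snd))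
  have hev : ∀ y ∈ (W : Set (n → ℂ)) ∩ Metric.sphere 0 1,
      ∀ᶠ z : ℝ × (n → ℂ) in 𝓝 (t₀, y), quadForm (M z.1) z.2 < 0 := by
    intro y hy
    have h0 : quadForm (M t₀) y < 0 := hW y hy.1 fun h0 => by
      have := hy.2
      simp [h0] at this
    have h1 : Tendsto (fun z : ℝ × (n → ℂ) => M z.1) (𝓝 (t₀, y)) (𝓝 (M t₀)) :=
      hM.tendsto.comp continuousAt_fst
    have h2 : Tendsto (fun z : ℝ × (n → ℂ) => z.2) (𝓝 (t₀, y)) (𝓝 y) := continuousAt_snd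
    have h3 := (hcont.tendsto (M t₀, y)).comp (h1.prodMk_nhds h2)
    exact h3.eventually_lt_const h0
  have := hK.eventually_forall_of_forall_eventually
    (P := fun t x => quadForm (M t) x < 0) hev
  filter_upwards [this] with t ht x hx hx0
  have hn : (0 : ℝ) < ‖x‖ := norm_pos_iff.mpr hx0
  have h1 := ht (((‖x‖⁻¹ : ℝ) : ℂ) • x) ⟨W.smul_mem _ hx, by
    simp [norm_smul, hn.ne']⟩
  rw [quadForm_smul] at h1
  by_contra h2
  exact absurd h1 (not_lt.mpr (mul_nonneg (by positivity) (not_lt.mp h2)))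

/-- `M` is a family of Hermitian matrices that is continuous and strictly decreasing on `s`. -/
structure IsDecreasingFamily (M : ℝ → Matrix n n ℂ) (s : Set ℝ) : Prop where
  herm : ∀ t, (M t).IsHermitian
  cont : ∀ t ∈ s, ContinuousAt M t
  anti : ∀ t ∈ s, ∀ t' ∈ s, t < t' → ∀ x, x ≠ 0 → quadForm (M t') x < quadForm (M t) x

variable {M : ℝ → Matrix n n ℂ} {s : Set ℝ} {t₀ : ℝ}

/-- The nonpositive spectral subspace at `t` has dimension index plus nullity, and strict decrease
makes the form at `t'` negative definite on it. -/
theorem IsDecreasingFamily.index_add_nullity_le (hM : IsDecreasingFamily M s) {t t' : ℝ}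
    (ht : t ∈ s) (ht' : t' ∈ s) (h : t < t') :
    indexOf (hM.herm t) (· < 0) + nullity (M t) ≤ indexOf (hM.herm t') (· < 0) := by
  obtain ⟨W, hW, h1⟩ := exists_subspace_nonpos (hM.herm t)
  have h2 := finrank_le_morseIndex (hM.herm t') (W := W) fun x hx hx0 =>
    (hM.anti t ht t' ht' h x hx0).trans_le (h1 x hx)
  have h3 := indexOf_add_nullity_add (hM.herm t)
  have h4 := indexOf_add_indexOf_not (hM.herm t) (0 < ·)
  omega

/-- Negative and positive directions at `t₀` persist nearby by continuity. So the index is lower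
semicontinuous, and index plus nullity, which complements the positive index, is upper
semicontinuous. -/
theorem IsDecreasingFamily.eventually_le_index (hM : IsDecreasingFamily M s) (ht : t₀ ∈ s) :
    ∀ᶠ t in 𝓝 t₀, indexOf (hM.herm t₀) (· < 0) ≤ indexOf (hM.herm t) (· < 0) ∧
      indexOf (hM.herm t) (· < 0) + nullity (M t) ≤
        indexOf (hM.herm t₀) (· < 0) + nullity (M t₀) := by
  obtain ⟨W, hW, h1⟩ := exists_subspace_neg (hM.herm t₀)
  obtain ⟨W', hW', h1'⟩ := exists_subspace_pos (hM.herm t₀)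
  filter_upwards [eventually_quadForm_neg (hM.cont t₀ ht) h1,
    eventually_quadForm_neg (M := fun t => -M t) (hM.cont t₀ ht).neg (W := W') fun x hx hx0 => by
      simpa [quadForm_neg] using h1' x hx hx0] with t ha hb
  have h2 := finrank_le_morseIndex (hM.herm t) ha
  have h3 := finrank_le_positiveIndex (hM.herm t) (W := W') fun x hx hx0 => by
    simpa [quadForm_neg] using hb x hx hx0
  have h4 := indexOf_add_nullity_add (hM.herm t)
  have h5 := indexOf_add_nullity_add (hM.herm t₀)
  omega

/-- Monotonicity bounds the index at `t` below by index plus nullity at `t₀`, and semicontinuity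
bounds index plus nullity at `t` above by the same number. To the left of `t₀`, in `eventually_lt`,
the two bounds enclose the index at `t₀` instead. -/
theorem IsDecreasingFamily.eventually_gt (hM : IsDecreasingFamily M s) (hs : IsOpen s)
    (ht : t₀ ∈ s) : ∀ᶠ t in 𝓝[>] t₀, nullity (M t) = 0 ∧
      indexOf (hM.herm t) (· < 0) = indexOf (hM.herm t₀) (· < 0) + nullity (M t₀) := by
  filter_upwards [nhdsWithin_le_nhds (hM.eventually_le_index ht), self_mem_nhdsWithin,
    nhdsWithin_le_nhds (hs.mem_nhds ht)] with t h1 h2 h3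
  have := hM.index_add_nullity_le ht h3 h2
  omega

theorem IsDecreasingFamily.eventually_lt (hM : IsDecreasingFamily M s) (hs : IsOpen s)
    (ht : t₀ ∈ s) : ∀ᶠ t in 𝓝[<] t₀, nullity (M t) = 0 ∧
      indexOf (hM.herm t) (· < 0) = indexOf (hM.herm t₀) (· < 0) := by
  filter_upwards [nhdsWithin_le_nhds (hM.eventually_le_index ht), self_mem_nhdsWithin,
    nhdsWithin_le_nhds (hs.mem_nhds ht)] with t h1 h2 h3
  have := hM.index_add_nullity_le h3 ht h2
  omega

/-- If the kernels of a decreasing family are counted by `m`, and nothing is counted below `a`,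
where the family is nonnegative, then the Morse index at `b` counts the crossings below `b`. -/
theorem IsDecreasingFamily.encard_eq_index (hM : IsDecreasingFamily M s) (hs : IsOpen s)
    (hs' : s.OrdConnected) {m : ℝ → ℕ∞} (hm : ∀ t ∈ s, m t = nullity (M t)) {a b : ℝ}
    (ha : a ∈ s) (hb : b ∈ s) (hma : ∀ t < a, m t = 0)
    (hMa : indexOf (hM.herm a) (· < 0) = 0) :
    {q : ℝ × ℕ | (q.2 : ℕ∞) < m q.1 ∧ q.1 < b}.encard = indexOf (hM.herm b) (· < 0) := by
  have hs'' : IsPreconnected s := hs'.isPreconnected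
  let C : ℝ → ℕ∞ := fun b => {q : ℝ × ℕ | (q.2 : ℕ∞) < m q.1 ∧ q.1 < b}.encard
  have hzero : ∀ {t}, t ∈ s → nullity (M t) = 0 → m t = 0 := fun {t} ht h => by
    rw [hm t ht, h]; rfl
  -- Truth of the claim is locally constant on the interval `s`: when a point is passed, both sides
  -- grow by its nullity. At `a` both sides vanish.
  refine hs''.induction₂ (fun x y => C x = indexOf (hM.herm x) (· < 0) ↔
    C y = indexOf (hM.herm y) (· < 0)) ?_ (fun x y z _ _ _ h h' => h.trans h')
    (fun x y _ _ h => h.symm) ha hb |>.mp ?_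
  · intro x hx
    refine nhdsWithin_le_nhds ?_
    have hr := hM.eventually_gt hs hx
    have hl := hM.eventually_lt hs hx
    obtain ⟨r, hxr, hr⟩ := (mem_nhdsGT_iff_exists_Ioo_subset' (lt_add_one x)).mp hr
    obtain ⟨l, hlx, hl⟩ := (mem_nhdsLT_iff_exists_Ioo_subset' (sub_one_lt x)).mp hl
    filter_upwards [Ioo_mem_nhds hlx hxr, hs.mem_nhds hx] with y hy hys
    rcases lt_trichotomy y x with hyx | rfl | hxy
    · have h1 := hl ⟨hy.1, hyx⟩
      have h2 : C y = C x := by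
        refine congrArg Set.encard (Set.ext fun q => and_congr_right fun hq => ?_)
        refine ⟨fun h => h.trans hyx, fun h => ?_⟩
        by_contra h3
        have h4 : q.1 ∈ Set.Ioo l x := ⟨hy.1.trans_le (not_lt.mp h3), h⟩
        rw [hzero (hs'.out hys hx ⟨not_lt.mp h3, h.le⟩) (hl h4).1] at hq
        exact not_lt_bot hq
      rw [h2, h1.2]
    · exact Iff.rfl
    · have h1 := hr ⟨hxy, hy.2⟩
      have h2 : C y = C x + nullity (M x) := by
        have hset : {q : ℝ × ℕ | (q.2 : ℕ∞) < m q.1 ∧ q.1 < y} =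
            {q : ℝ × ℕ | (q.2 : ℕ∞) < m q.1 ∧ q.1 < x} ∪
              (fun i : ℕ => (x, i)) '' (Finset.range (nullity (M x))) := by
          ext ⟨t, i⟩
          simp only [Set.mem_ofPred_eq, Set.mem_union, Set.mem_image, Finset.coe_range,
            Set.mem_Iio, Prod.mk.injEq]
          constructor
          · rintro ⟨h3, h4⟩
            rcases lt_trichotomy t x with h5 | rfl | h5
            · exact Or.inl ⟨h3, h5⟩
            · right
              refine ⟨i, ?_, rfl, rfl⟩
              rw [hm t hx] at h3
              exact_mod_cast h3
            · rw [hzero (hs'.out hx hys ⟨h5.le, h4.le⟩) (hr ⟨h5, h4.trans hy.2⟩).1] at h3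
              exact absurd h3 not_lt_bot
          · rintro (⟨h3, h4⟩ | ⟨j, hj, rfl, rfl⟩)
            · exact ⟨h3, h4.trans hxy⟩
            · refine ⟨?_, hxy⟩
              rw [hm x hx]
              exact_mod_cast hj
        change Set.encard _ = Set.encard _ + _
        rw [hset, Set.encard_union_eq]
        · rw [Function.Injective.encard_image (fun i j h => (Prod.mk.inj h).2)]
          rw [Set.encard_coe_eq_coe_finsetCard, Finset.card_range]
        · rw [Set.disjoint_left]
          rintro ⟨t, i⟩ ⟨-, h3⟩ ⟨j, -, h4⟩
          exact h3.ne (Prod.mk.inj h4).1.symm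
      -- The count might still be infinite here; cancellation only needs the added nullity to be
      -- finite.
      rw [h2, h1.2, Nat.cast_add]
      exact (WithTop.add_right_inj (ENat.natCast_ne_top _)).symm
  · rw [hMa]
    change Set.encard _ = _
    rw [Nat.cast_zero, Set.encard_eq_zero, Set.eq_empty_iff_forall_notMem]
    rintro q ⟨h1, h2⟩
    rw [hma _ h2] at h1
    exact not_lt_bot h1

/-- Additivity of the Morse index under an orthogonal decomposition of the quadratic form. -/
theorem indexOf_eq_add {p r : Type*} [Fintype p] [Fintype r] {S : Matrix p p ℂ}
    {D : Matrix r r ℂ} (hA : A.IsHermitian) (hS : S.IsHermitian) (hD : D.IsHermitian)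
    (Θ : ((p → ℂ) × (r → ℂ)) ≃ₗ[ℂ] (n → ℂ))
    (hΘ : ∀ y z, quadForm A (Θ (y, z)) = quadForm S y + quadForm D z) :
    indexOf hA (· < 0) = indexOf hS (· < 0) + indexOf hD (· < 0) := by
  -- Products of negative subspaces bound the index of `A` from below, products of nonnegative
  -- spectral subspaces bound it from above, and the two bounds agree.
  let Φ (W : Submodule ℂ (p → ℂ)) (W' : Submodule ℂ (r → ℂ)) : (W × W') →ₗ[ℂ] (n → ℂ) :=
    Θ.toLinearMap ∘ₗ W.subtype.prodMap W'.subtype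
  have hdim : ∀ (W : Submodule ℂ (p → ℂ)) (W' : Submodule ℂ (r → ℂ)),
      Module.finrank ℂ (LinearMap.range (Φ W W')) =
        Module.finrank ℂ W + Module.finrank ℂ W' := fun W W' => by
    rw [LinearMap.finrank_range_of_inj, Module.finrank_prod]
    exact Θ.injective.comp (W.injective_subtype.prodMap W'.injective_subtype)
  have hcard : Fintype.card n = Fintype.card p + Fintype.card r := by
    have := Θ.finrank_eq
    rwa [Module.finrank_prod, Module.finrank_fintype_fun_eq_card,
      Module.finrank_fintype_fun_eq_card, Module.finrank_fintype_fun_eq_card, eq_comm] at this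
  obtain ⟨W, hW, h1⟩ := exists_subspace_neg hS
  obtain ⟨W', hW', h1'⟩ := exists_subspace_neg hD
  have h2 := finrank_le_morseIndex hA (W := LinearMap.range (Φ W W')) (by
    rintro _ ⟨⟨⟨y, hy⟩, ⟨z, hz⟩⟩, rfl⟩ h0
    change quadForm A (Θ (y, z)) < 0
    rw [hΘ]
    have hy' : quadForm S y ≤ 0 := by
      by_cases h : y = 0
      · simp [h, quadForm]
      · exact (h1 y hy h).le
    have hz' : quadForm D z ≤ 0 := by
      by_cases h : z = 0
      · simp [h, quadForm]
      · exact (h1' z hz h).le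
    by_cases h : y = 0
    · have hz0 : z ≠ 0 := fun hz0 => h0 (by simp [Φ, h, hz0])
      linarith [h1' z hz hz0]
    · linarith [h1 y hy h])
  obtain ⟨X, hX, h3⟩ := exists_subspace_nonneg hS
  obtain ⟨X', hX', h3'⟩ := exists_subspace_nonneg hD
  have h4 := finrank_add_morseIndex_le hA (W := LinearMap.range (Φ X X')) (by
    rintro _ ⟨⟨⟨y, hy⟩, ⟨z, hz⟩⟩, rfl⟩
    change 0 ≤ quadForm A (Θ (y, z))
    rw [hΘ]
    exact add_nonneg (h3 y hy) (h3' z hz))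
  rw [hdim] at h2 h4
  have h5 := indexOf_add_indexOf_not hS (· < 0)
  have h6 := indexOf_add_indexOf_not hD (· < 0)
  omega

end HermitianForms

/-! ### Schur complements -/

section SchurComplement

open Matrix

variable {n p r : Type*} [Fintype n] [Fintype p] [Fintype r]

theorem quadForm_submatrix (M : Matrix n n ℂ) (e : p ≃ n) (x : p → ℂ) :
    quadForm (M.submatrix e e) x = quadForm M (x ∘ e.symm) := by
  unfold quadForm
  rw [submatrix_mulVec_equiv]
  congr 1
  simp only [dotProduct]
  exact Fintype.sum_equiv e _ _ fun i => by simp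

/-- The Schur complement of a non-degenerate diagonal block. -/
theorem exists_schur_complement {M : Matrix n n ℂ} (hM : M.IsHermitian) (e : p ⊕ r ≃ n)
    (hD : nullity (M.submatrix (e ∘ Sum.inr) (e ∘ Sum.inr)) = 0) :
    ∃ (S : Matrix p p ℂ) (hS : S.IsHermitian),
      indexOf hM (· < 0) = indexOf hS (· < 0) +
        indexOf (hM.submatrix (e ∘ Sum.inr)) (· < 0) ∧
      ∀ ξ : p → ℂ, ∃ x : n → ℂ, (∀ i, x (e (Sum.inl i)) = ξ i) ∧
        (∀ j, (M *ᵥ x) (e (Sum.inr j)) = 0) ∧ ∀ i, (M *ᵥ x) (e (Sum.inl i)) = (S *ᵥ ξ) i := by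
  classical
  set D : Matrix r r ℂ := M.submatrix (e ∘ Sum.inr) (e ∘ Sum.inr) with hDdef
  set B : Matrix p r ℂ := M.submatrix (e ∘ Sum.inl) (e ∘ Sum.inr) with hBdef
  set A : Matrix p p ℂ := M.submatrix (e ∘ Sum.inl) (e ∘ Sum.inl) with hAdef
  have hDh : D.IsHermitian := hM.submatrix _
  have hAh : A.IsHermitian := hM.submatrix _
  have hDu : IsUnit D :=
    mulVec_injective_iff_isUnit.mp (bijective_mulVec_of_nullity_eq_zero hD).1
  have hDdet : IsUnit D.det := (isUnit_iff_isUnit_det D).mp hDu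
  have hblock : M.submatrix e e = fromBlocks A B Bᴴ D := by
    ext i j
    rcases i with i | i <;> rcases j with j | j <;> simp [A, B, D]
    exact (hM.apply _ _).symm
  have hSh : (A - B * D⁻¹ * Bᴴ).IsHermitian :=
    hAh.sub (isHermitian_mul_mul_conjTranspose B hDh.inv)
  refine ⟨A - B * D⁻¹ * Bᴴ, hSh, ?_, fun ξ => ?_⟩
  · let K : (p → ℂ) →ₗ[ℂ] (r → ℂ) := (D⁻¹ * Bᴴ).mulVecLin
    -- This shear completes the square: in the new coordinates the form of `M` is the sum of those
    -- of the Schur complement and of `D`.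
    let Θ : ((p → ℂ) × (r → ℂ)) ≃ₗ[ℂ] (n → ℂ) :=
      { toFun := fun y => Sum.elim y.1 (y.2 - K y.1) ∘ e.symm
        invFun := fun x => (fun i => x (e (Sum.inl i)),
          (fun j => x (e (Sum.inr j))) + K fun i => x (e (Sum.inl i)))
        map_add' := fun y z => by
          ext i
          obtain ⟨i, rfl⟩ := e.surjective i
          rcases i with i | i <;> simp
          ring
        map_smul' := fun c y => by
          ext i
          obtain ⟨i, rfl⟩ := e.surjective i
          rcases i with i | i <;> simp
          ring
        left_inv := fun y => by
          refine Prod.ext ?_ ?_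
          · ext i; simp
          · ext i
            simp
        right_inv := fun x => by
          ext i
          obtain ⟨i, rfl⟩ := e.surjective i
          rcases i with i | i <;> simp }
    refine indexOf_eq_add hM hSh hDh Θ fun y z => ?_
    change quadForm M (Sum.elim y (z - K y) ∘ e.symm) = _
    rw [← quadForm_submatrix, hblock]
    let := hDu.invertible
    unfold quadForm
    rw [dotProduct_mulVec, schur_complement_eq₂₂ A B y _ hDh, Complex.add_re]
    have : (D⁻¹ * Bᴴ) *ᵥ y + (z - K y) = z := by
      change (D⁻¹ * Bᴴ) *ᵥ y + (z - (D⁻¹ * Bᴴ) *ᵥ y) = z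
      abel
    rw [this, ← dotProduct_mulVec, ← dotProduct_mulVec, add_comm]
  -- The second component is the one that solves the rows of the block `D`.
  · refine ⟨Sum.elim ξ (-((D⁻¹ * Bᴴ) *ᵥ ξ)) ∘ e.symm, fun i => by simp, ?_⟩
    have key : ∀ k, (M *ᵥ (Sum.elim ξ (-((D⁻¹ * Bᴴ) *ᵥ ξ)) ∘ e.symm)) (e k) =
        (fromBlocks A B Bᴴ D *ᵥ Sum.elim ξ (-((D⁻¹ * Bᴴ) *ᵥ ξ))) k := fun k => by
      rw [← hblock, submatrix_mulVec_equiv]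
      rfl
    constructor
    · intro j
      rw [key, fromBlocks_mulVec]
      simp only [Sum.elim_inr, Sum.elim_comp_inl, Sum.elim_comp_inr]
      rw [mulVec_neg, mulVec_mulVec, ← Matrix.mul_assoc, mul_nonsing_inv _ hDdet, Matrix.one_mul]
      simp
    · intro i
      rw [key, fromBlocks_mulVec]
      simp only [Sum.elim_inl, Sum.elim_comp_inl, Sum.elim_comp_inr]
      rw [mulVec_neg, mulVec_mulVec, ← Matrix.mul_assoc, sub_mulVec, sub_eq_add_neg]

end SchurComplement

/-! ### Solutions of -u'' = μu on an interval -/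

section Solutions

open Filter Topology Set

/-- The solution of `-u'' = μ u` with `u(0) = 1` and `u'(0) = 0`. -/
noncomputable def cosSol (μ x : ℝ) : ℝ := Real.cos (√μ * x) * Real.cosh (√(-μ) * x)

/-- The solution of `-u'' = μ u` with `u(0) = 0` and `u'(0) = 1`. -/
noncomputable def sinSol (μ x : ℝ) : ℝ := ∫ t in (0 : ℝ)..x, cosSol μ t

@[simp] theorem cosSol_zero (μ : ℝ) : cosSol μ 0 = 1 := by simp [cosSol]

@[simp] theorem sinSol_zero (μ : ℝ) : sinSol μ 0 = 0 := by simp [sinSol]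

theorem continuous_cosSol : Continuous (Function.uncurry cosSol) := by
  unfold cosSol Function.uncurry
  fun_prop

/-- As a primitive of `cosSol`, `sinSol` is jointly continuous without any exception at `μ = 0`,
where a formula such as sin(√μ x)/√μ would degenerate. -/
theorem continuous_sinSol : Continuous (Function.uncurry sinSol) :=
  intervalIntegral.continuous_parametric_primitive_of_continuous continuous_cosSol

theorem continuous_cosSol_right (μ : ℝ) : Continuous (cosSol μ) :=
  continuous_cosSol.comp (Continuous.prodMk_right μ)

theorem continuous_cosSol_left (x : ℝ) : Continuous fun μ => cosSol μ x :=
  continuous_cosSol.comp (Continuous.prodMk_left x)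

theorem continuous_sinSol_left (x : ℝ) : Continuous fun μ => sinSol μ x :=
  continuous_sinSol.comp (Continuous.prodMk_left x)

theorem hasDerivAt_sinSol (μ x : ℝ) : HasDerivAt (sinSol μ) (cosSol μ x) x :=
  intervalIntegral.integral_hasDerivAt_right
    ((continuous_cosSol_right μ).intervalIntegrable _ _)
    (continuous_cosSol_right μ).stronglyMeasurable.stronglyMeasurableAtFilter
    (continuous_cosSol_right μ).continuousAt

/-- The real square root is zero on negative numbers, so for each sign of `μ` one of the two factors
of `cosSol` is identically one. -/
theorem hasDerivAt_cosSol (μ x : ℝ) : HasDerivAt (cosSol μ) (-μ * sinSol μ x) x := by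
  rcases le_total 0 μ with h | h
  · have h0 : √(-μ) = 0 := Real.sqrt_eq_zero_of_nonpos (by linarith)
    have hc : cosSol μ = fun x => Real.cos (√μ * x) := by
      funext x
      simp [cosSol, h0]
    have hd : ∀ x, HasDerivAt (cosSol μ) (-(√μ * Real.sin (√μ * x))) x := fun x => by
      rw [hc]
      have := (Real.hasDerivAt_cos (√μ * x)).comp x ((hasDerivAt_id x).const_mul √μ)
      refine this.congr_deriv ?_
      simp only [mul_one]
      ring
    have hs : ∀ x, HasDerivAt (fun x => √μ * Real.sin (√μ * x)) (μ * cosSol μ x) x := fun x => by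
      rw [hc]
      have := ((Real.hasDerivAt_sin (√μ * x)).comp x ((hasDerivAt_id x).const_mul √μ)).const_mul √μ
      refine this.congr_deriv ?_
      linear_combination Real.cos (√μ * x) * Real.mul_self_sqrt h
    have hval := intervalIntegral.integral_eq_sub_of_hasDerivAt (a := 0) (b := x)
      (fun y _ => hs y) (((continuous_cosSol_right μ).const_mul μ).intervalIntegrable _ _)
    rw [intervalIntegral.integral_const_mul] at hval
    convert hd x using 1
    simp only [mul_zero, Real.sin_zero, sub_zero] at hval
    rw [sinSol, neg_mul, hval]
  · have h0 : √μ = 0 := Real.sqrt_eq_zero_of_nonpos h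
    have hc : cosSol μ = fun x => Real.cosh (√(-μ) * x) := by
      funext x
      simp [cosSol, h0]
    have hd : ∀ x, HasDerivAt (cosSol μ) (√(-μ) * Real.sinh (√(-μ) * x)) x := fun x => by
      rw [hc]
      have := (Real.hasDerivAt_cosh (√(-μ) * x)).comp x ((hasDerivAt_id x).const_mul √(-μ))
      refine this.congr_deriv ?_
      simp only [mul_one]
      ring
    have hs : ∀ x, HasDerivAt (fun x => √(-μ) * Real.sinh (√(-μ) * x)) (-μ * cosSol μ x) x :=
      fun x => by
        rw [hc]
        have := ((Real.hasDerivAt_sinh (√(-μ) * x)).comp x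
          ((hasDerivAt_id x).const_mul √(-μ))).const_mul √(-μ)
        refine this.congr_deriv ?_
        linear_combination Real.cosh (√(-μ) * x) * Real.mul_self_sqrt (show 0 ≤ -μ by linarith)
    have hval := intervalIntegral.integral_eq_sub_of_hasDerivAt (a := 0) (b := x)
      (fun y _ => hs y) (((continuous_cosSol_right μ).const_mul (-μ)).intervalIntegrable _ _)
    rw [intervalIntegral.integral_const_mul] at hval
    convert hd x using 1
    simp only [mul_zero, Real.sinh_zero, sub_zero] at hval
    rw [sinSol, hval]

/-- This is the Wronskian of `cosSol` and `sinSol`, which is constant; it makes the fundamental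
matrix invertible. -/
theorem cosSol_sq_add (μ x : ℝ) : cosSol μ x ^ 2 + μ * sinSol μ x ^ 2 = 1 := by
  have hd : ∀ x, HasDerivAt (fun x => cosSol μ x ^ 2 + μ * sinSol μ x ^ 2) 0 x := fun x => by
    have := ((hasDerivAt_cosSol μ x).pow 2).add (((hasDerivAt_sinSol μ x).pow 2).const_mul μ)
    refine this.congr_deriv ?_
    simp
    ring
  have := is_const_of_deriv_eq_zero (fun x => (hd x).differentiableAt) (fun x => (hd x).deriv) x 0
  simpa using this

/-- The solution of `-u'' = μ u` with `u(0) = a` and `u'(0) = d`. -/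
noncomputable def sol (μ : ℝ) (a d : ℂ) (x : ℝ) : ℂ := a * cosSol μ x + d * sinSol μ x

/-- The derivative of `sol`. -/
noncomputable def solDeriv (μ : ℝ) (a d : ℂ) (x : ℝ) : ℂ :=
  d * cosSol μ x - μ * (a * sinSol μ x)

@[simp] theorem sol_zero (μ : ℝ) (a d : ℂ) : sol μ a d 0 = a := by simp [sol]

@[simp] theorem solDeriv_zero (μ : ℝ) (a d : ℂ) : solDeriv μ a d 0 = d := by simp [solDeriv]

theorem hasDerivAt_sol (μ : ℝ) (a d : ℂ) (x : ℝ) :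
    HasDerivAt (sol μ a d) (solDeriv μ a d x) x := by
  have := (((hasDerivAt_cosSol μ x).ofReal_comp).const_mul a).add
    (((hasDerivAt_sinSol μ x).ofReal_comp).const_mul d)
  refine this.congr_deriv ?_
  unfold solDeriv
  push_cast
  ring

theorem hasDerivAt_solDeriv (μ : ℝ) (a d : ℂ) (x : ℝ) :
    HasDerivAt (solDeriv μ a d) (-(μ * sol μ a d x)) x := by
  have := (((hasDerivAt_cosSol μ x).ofReal_comp).const_mul d).sub
    ((((hasDerivAt_sinSol μ x).ofReal_comp).const_mul a).const_mul (μ : ℂ))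
  refine this.congr_deriv ?_
  unfold sol
  push_cast
  ring

theorem continuous_sol (μ : ℝ) (a d : ℂ) : Continuous (sol μ a d) :=
  continuous_iff_continuousAt.mpr fun x => (hasDerivAt_sol μ a d x).continuousAt

/-- Uniqueness: applying the inverse of the fundamental matrix to `(F, G)` gives the two expressions
in `d1` and `d2`, which have derivative zero and hence keep their initial values. -/
theorem eq_sol_of_hasDerivWithinAt {μ ℓ : ℝ} {F G : ℝ → ℂ}
    (hF : ∀ x ∈ Icc 0 ℓ, HasDerivWithinAt F (G x) (Icc 0 ℓ) x)
    (hG : ∀ x ∈ Icc 0 ℓ, HasDerivWithinAt G (-(μ * F x)) (Icc 0 ℓ) x) :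
    ∀ x ∈ Icc 0 ℓ, F x = sol μ (F 0) (G 0) x ∧ G x = solDeriv μ (F 0) (G 0) x := by
  intro x hx
  rcases hx.1.eq_or_lt with rfl | hx0
  · simp
  have hu : UniqueDiffOn ℝ (Icc 0 ℓ) := uniqueDiffOn_Icc (hx0.trans_le hx.2)
  have hc := fun x => (hasDerivAt_cosSol μ x).ofReal_comp
  have hs := fun x => (hasDerivAt_sinSol μ x).ofReal_comp
  have d1 : ∀ x ∈ Icc 0 ℓ, HasDerivWithinAt (fun x => F x * cosSol μ x - G x * sinSol μ x) 0
      (Icc 0 ℓ) x := fun x hx => by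
    have := ((hF x hx).mul (hc x).hasDerivWithinAt).sub ((hG x hx).mul (hs x).hasDerivWithinAt)
    refine this.congr_deriv ?_
    push_cast
    ring
  have d2 : ∀ x ∈ Icc 0 ℓ, HasDerivWithinAt
      (fun x => μ * (F x * sinSol μ x) + G x * cosSol μ x) 0 (Icc 0 ℓ) x := fun x hx => by
    have := (((hF x hx).mul (hs x).hasDerivWithinAt).const_mul (μ : ℂ)).add
      ((hG x hx).mul (hc x).hasDerivWithinAt)
    refine this.congr_deriv ?_
    push_cast
    ring
  have e1 := constant_of_derivWithin_zero (fun x hx => (d1 x hx).differentiableWithinAt)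
    (fun x hx => (d1 x (Ico_subset_Icc_self hx)).derivWithin (hu x (Ico_subset_Icc_self hx))) x hx
  have e2 := constant_of_derivWithin_zero (fun x hx => (d2 x hx).differentiableWithinAt)
    (fun x hx => (d2 x (Ico_subset_Icc_self hx)).derivWithin (hu x (Ico_subset_Icc_self hx))) x hx
  have e3 : (cosSol μ x : ℂ) ^ 2 + μ * (sinSol μ x : ℂ) ^ 2 = 1 := by
    exact_mod_cast cosSol_sq_add μ x
  simp only [cosSol_zero, sinSol_zero, Complex.ofReal_one, Complex.ofReal_zero, mul_one, mul_zero,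
    sub_zero, zero_add] at e1 e2
  unfold sol solDeriv
  constructor
  · rw [← e1, ← e2]
    linear_combination (-F x) * e3
  · rw [← e1, ← e2]
    linear_combination (-G x) * e3

/-- The equation is autonomous, so the translate by `x` is again a solution and is determined by its
data at `x`. The double-angle formulas and the gluing of edges come from this. -/
theorem sol_add {μ x y : ℝ} (a d : ℂ) (hy : 0 ≤ y) :
    sol μ a d (x + y) = sol μ (sol μ a d x) (solDeriv μ a d x) y ∧
      solDeriv μ a d (x + y) = solDeriv μ (sol μ a d x) (solDeriv μ a d x) y := by
  have := eq_sol_of_hasDerivWithinAt (μ := μ) (ℓ := y) (F := fun t => sol μ a d (x + t))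
    (G := fun t => solDeriv μ a d (x + t))
    (fun t _ => ((hasDerivAt_sol μ a d (x + t)).comp_const_add x t).hasDerivWithinAt)
    (fun t _ => ((hasDerivAt_solDeriv μ a d (x + t)).comp_const_add x t).hasDerivWithinAt)
    y ⟨hy, le_rfl⟩
  simpa using this

theorem cosSol_two_mul {μ x : ℝ} (hx : 0 ≤ x) :
    cosSol μ (2 * x) = cosSol μ x ^ 2 - μ * sinSol μ x ^ 2 := by
  have := (sol_add (μ := μ) (x := x) 1 0 hx).1
  rw [← two_mul] at this
  simp only [sol, solDeriv] at this
  have h : (cosSol μ (2 * x) : ℂ) = cosSol μ x ^ 2 - μ * sinSol μ x ^ 2 := by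
    linear_combination this
  exact_mod_cast h

theorem sinSol_two_mul {μ x : ℝ} (hx : 0 ≤ x) :
    sinSol μ (2 * x) = 2 * sinSol μ x * cosSol μ x := by
  have := (sol_add (μ := μ) (x := x) 0 1 hx).1
  rw [← two_mul] at this
  simp only [sol, solDeriv] at this
  have h : (sinSol μ (2 * x) : ℂ) = 2 * sinSol μ x * cosSol μ x := by
    linear_combination this
  exact_mod_cast h

theorem derivWithin_eq_of_eqOn_sol {μ ℓ : ℝ} (hℓ : 0 < ℓ) {F : ℝ → ℂ} {a d : ℂ}
    (h : ∀ x ∈ Icc 0 ℓ, F x = sol μ a d x) {x : ℝ} (hx : x ∈ Icc 0 ℓ) :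
    derivWithin F (Icc 0 ℓ) x = solDeriv μ a d x :=
  ((hasDerivAt_sol μ a d x).hasDerivWithinAt.congr h (h x hx)).derivWithin
    (uniqueDiffOn_Icc hℓ x hx)

/-- The solutions of `-F'' = μ F` in `H²`. -/
theorem hasSecondDeriv_iff {μ ℓ : ℝ} (hℓ : 0 < ℓ) {F : ℝ → ℂ} :
    HasSecondDeriv ℓ F (fun x => -((μ : ℂ) * F x)) ↔
      ∃ a d, ∀ x ∈ Icc 0 ℓ, F x = sol μ a d x := by
  constructor
  · rintro ⟨h1, -, h3⟩
    set G : ℝ → ℂ := derivWithin F (Icc 0 ℓ) with hG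
    -- The extension of `F` by its end values makes the integrand continuous on the whole line, so
    -- that the integral is differentiable also at the ends of the interval.
    let F' : ℝ → ℂ := IccExtend hℓ.le ((Icc 0 ℓ).domRestrict F)
    have hF' : Continuous F' := (h1.continuousOn.domRestrict).Icc_extend'
    have hFF' : ∀ x ∈ Icc 0 ℓ, F' x = F x := fun x hx => IccExtend_of_mem _ _ hx
    have h4 : ∀ x ∈ Icc 0 ℓ, G x = G 0 + ∫ t in (0 : ℝ)..x, -((μ : ℂ) * F' t) := fun x hx => by
      rw [h3 x hx]
      congr 1
      refine intervalIntegral.integral_congr fun t ht => ?_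
      rw [uIcc_of_le hx.1] at ht
      simp only [hFF' t ⟨ht.1, ht.2.trans hx.2⟩]
    have hcont : Continuous fun t => -((μ : ℂ) * F' t) := by fun_prop
    have h5 : ∀ x ∈ Icc 0 ℓ, HasDerivWithinAt G (-(μ * F x)) (Icc 0 ℓ) x := fun x hx => by
      have := (intervalIntegral.integral_hasDerivAt_right (hcont.intervalIntegrable 0 x)
        hcont.stronglyMeasurable.stronglyMeasurableAtFilter hcont.continuousAt).const_add (G 0)
      rw [← hFF' x hx]
      exact this.hasDerivWithinAt.congr h4 (h4 x hx)
    exact ⟨F 0, G 0, fun x hx => (eq_sol_of_hasDerivWithinAt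
      (fun x hx => (h1 x hx).hasDerivWithinAt) h5 x hx).1⟩
  · rintro ⟨a, d, h⟩
    refine ⟨fun x hx => ((hasDerivAt_sol μ a d x).hasDerivWithinAt.congr h
      (h x hx)).differentiableWithinAt, ?_, fun x hx => ?_⟩
    · have hc : Continuous fun x => -((μ : ℂ) * sol μ a d x) := by
        have := continuous_sol μ a d
        fun_prop
      obtain ⟨C, hC⟩ := isCompact_Icc.exists_bound_of_continuousOn (s := Icc 0 ℓ) hc.continuousOn
      have : MeasureTheory.MemLp (fun x => -((μ : ℂ) * sol μ a d x)) 2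
          (MeasureTheory.volume.restrict (Icc 0 ℓ)) :=
        MeasureTheory.MemLp.of_bound hc.aestronglyMeasurable C
          ((MeasureTheory.ae_restrict_iff' measurableSet_Icc).mpr (Eventually.of_forall hC))
      refine this.ae_eq ?_
      refine (MeasureTheory.ae_restrict_iff' measurableSet_Icc).mpr (Eventually.of_forall ?_)
      intro x hx
      simp only [h x hx]
    · rw [derivWithin_eq_of_eqOn_sol hℓ h hx, derivWithin_eq_of_eqOn_sol hℓ h ⟨le_rfl, hℓ.le⟩]
      have hc : Continuous fun x => -((μ : ℂ) * sol μ a d x) := by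
        have := continuous_sol μ a d
        fun_prop
      have h1 := intervalIntegral.integral_eq_sub_of_hasDerivAt (a := 0) (b := x)
        (fun y _ => hasDerivAt_solDeriv μ a d y) (hc.intervalIntegrable _ _)
      have h2 : ∫ t in (0 : ℝ)..x, -((μ : ℂ) * F t) = ∫ t in (0 : ℝ)..x, -((μ : ℂ) * sol μ a d t) := by
        refine intervalIntegral.integral_congr fun t ht => ?_
        rw [uIcc_of_le hx.1] at ht
        simp only [h t ⟨ht.1, ht.2.trans hx.2⟩]
      rw [h2, h1]
      ring

/-- For `μ ≥ 0` the argument of the cosine stays below `π / 2`; for `μ ≤ 0` the cosine factor is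
identically one. -/
theorem cosSol_pos {μ x y : ℝ} (hμ : μ * y ^ 2 < (Real.pi / 2) ^ 2) (hx : x ∈ Icc 0 y) :
    0 < cosSol μ x := by
  refine mul_pos (Real.cos_pos_of_mem_Ioo ?_) (Real.cosh_pos _)
  have h1 : 0 ≤ √μ * x := mul_nonneg (Real.sqrt_nonneg _) hx.1
  refine ⟨by linarith [Real.pi_pos], ?_⟩
  have h2 : √μ * x ≤ √μ * y := mul_le_mul_of_nonneg_left hx.2 (Real.sqrt_nonneg _)
  refine h2.trans_lt ?_
  rcases le_total 0 μ with h | h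
  · refine lt_of_pow_lt_pow_left₀ 2 (by positivity) ?_
    rwa [mul_pow, Real.sq_sqrt h]
  · rw [Real.sqrt_eq_zero_of_nonpos h]
    simp [Real.pi_pos]

theorem sinSol_pos {μ x y : ℝ} (hμ : μ * y ^ 2 < (Real.pi / 2) ^ 2) (hx : x ∈ Ioc 0 y) :
    0 < sinSol μ x :=
  intervalIntegral.intervalIntegral_pos_of_pos_on
    ((continuous_cosSol_right μ).intervalIntegrable _ _)
    (fun _ ht => cosSol_pos hμ ⟨ht.1.le, ht.2.le.trans hx.2⟩) hx.1

/-- The logarithmic derivative of `cosSol`. -/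
noncomputable def tanCoef (μ y : ℝ) : ℝ := -μ * sinSol μ y / cosSol μ y

/-- The logarithmic derivative of `sinSol`. -/
noncomputable def cotCoef (μ y : ℝ) : ℝ := cosSol μ y / sinSol μ y

/-- Sturm comparison: the Wronskian of the solutions at `μ` and `ν` starts at zero and has
derivative `(μ - ν)` times a positive product. The same argument with `sinSol` gives `cotCoef_lt`.
-/
theorem tanCoef_lt {μ ν y : ℝ} (hy : 0 < y) (hμν : μ < ν)
    (hν : ν * y ^ 2 < (Real.pi / 2) ^ 2) : tanCoef ν y < tanCoef μ y := by
  have hμ : μ * y ^ 2 < (Real.pi / 2) ^ 2 := lt_trans (by gcongr) hν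
  have hd : ∀ x, HasDerivAt (fun x => cosSol μ x * (-ν * sinSol ν x) -
      (-μ * sinSol μ x) * cosSol ν x) ((μ - ν) * (cosSol μ x * cosSol ν x)) x := fun x => by
    have := ((hasDerivAt_cosSol μ x).mul ((hasDerivAt_sinSol ν x).const_mul (-ν))).sub
      (((hasDerivAt_sinSol μ x).const_mul (-μ)).mul (hasDerivAt_cosSol ν x))
    refine this.congr_deriv ?_
    ring
  have h := strictAntiOn_of_deriv_neg (convex_Icc 0 y)
    (fun x _ => (hd x).continuousAt.continuousWithinAt) (fun x hx => by
      rw [interior_Icc] at hx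
      rw [(hd x).deriv]
      exact mul_neg_of_neg_of_pos (by linarith) (mul_pos (cosSol_pos hμ (Ioo_subset_Icc_self hx))
        (cosSol_pos hν (Ioo_subset_Icc_self hx))))
    (left_mem_Icc.mpr hy.le) (right_mem_Icc.mpr hy.le) hy
  simp only [sinSol_zero, mul_zero, zero_mul, sub_zero] at h
  have h1 := cosSol_pos hμ (right_mem_Icc.mpr hy.le)
  have h2 := cosSol_pos hν (right_mem_Icc.mpr hy.le)
  unfold tanCoef
  rw [div_lt_div_iff₀ h2 h1]
  linarith

theorem cotCoef_lt {μ ν y : ℝ} (hy : 0 < y) (hμν : μ < ν)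
    (hν : ν * y ^ 2 < (Real.pi / 2) ^ 2) : cotCoef ν y < cotCoef μ y := by
  have hμ : μ * y ^ 2 < (Real.pi / 2) ^ 2 := lt_trans (by gcongr) hν
  have hd : ∀ x, HasDerivAt (fun x => sinSol μ x * cosSol ν x - cosSol μ x * sinSol ν x)
      ((μ - ν) * (sinSol μ x * sinSol ν x)) x := fun x => by
    have := ((hasDerivAt_sinSol μ x).mul (hasDerivAt_cosSol ν x)).sub
      ((hasDerivAt_cosSol μ x).mul (hasDerivAt_sinSol ν x))
    refine this.congr_deriv ?_
    ring
  have h := strictAntiOn_of_deriv_neg (convex_Icc 0 y)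
    (fun x _ => (hd x).continuousAt.continuousWithinAt) (fun x hx => by
      rw [interior_Icc] at hx
      rw [(hd x).deriv]
      exact mul_neg_of_neg_of_pos (by linarith) (mul_pos (sinSol_pos hμ (Ioo_subset_Ioc_self hx))
        (sinSol_pos hν (Ioo_subset_Ioc_self hx))))
    (left_mem_Icc.mpr hy.le) (right_mem_Icc.mpr hy.le) hy
  simp only [sinSol_zero, mul_zero, zero_mul, sub_zero] at h
  have h1 := sinSol_pos hμ (right_mem_Ioc.mpr hy)
  have h2 := sinSol_pos hν (right_mem_Ioc.mpr hy)
  unfold cotCoef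
  rw [div_lt_div_iff₀ h2 h1]
  linarith

theorem continuousAt_tanCoef {μ y : ℝ} (hy : 0 < y) (hμ : μ * y ^ 2 < (Real.pi / 2) ^ 2) :
    ContinuousAt (fun μ => tanCoef μ y) μ :=
  ((continuous_id.neg.mul (continuous_sinSol_left y)).continuousAt).div
    (continuous_cosSol_left y).continuousAt (cosSol_pos hμ (right_mem_Icc.mpr hy.le)).ne'

theorem continuousAt_cotCoef {μ y : ℝ} (hy : 0 < y) (hμ : μ * y ^ 2 < (Real.pi / 2) ^ 2) :
    ContinuousAt (fun μ => cotCoef μ y) μ :=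
  (continuous_cosSol_left y).continuousAt.div
    (continuous_sinSol_left y).continuousAt (sinSol_pos hμ (right_mem_Ioc.mpr hy)).ne'

/-- On an interval of length `2y` the reflection-even and reflection-odd data are eigenvectors of
the Dirichlet-to-Neumann matrix, with eigenvalues `tanCoef μ y` and `cotCoef μ y`. Half the sum is
therefore its diagonal entry, and half the difference, in the next lemma, is minus its off-diagonal
entry. -/
theorem coef_add_div_two {μ y : ℝ} (hy : 0 < y) (hμ : μ * y ^ 2 < (Real.pi / 2) ^ 2) :
    (cotCoef μ y + tanCoef μ y) / 2 = cosSol μ (2 * y) / sinSol μ (2 * y) := by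
  have h1 := cosSol_pos hμ (right_mem_Icc.mpr hy.le)
  have h2 := sinSol_pos hμ (right_mem_Ioc.mpr hy)
  rw [cosSol_two_mul hy.le, sinSol_two_mul hy.le, cotCoef, tanCoef]
  field_simp
  ring

theorem coef_sub_div_two {μ y : ℝ} (hy : 0 < y) (hμ : μ * y ^ 2 < (Real.pi / 2) ^ 2) :
    (cotCoef μ y - tanCoef μ y) / 2 = 1 / sinSol μ (2 * y) := by
  have h1 := cosSol_pos hμ (right_mem_Icc.mpr hy.le)
  have h2 := sinSol_pos hμ (right_mem_Ioc.mpr hy)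
  rw [← cosSol_sq_add μ y, sinSol_two_mul hy.le, cotCoef, tanCoef]
  field_simp
  ring

theorem sinSol_two_mul_pos {μ y : ℝ} (hy : 0 < y) (hμ : μ * y ^ 2 < (Real.pi / 2) ^ 2) :
    0 < sinSol μ (2 * y) := by
  have h1 := cosSol_pos hμ (right_mem_Icc.mpr hy.le)
  have h2 := sinSol_pos hμ (right_mem_Ioc.mpr hy)
  rw [sinSol_two_mul hy.le]
  positivity

end Solutions

/-! ### Solutions on the edges and their boundary data -/

section EdgeSolutions

open Set

variable {V E : Type*} (G : MetricGraph V E)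

/-- On every edge `f` is the solution of `-u'' = μ u` with the initial values `a` and `d`. -/
def IsSol (μ : ℝ) (f : E → ℝ → ℂ) (a d : E → ℂ) : Prop :=
  ∀ e, ∀ x ∈ Icc 0 (G.len e), f e x = sol μ (a e) (d e) x

variable {G}

theorem exists_isSol_iff {μ : ℝ} {f : E → ℝ → ℂ} :
    (∀ e, HasSecondDeriv (G.len e) (f e) (fun x => -((μ : ℂ) * f e x))) ↔
      ∃ a d, G.IsSol μ f a d := by
  constructor
  · intro h
    choose a d had using fun e => (hasSecondDeriv_iff (G.len_pos e)).mp (h e)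
    exact ⟨a, d, had⟩
  · rintro ⟨a, d, h⟩ e
    exact (hasSecondDeriv_iff (G.len_pos e)).mpr ⟨a e, d e, h e⟩

variable {μ : ℝ} {f : E → ℝ → ℂ} {a d : E → ℂ}

theorem IsSol.endValue (hf : G.IsSol μ f a d) (h : E × Bool) :
    G.endValue f h = if h.2 then sol μ (a h.1) (d h.1) (G.len h.1) else a h.1 := by
  have hp := (G.len_pos h.1).le
  unfold MetricGraph.endValue
  rw [hf h.1 _ ⟨hp, le_rfl⟩, hf h.1 0 ⟨le_rfl, hp⟩, sol_zero]

theorem IsSol.outDeriv (hf : G.IsSol μ f a d) (h : E × Bool) :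
    G.outDeriv f h = if h.2 then -solDeriv μ (a h.1) (d h.1) (G.len h.1) else d h.1 := by
  have hp := (G.len_pos h.1).le
  unfold MetricGraph.outDeriv
  rw [derivWithin_eq_of_eqOn_sol (G.len_pos h.1) (hf h.1) ⟨hp, le_rfl⟩,
    derivWithin_eq_of_eqOn_sol (G.len_pos h.1) (hf h.1) ⟨le_rfl, hp⟩, solDeriv_zero]

open Classical in
/-- The function on the graph given by solutions on the edges, extended by zero. -/
noncomputable def solFun (G : MetricGraph V E) (μ : ℝ) (a d : E → ℂ) : E → ℝ → ℂ := fun e x =>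
  if x ∈ Icc 0 (G.len e) then sol μ (a e) (d e) x else 0

theorem isSol_solFun (μ : ℝ) (a d : E → ℂ) : G.IsSol μ (G.solFun μ a d) a d :=
  fun _ _ hx => if_pos hx

theorem solFun_of_notMem (μ : ℝ) (a d : E → ℂ) (e : E) {x : ℝ} (hx : x ∉ Icc 0 (G.len e)) :
    G.solFun μ a d e x = 0 := if_neg hx

/-- The row of the Dirichlet-to-Neumann matrix of `[0, 2y]` that belongs to the end `0`. On an edge
of length `4y` this is the first half; `solDeriv_len_eq` is the row at the far end of the second
half. -/
theorem solDeriv_zero_eq {μ y : ℝ} (hy : 0 < y) (hμ : μ * y ^ 2 < (Real.pi / 2) ^ 2) (a d : ℂ) :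
    (((cotCoef μ y + tanCoef μ y) / 2 : ℝ) : ℂ) * a -
      (((cotCoef μ y - tanCoef μ y) / 2 : ℝ) : ℂ) * sol μ a d (2 * y) = -d := by
  have hs := sinSol_two_mul_pos hy hμ
  have hs' : (sinSol μ (2 * y) : ℂ) ≠ 0 := by exact_mod_cast hs.ne'
  rw [coef_add_div_two hy hμ, coef_sub_div_two hy hμ, sol]
  push_cast
  field_simp
  ring

theorem solDeriv_len_eq {μ y : ℝ} (hy : 0 < y) (hμ : μ * y ^ 2 < (Real.pi / 2) ^ 2) (a d : ℂ) :
    (((cotCoef μ y + tanCoef μ y) / 2 : ℝ) : ℂ) * sol μ a d (4 * y) -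
      (((cotCoef μ y - tanCoef μ y) / 2 : ℝ) : ℂ) * sol μ a d (2 * y) =
        solDeriv μ a d (4 * y) := by
  have hs := sinSol_two_mul_pos hy hμ
  have hs' : (sinSol μ (2 * y) : ℂ) ≠ 0 := by exact_mod_cast hs.ne'
  have h4 : (4 : ℝ) * y = 2 * y + 2 * y := by ring
  have h1 := (sol_add (μ := μ) (x := 2 * y) a d (by positivity : 0 ≤ 2 * y))
  rw [h4, h1.1, h1.2, coef_add_div_two hy hμ, coef_sub_div_two hy hμ]
  have e3 : (cosSol μ (2 * y) : ℂ) ^ 2 + μ * (sinSol μ (2 * y) : ℂ) ^ 2 = 1 := by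
    exact_mod_cast cosSol_sq_add μ (2 * y)
  generalize sol μ a d (2 * y) = A
  generalize solDeriv μ a d (2 * y) = B
  unfold sol solDeriv
  push_cast
  field_simp
  linear_combination A * e3

end EdgeSolutions

/-! ### The Dirichlet-to-Neumann matrix on vertices and midpoints -/

section VertexMatrix

open Matrix Set

variable {V E : Type*} [Fintype E] (G : MetricGraph V E)

/-- The diagonal coefficient of the Dirichlet-to-Neumann matrix of half of the edge `e`. -/
noncomputable def diagCoef (μ : ℝ) (e : E) : ℝ :=
  (cotCoef μ (G.len e / 4) + tanCoef μ (G.len e / 4)) / 2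

/-- The negative of the off-diagonal coefficient of the Dirichlet-to-Neumann matrix of half of the
edge `e`. -/
noncomputable def offCoef (μ : ℝ) (e : E) : ℝ :=
  (cotCoef μ (G.len e / 4) - tanCoef μ (G.len e / 4)) / 2

open Classical in
/-- The Dirichlet-to-Neumann matrix of the set of all vertices and all midpoints of edges. -/
noncomputable def vertexMatrix (μ : ℝ) : Matrix (V ⊕ E) (V ⊕ E) ℂ :=
  ∑ h : E × Bool,
    (((tanCoef μ (G.len h.1 / 4) / 2 : ℝ) : ℂ) •
        vecMulVec (Pi.single (Sum.inl (G.endpoint h)) 1 + Pi.single (Sum.inr h.1) 1)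
          (Pi.single (Sum.inl (G.endpoint h)) 1 + Pi.single (Sum.inr h.1) 1) +
      ((cotCoef μ (G.len h.1 / 4) / 2 : ℝ) : ℂ) •
        vecMulVec (Pi.single (Sum.inl (G.endpoint h)) 1 - Pi.single (Sum.inr h.1) 1)
          (Pi.single (Sum.inl (G.endpoint h)) 1 - Pi.single (Sum.inr h.1) 1))

variable {G} {μ : ℝ}

theorem isHermitian_vertexMatrix (μ : ℝ) : (G.vertexMatrix μ).IsHermitian := by
  classical
  have key : ∀ (r : ℝ) (w : V ⊕ E → ℂ), star w = w → ((r : ℂ) • vecMulVec w w).IsHermitian := by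
    intro r w hw
    rw [IsHermitian, conjTranspose_smul, conjTranspose_vecMulVec, hw]
    simp
  unfold vertexMatrix
  rw [IsHermitian, conjTranspose_sum]
  refine Finset.sum_congr rfl fun h _ => IsHermitian.add (key _ _ ?_) (key _ _ ?_)
  · rw [star_add, ← Pi.single_star, ← Pi.single_star, star_one]
  · rw [star_sub, ← Pi.single_star, ← Pi.single_star, star_one]

variable [Fintype V]

theorem vertexMatrix_mulVec (μ : ℝ) (x : V ⊕ E → ℂ) (i : V ⊕ E) [DecidableEq (V ⊕ E)] :
    (G.vertexMatrix μ *ᵥ x) i = ∑ h : E × Bool,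
      ((G.diagCoef μ h.1 * x (Sum.inl (G.endpoint h)) - G.offCoef μ h.1 * x (Sum.inr h.1)) *
          (if i = Sum.inl (G.endpoint h) then 1 else 0) +
        (G.diagCoef μ h.1 * x (Sum.inr h.1) - G.offCoef μ h.1 * x (Sum.inl (G.endpoint h))) *
          (if i = Sum.inr h.1 then 1 else 0)) := by
  unfold vertexMatrix
  rw [sum_mulVec, Finset.sum_apply]
  refine Finset.sum_congr rfl fun h _ => ?_
  rw [add_mulVec, smul_mulVec, smul_mulVec, vecMulVec_mulVec, vecMulVec_mulVec]
  simp only [Pi.add_apply, Pi.smul_apply, Pi.sub_apply, MulOpposite.smul_eq_mul_unop,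
    MulOpposite.unop_op, smul_eq_mul, add_dotProduct, sub_dotProduct, single_dotProduct,
    Pi.single_apply, diagCoef, offCoef, one_mul]
  push_cast
  split_ifs <;> ring

theorem vertexMatrix_mulVec_inl [DecidableEq V] (μ : ℝ) (x : V ⊕ E → ℂ) (v : V) :
    (G.vertexMatrix μ *ᵥ x) (Sum.inl v) = ∑ h : E × Bool with G.endpoint h = v,
      (G.diagCoef μ h.1 * x (Sum.inl (G.endpoint h)) - G.offCoef μ h.1 * x (Sum.inr h.1)) := by
  classical
  rw [vertexMatrix_mulVec, Finset.sum_filter]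
  refine Finset.sum_congr rfl fun h _ => ?_
  by_cases hv : G.endpoint h = v
  · simp [hv]
  · simp [hv, Ne.symm hv]

theorem vertexMatrix_mulVec_inr (μ : ℝ) (x : V ⊕ E → ℂ) (e : E) :
    (G.vertexMatrix μ *ᵥ x) (Sum.inr e) = ∑ b : Bool,
      (G.diagCoef μ e * x (Sum.inr e) - G.offCoef μ e * x (Sum.inl (G.endpoint (e, b)))) := by
  classical
  rw [vertexMatrix_mulVec, Fintype.sum_prod_type, Finset.sum_eq_single e]
  · simp
  · intro e' _ he
    simp [Ne.symm he]
  · simp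

/-- Splitting the data of each half edge into even and odd parts reduces monotonicity and positivity
of the form to those of the scalars `tanCoef` and `cotCoef`. -/
theorem quadForm_vertexMatrix (μ : ℝ) (x : V ⊕ E → ℂ) :
    quadForm (G.vertexMatrix μ) x = ∑ h : E × Bool,
      (tanCoef μ (G.len h.1 / 4) / 2 * ‖x (Sum.inl (G.endpoint h)) + x (Sum.inr h.1)‖ ^ 2 +
        cotCoef μ (G.len h.1 / 4) / 2 * ‖x (Sum.inl (G.endpoint h)) - x (Sum.inr h.1)‖ ^ 2) := by
  classical
  have key : ∀ (r : ℝ) (w : V ⊕ E → ℂ), star w = w →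
      (star x ⬝ᵥ ((r : ℂ) • vecMulVec w w) *ᵥ x).re = r * ‖w ⬝ᵥ x‖ ^ 2 := by
    intro r w hw
    have h1 : star x ⬝ᵥ w = star (w ⬝ᵥ x) := by
      rw [star_dotProduct, hw, dotProduct_comm, dotProduct_comm]
    rw [smul_mulVec, vecMulVec_mulVec, dotProduct_smul, op_smul_eq_smul, dotProduct_smul, h1,
      smul_eq_mul, smul_eq_mul, Complex.re_ofReal_mul, mul_comm (w ⬝ᵥ x), Complex.star_def,
      ← Complex.normSq_eq_conj_mul_self, Complex.ofReal_re, Complex.normSq_eq_norm_sq]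
  unfold quadForm vertexMatrix
  rw [sum_mulVec, dotProduct_sum, Complex.re_sum]
  refine Finset.sum_congr rfl fun h _ => ?_
  rw [add_mulVec, dotProduct_add, Complex.add_re, key, key]
  · simp only [add_dotProduct, sub_dotProduct, single_dotProduct, one_mul]
  · rw [star_sub, ← Pi.single_star, ← Pi.single_star, star_one]
  · rw [star_add, ← Pi.single_star, ← Pi.single_star, star_one]

end VertexMatrix

/-! ### Monotonicity of the vertex matrix, and its kernel as the eigenspace -/

section VertexMatrixSolutions

open Matrix Set

variable {V E : Type*} (G : MetricGraph V E)

/-- The spectral parameter `μ` is small compared to the lengths of the edges. -/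
def IsSubcritical (μ : ℝ) : Prop := ∀ e, μ * (G.len e / 4) ^ 2 < (Real.pi / 2) ^ 2

variable {G} {μ ν : ℝ}

theorem IsSubcritical.mono (h : G.IsSubcritical ν) (hμ : μ ≤ ν) : G.IsSubcritical μ := fun e =>
  (mul_le_mul_of_nonneg_right hμ (sq_nonneg _)).trans_lt (h e)

theorem isSubcritical_of_nonpos (hμ : μ ≤ 0) : G.IsSubcritical μ := fun e =>
  (mul_nonpos_of_nonpos_of_nonneg hμ (sq_nonneg _)).trans_lt (by positivity)

theorem isOpen_isSubcritical [Finite E] : IsOpen {μ | G.IsSubcritical μ} := by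
  simp only [IsSubcritical, Set.ofPred_forall]
  exact isOpen_iInter_of_finite fun e =>
    isOpen_lt (continuous_id.mul continuous_const) continuous_const

theorem ordConnected_isSubcritical : OrdConnected {μ | G.IsSubcritical μ} :=
  ⟨fun _ _ _ hy _ hz => IsSubcritical.mono hy hz.2⟩

theorem offCoef_pos (h : G.IsSubcritical μ) (e : E) : 0 < G.offCoef μ e := by
  have hy : 0 < G.len e / 4 := by have := G.len_pos e; positivity
  rw [offCoef, coef_sub_div_two hy (h e)]
  exact one_div_pos.mpr (sinSol_two_mul_pos hy (h e))

/-- The sum and the difference of `x` and `y` cannot both vanish, so at least one of the two terms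
increases strictly. -/
theorem norm_add_sub_combination_lt {t k t' k' : ℝ} (ht : t < t') (hk : k < k') {x y : ℂ}
    (h : x ≠ 0 ∨ y ≠ 0) : t / 2 * ‖x + y‖ ^ 2 + k / 2 * ‖x - y‖ ^ 2 <
      t' / 2 * ‖x + y‖ ^ 2 + k' / 2 * ‖x - y‖ ^ 2 := by
  by_cases h1 : x + y = 0
  · have h2 : x - y ≠ 0 := fun h2 => by
      have hx : x = 0 := by linear_combination (h1 + h2) / 2
      have hy : y = 0 := by linear_combination (h1 - h2) / 2
      tauto
    have h3 : 0 < ‖x - y‖ := norm_pos_iff.mpr h2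
    have h4 : k / 2 * ‖x - y‖ ^ 2 < k' / 2 * ‖x - y‖ ^ 2 := by gcongr
    rw [h1]
    simpa using h4
  · have h3 : 0 < ‖x + y‖ := norm_pos_iff.mpr h1
    have h4 : t / 2 * ‖x + y‖ ^ 2 < t' / 2 * ‖x + y‖ ^ 2 := by gcongr
    have h5 : k / 2 * ‖x - y‖ ^ 2 ≤ k' / 2 * ‖x - y‖ ^ 2 := by gcongr
    linarith

/-- Without isolated vertices every coordinate enters the form of some half edge, so strictness on
half edges yields strictness of the whole form. -/
theorem exists_end_ne_zero (hI : ∀ v, ∃ h, G.endpoint h = v) {x : V ⊕ E → ℂ} (hx : x ≠ 0) :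
    ∃ h : E × Bool, x (Sum.inl (G.endpoint h)) ≠ 0 ∨ x (Sum.inr h.1) ≠ 0 := by
  obtain ⟨i, hi⟩ := Function.ne_iff.mp hx
  rcases i with v | e
  · obtain ⟨h, rfl⟩ := hI v
    exact ⟨h, Or.inl hi⟩
  · exact ⟨(e, false), Or.inr hi⟩

theorem endValue_add {R : Type*} [Add R] (f g : E → ℝ → R) (h : E × Bool) :
    G.endValue (f + g) h = G.endValue f h + G.endValue g h := by
  unfold endValue
  split_ifs <;> rfl

theorem endValue_smul (c : ℂ) (f : E → ℝ → ℂ) (h : E × Bool) :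
    G.endValue (c • f) h = c * G.endValue f h := by
  unfold endValue
  split_ifs <;> rfl

/-- In the subcritical range half of an edge has no Dirichlet eigenfunction: `sinSol` is positive at
`len e / 2`. -/
theorem IsSol.eq_zero_of_midpoint (hμ : G.IsSubcritical μ) {f : E → ℝ → ℂ} {a d : E → ℂ}
    (hf : G.IsSol μ f a d) {e : E} (ha : a e = 0) (hm : f e (G.len e / 2) = 0) : d e = 0 := by
  have hy : 0 < G.len e / 4 := by linarith [G.len_pos e]
  have hs := sinSol_two_mul_pos hy (hμ e)
  rw [show 2 * (G.len e / 4) = G.len e / 2 by ring] at hs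
  rw [hf e _ (by constructor <;> linarith [G.len_pos e]), sol, ha, zero_mul, zero_add,
    mul_eq_zero] at hm
  exact hm.resolve_right fun h => absurd (by exact_mod_cast h) hs.ne'

variable [Fintype E]

theorem mem_eigenspace_iff {f : E → ℝ → ℂ} : f ∈ G.eigenspace μ ↔
    (∀ e, ∀ x ∉ Icc 0 (G.len e), f e x = 0) ∧ (∃ a d, G.IsSol μ f a d) ∧
      (∀ h h', G.endpoint h = G.endpoint h' → G.endValue f h = G.endValue f h') ∧
        ∀ v, G.outDerivSum f v = 0 := by
  rw [← exists_isSol_iff]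
  exact ⟨fun h => ⟨h.1, h.2.1, h.2.2, h.2.3⟩, fun h => ⟨h.1, h.2.1, h.2.2.1, h.2.2.2⟩⟩

variable [Fintype V]

theorem isDecreasingFamily_vertexMatrix (hI : ∀ v, ∃ h, G.endpoint h = v) :
    IsDecreasingFamily G.vertexMatrix {μ | G.IsSubcritical μ} where
  herm := isHermitian_vertexMatrix
  cont μ hμ := by
    unfold vertexMatrix
    refine tendsto_finsetSum _ fun h _ => ?_
    have hy : 0 < G.len h.1 / 4 := by have := G.len_pos h.1; positivity
    have h1 := continuousAt_tanCoef hy (hμ h.1)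
    have h2 := continuousAt_cotCoef hy (hμ h.1)
    exact ((Complex.continuous_ofReal.continuousAt.comp (h1.div_const 2)).smul
      continuousAt_const).add ((Complex.continuous_ofReal.continuousAt.comp
        (h2.div_const 2)).smul continuousAt_const)
  anti μ hμ ν hν hlt x hx := by
    rw [quadForm_vertexMatrix, quadForm_vertexMatrix]
    have hy : ∀ e, 0 < G.len e / 4 := fun e => by have := G.len_pos e; positivity
    obtain ⟨h, hh⟩ := exists_end_ne_zero hI hx
    refine Finset.sum_lt_sum (fun h _ => ?_) ⟨h, Finset.mem_univ h, norm_add_sub_combination_lt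
      (tanCoef_lt (hy h.1) hlt (hν h.1)) (cotCoef_lt (hy h.1) hlt (hν h.1)) hh⟩
    have h1 := tanCoef_lt (hy h.1) hlt (hν h.1)
    have h2 := cotCoef_lt (hy h.1) hlt (hν h.1)
    gcongr

/-- All coefficients are positive for negative `μ`, which supplies the starting point of the
eigenvalue count. -/
theorem quadForm_vertexMatrix_pos (hI : ∀ v, ∃ h, G.endpoint h = v) (hμ : μ < 0)
    {x : V ⊕ E → ℂ} (hx : x ≠ 0) : 0 < quadForm (G.vertexMatrix μ) x := by
  have hsub : G.IsSubcritical μ := isSubcritical_of_nonpos hμ.le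
  have hy : ∀ e, 0 < G.len e / 4 := fun e => by have := G.len_pos e; positivity
  have h1 : ∀ e, 0 < tanCoef μ (G.len e / 4) := fun e =>
    div_pos (mul_pos (by linarith) (sinSol_pos (hsub e) (right_mem_Ioc.mpr (hy e))))
      (cosSol_pos (hsub e) (right_mem_Icc.mpr (hy e).le))
  have h2 : ∀ e, 0 < cotCoef μ (G.len e / 4) := fun e =>
    div_pos (cosSol_pos (hsub e) (right_mem_Icc.mpr (hy e).le))
      (sinSol_pos (hsub e) (right_mem_Ioc.mpr (hy e)))
  rw [quadForm_vertexMatrix]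
  obtain ⟨h, hh⟩ := exists_end_ne_zero hI hx
  refine Finset.sum_pos' (fun h _ => ?_) ⟨h, Finset.mem_univ h, ?_⟩
  · have := h1 h.1
    have := h2 h.1
    positivity
  · simpa using norm_add_sub_combination_lt (h1 h.1) (h2 h.1) hh

theorem nullity_eq_zero_of_pos {n : Type*} [Fintype n] {A : Matrix n n ℂ}
    (h : ∀ x, x ≠ 0 → 0 < quadForm A x) : nullity A = 0 := by
  unfold nullity
  rw [Submodule.finrank_eq_zero, LinearMap.ker_eq_bot']
  intro x hx
  by_contra h0
  have := h x h0
  rw [mulVecLin_apply] at hx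
  simp [quadForm, hx] at this

theorem quadForm_submatrix_of_injective {n r : Type*} [Fintype n] [Fintype r] (M : Matrix n n ℂ)
    {ι : r → n} (hι : Function.Injective ι) (x : r → ℂ) :
    quadForm (M.submatrix ι ι) x = quadForm M (Function.extend ι x 0) := by
  classical
  have key : ∀ (w : r → ℂ) (u : n → ℂ),
      ∑ i, Function.extend ι w 0 i * u i = ∑ j, w j * u (ι j) := by
    intro w u
    rw [← Finset.sum_subset (Finset.subset_univ (Finset.univ.image ι))]
    · rw [Finset.sum_image hι.injOn]
      exact Finset.sum_congr rfl fun j _ => by rw [hι.extend_apply]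
    · intro i _ hi
      rw [Function.extend_apply']
      · simp
      · rintro ⟨j, rfl⟩
        exact hi (Finset.mem_image_of_mem _ (Finset.mem_univ j))
  have hstar : star (Function.extend ι x 0) = Function.extend ι (star x) 0 := by
    funext i
    by_cases hi : ∃ j, ι j = i
    · obtain ⟨j, rfl⟩ := hi
      simp [hι.extend_apply]
    · simp [Function.extend_apply' _ _ _ hi]
  unfold quadForm
  rw [hstar]
  congr 1
  simp only [dotProduct, key]
  refine Finset.sum_congr rfl fun j _ => ?_
  congr 1
  simp only [mulVec, dotProduct, submatrix_apply]
  simp only [mul_comm (M _ _), key]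

theorem IsDecreasingFamily.submatrix {n r : Type*} [Fintype n] [Fintype r] {M : ℝ → Matrix n n ℂ}
    {s : Set ℝ} (hM : IsDecreasingFamily M s) {ι : r → n} (hι : Function.Injective ι) :
    IsDecreasingFamily (fun t => (M t).submatrix ι ι) s where
  herm t := (hM.herm t).submatrix ι
  cont t ht := ContinuousAt.comp (g := fun A : Matrix n n ℂ => A.submatrix ι ι)
    (continuous_id.matrix_submatrix ι ι).continuousAt (hM.cont t ht)
  anti t ht t' ht' h x hx := by
    rw [quadForm_submatrix_of_injective _ hι, quadForm_submatrix_of_injective _ hι]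
    refine hM.anti t ht t' ht' h _ fun h0 => hx ?_
    funext j
    have := congrFun h0 (ι j)
    rwa [hι.extend_apply] at this

/-- Solutions on the edges that are continuous at the vertices, in terms of their values at the
vertices and at the midpoints of the edges. -/
theorem vertexMatrix_mulVec_of_isSol (hμ : G.IsSubcritical μ) {f : E → ℝ → ℂ} {a d : E → ℂ}
    (hf : G.IsSol μ f a d) {x : V ⊕ E → ℂ}
    (hv : ∀ h, G.endValue f h = x (Sum.inl (G.endpoint h)))
    (he : ∀ e, f e (G.len e / 2) = x (Sum.inr e)) :
    (∀ e, (G.vertexMatrix μ *ᵥ x) (Sum.inr e) = 0) ∧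
      ∀ v, (G.vertexMatrix μ *ᵥ x) (Sum.inl v) = -G.outDerivSum f v := by
  classical
  have hy : ∀ e, 0 < G.len e / 4 := fun e => by have := G.len_pos e; positivity
  have h2 : ∀ e, 2 * (G.len e / 4) = G.len e / 2 := fun e => by ring
  have h4 : ∀ e, 4 * (G.len e / 4) = G.len e := fun e => by ring
  have hm : ∀ e, x (Sum.inr e) = sol μ (a e) (d e) (G.len e / 2) := fun e => by
    rw [← he, hf e]
    constructor <;> linarith [G.len_pos e]
  have key : ∀ h : E × Bool, G.diagCoef μ h.1 * x (Sum.inl (G.endpoint h)) -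
      G.offCoef μ h.1 * x (Sum.inr h.1) = -G.outDeriv f h := by
    rintro ⟨e, b⟩
    have k1 := solDeriv_zero_eq (hy e) (hμ e) (a e) (d e)
    have k2 := solDeriv_len_eq (hy e) (hμ e) (a e) (d e)
    rw [h2] at k1 k2
    rw [h4] at k2
    rw [← hv, hf.outDeriv, hf.endValue, hm]
    cases b
    · simpa [diagCoef, offCoef] using k1
    · simpa [diagCoef, offCoef] using k2
  constructor
  · intro e
    have k1 := key (e, false)
    have k2 := key (e, true)
    rw [hf.outDeriv] at k1 k2
    have hx0 := hv (e, false)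
    have hx1 := hv (e, true)
    rw [hf.endValue] at hx0 hx1
    simp only [Bool.false_eq_true, if_false, if_true] at k1 k2 hx0 hx1
    rw [vertexMatrix_mulVec_inr, Fintype.sum_bool, ← hx0, ← hx1, hm]
    have hyy := hy e
    have hs := sinSol_two_mul_pos (hy e) (hμ e)
    have hL : (0 : ℝ) ≤ G.len e / 2 := by linarith [G.len_pos e]
    -- Continuing the solution from the midpoint to the far end turns the midpoint row into the
    -- identity `cosSol_sq_add`.
    have hsum := (sol_add (μ := μ) (x := G.len e / 2) (a e) (d e) hL).1
    rw [add_halves] at hsum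
    rw [diagCoef, offCoef, coef_add_div_two (hy e) (hμ e), coef_sub_div_two (hy e) (hμ e), hsum]
    rw [h2] at hs ⊢
    have hs' : (sinSol μ (G.len e / 2) : ℂ) ≠ 0 := by exact_mod_cast hs.ne'
    have e3 : (cosSol μ (G.len e / 2) : ℂ) ^ 2 + μ * (sinSol μ (G.len e / 2) : ℂ) ^ 2 = 1 := by
      exact_mod_cast cosSol_sq_add μ (G.len e / 2)
    unfold sol solDeriv
    push_cast
    field_simp
    linear_combination (a e) * e3
  · intro v
    rw [vertexMatrix_mulVec_inl, outDerivSum, ← Finset.sum_neg_distrib]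
    refine Finset.sum_congr ?_ fun h _ => key h
    congr!

/-- Vertex and midpoint values that are consistent on every edge are the values of solutions. -/
theorem exists_isSol_of_mulVec_eq_zero (hμ : G.IsSubcritical μ) {x : V ⊕ E → ℂ}
    (hx : ∀ e, (G.vertexMatrix μ *ᵥ x) (Sum.inr e) = 0) :
    ∃ a d, (∀ h, G.endValue (G.solFun μ a d) h = x (Sum.inl (G.endpoint h))) ∧
      ∀ e, G.solFun μ a d e (G.len e / 2) = x (Sum.inr e) := by
  have hy : ∀ e, 0 < G.len e / 4 := fun e => by have := G.len_pos e; positivity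
  have h2 : ∀ e, 2 * (G.len e / 4) = G.len e / 2 := fun e => by ring
  let a : E → ℂ := fun e => x (Sum.inl (G.endpoint (e, false)))
  -- The slope for which the solution starting at `a e` reaches `x (Sum.inr e)` at the midpoint; it
  -- is read off from `solDeriv_zero_eq`. The midpoint row then forces the right value at the far
  -- end.
  let d : E → ℂ := fun e => G.offCoef μ e * x (Sum.inr e) - G.diagCoef μ e * a e
  have hf : G.IsSol μ (G.solFun μ a d) a d := isSol_solFun μ a d
  have hoff := fun e => offCoef_pos hμ e
  have hmid : ∀ e, sol μ (a e) (d e) (G.len e / 2) = x (Sum.inr e) := fun e => by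
    have k1 := solDeriv_zero_eq (hy e) (hμ e) (a e) (d e)
    rw [h2] at k1
    have hne : ((G.offCoef μ e : ℝ) : ℂ) ≠ 0 := by exact_mod_cast (hoff e).ne'
    refine mul_left_cancel₀ hne ?_
    change (G.diagCoef μ e : ℂ) * a e - (G.offCoef μ e : ℂ) * _ = -(d e) at k1
    simp only [d] at k1 ⊢
    linear_combination -k1
  refine ⟨a, d, ?_, fun e => ?_⟩
  · rintro ⟨e, b⟩
    rw [hf.endValue]
    cases b
    · simp [a]
    · simp only [if_true]
      have h1 := hx e
      rw [vertexMatrix_mulVec_inr, Fintype.sum_bool, ← hmid] at h1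
      have hL : (0 : ℝ) ≤ G.len e / 2 := by linarith [G.len_pos e]
      have hsum := (sol_add (μ := μ) (x := G.len e / 2) (a e) (d e) hL).1
      rw [add_halves] at hsum
      rw [hsum]
      have hs := sinSol_two_mul_pos (hy e) (hμ e)
      rw [diagCoef, offCoef, coef_add_div_two (hy e) (hμ e), coef_sub_div_two (hy e) (hμ e)] at h1
      rw [h2] at hs h1
      have hs' : (sinSol μ (G.len e / 2) : ℂ) ≠ 0 := by exact_mod_cast hs.ne'
      have e3 : (cosSol μ (G.len e / 2) : ℂ) ^ 2 + μ * (sinSol μ (G.len e / 2) : ℂ) ^ 2 = 1 := by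
        exact_mod_cast cosSol_sq_add μ (G.len e / 2)
      push_cast at h1
      field_simp at h1
      change _ - x (Sum.inl (G.endpoint (e, true))) + (_ - a e) = _ at h1
      simp only [sol, solDeriv] at h1 ⊢
      linear_combination h1 - (a e) * e3
  · rw [hf e _ (by constructor <;> linarith [G.len_pos e]), hmid]

/-- The eigenspaces are the kernels of the vertex matrices. -/
theorem multiplicity_eq_nullity (hI : ∀ v, ∃ h, G.endpoint h = v) (hμ : G.IsSubcritical μ) :
    G.multiplicity μ = nullity (G.vertexMatrix μ) := by
  choose σ hσ using hI
  -- Evaluation at vertices and midpoints. By continuity at the vertices the choice of the end `σ v`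
  -- does not matter.
  let Φ : G.eigenspace μ →ₗ[ℂ] (V ⊕ E → ℂ) :=
    { toFun := fun f => Sum.elim (fun v => G.endValue f.1 (σ v)) fun e => f.1 e (G.len e / 2)
      map_add' := fun f g => by
        ext i
        rcases i with v | e
        · simp [endValue_add]
        · simp
      map_smul' := fun c f => by
        ext i
        rcases i with v | e
        · simp [endValue_smul]
        · simp }
  have hends : ∀ (f : G.eigenspace μ) h, G.endValue f.1 h = Φ f (Sum.inl (G.endpoint h)) :=
    fun f h => f.2.2.2 _ _ (hσ _).symm
  have hinj : Function.Injective Φ := by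
    rw [← LinearMap.ker_eq_bot, LinearMap.ker_eq_bot']
    intro f hf
    obtain ⟨h0, ⟨a, d, had⟩, -⟩ := mem_eigenspace_iff.mp f.2
    ext e t
    by_cases ht : t ∈ Icc 0 (G.len e)
    · have ha : a e = 0 := by
        have := hends f (e, false)
        rw [had.endValue, hf] at this
        simpa using this
      have hd : d e = 0 := had.eq_zero_of_midpoint hμ ha (congrFun hf (Sum.inr e))
      rw [had e t ht, ha, hd]
      simp [sol]
    · rw [h0 e t ht]
      rfl
  have hrange : LinearMap.range Φ = LinearMap.ker (G.vertexMatrix μ).mulVecLin := by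
    ext x
    rw [LinearMap.mem_range, LinearMap.mem_ker, mulVecLin_apply]
    constructor
    · rintro ⟨f, rfl⟩
      obtain ⟨h0, ⟨a, d, had⟩, -, hk⟩ := mem_eigenspace_iff.mp f.2
      obtain ⟨h1, h2⟩ := vertexMatrix_mulVec_of_isSol hμ had (hends f) fun e => rfl
      ext i
      rcases i with v | e
      · rw [h2, hk, neg_zero]; rfl
      · exact h1 e
    · intro hx
      obtain ⟨a, d, h1, h2⟩ := exists_isSol_of_mulVec_eq_zero hμ (x := x) fun e => by rw [hx]; rfl
      have h3 := (vertexMatrix_mulVec_of_isSol hμ (isSol_solFun μ a d) h1 h2).2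
      refine ⟨⟨G.solFun μ a d, mem_eigenspace_iff.mpr ⟨fun e t ht => solFun_of_notMem μ a d e ht,
        ⟨a, d, isSol_solFun μ a d⟩, fun h h' hh => by rw [h1, h1, hh], fun v => ?_⟩⟩, ?_⟩
      · have := h3 v
        rw [hx] at this
        simpa using this.symm
      · ext i
        rcases i with v | e
        · change G.endValue (G.solFun μ a d) (σ v) = _
          rw [h1, hσ]
        · exact h2 e
  let Ψ := (LinearEquiv.ofInjective Φ hinj).trans (LinearEquiv.ofEq _ _ hrange)
  have : Module.Finite ℂ (G.eigenspace μ) := Module.Finite.equiv Ψ.symm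
  rw [multiplicity, ← Module.finrank_eq_rank, Ψ.finrank_eq, nullity]
  simp

end VertexMatrixSolutions

/-! ### Invariance of the spectrum under subdivision -/

section Subdivide

open Set

variable {V E : Type*} {G : MetricGraph V E} (S : G.Subdivision)

@[simp] theorem Subdivision.left_zero (e : E) : S.left e 0 = 0 := rfl

@[simp] theorem Subdivision.left_succ (e : E) (j : Fin (S.num e)) :
    S.left e j.succ = S.pt e j := rfl

@[simp] theorem Subdivision.right_last (e : E) :
    S.right e (Fin.last (S.num e)) = G.len e := by
  simp [Subdivision.right]

@[simp] theorem Subdivision.right_castSucc (e : E) (j : Fin (S.num e)) :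
    S.right e j.castSucc = S.pt e j := by
  simp [Subdivision.right]

theorem Subdivision.left_nonneg (e : E) (i : Fin (S.num e + 1)) : 0 ≤ S.left e i := by
  induction i using Fin.cases with
  | zero => exact le_rfl
  | succ j => exact (S.mem_Ioo e j).1.le

theorem Subdivision.right_le (e : E) (i : Fin (S.num e + 1)) : S.right e i ≤ G.len e := by
  induction i using Fin.lastCases with
  | last => simp
  | cast j => simpa using (S.mem_Ioo e j).2.le

/-- The end of a part of a subdivided edge that is an end of the whole edge. -/
def subdivideEnd (h : E × Bool) : (Σ e, Fin (S.num e + 1)) × Bool :=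
  if h.2 then (⟨h.1, Fin.last _⟩, true) else (⟨h.1, 0⟩, false)

/-- The position on the edge of an end of a part of it. -/
def Subdivision.pos (h : (Σ e, Fin (S.num e + 1)) × Bool) : ℝ :=
  if h.2 then S.right h.1.1 h.1.2 else S.left h.1.1 h.1.2

theorem endpoint_subdivideEnd (h : E × Bool) :
    (G.subdivide S).endpoint (subdivideEnd S h) = Sum.inl (G.endpoint h) := by
  obtain ⟨e, b⟩ := h
  cases b <;> simp [subdivideEnd, endpoint, subdivide]

theorem endpoint_succ (e : E) (j : Fin (S.num e)) :
    (G.subdivide S).endpoint (⟨e, j.succ⟩, false) = Sum.inr ⟨e, j⟩ := by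
  simp [endpoint, subdivide]

theorem endpoint_castSucc (e : E) (j : Fin (S.num e)) :
    (G.subdivide S).endpoint (⟨e, j.castSucc⟩, true) = Sum.inr ⟨e, j⟩ := by
  simp [endpoint, subdivide]

/-- An end of a part is either an end of the whole edge or one of the two ends at a new vertex;
`sum_subdivide_ends` is this partition for sums. -/
theorem subdivide_end_cases {motive : (Σ e, Fin (S.num e + 1)) × Bool → Prop}
    (h1 : ∀ h, motive (subdivideEnd S h)) (h2 : ∀ e j, motive (⟨e, Fin.succ j⟩, false))
    (h3 : ∀ e j, motive (⟨e, Fin.castSucc j⟩, true)) (h) : motive h := by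
  obtain ⟨⟨e, i⟩, b⟩ := h
  cases b
  · induction i using Fin.cases with
    | zero => exact h1 (e, false)
    | succ j => exact h2 e j
  · induction i using Fin.lastCases with
    | last => exact h1 (e, true)
    | cast j => exact h3 e j

theorem exists_end_subdivide (hI : ∀ v, ∃ h, G.endpoint h = v) :
    ∀ v, ∃ h, (G.subdivide S).endpoint h = v := by
  rintro (v | ⟨e, j⟩)
  · obtain ⟨h, rfl⟩ := hI v
    exact ⟨_, endpoint_subdivideEnd S h⟩
  · exact ⟨_, endpoint_succ S e j⟩

theorem sum_subdivide_ends [Fintype E] {R : Type*} [AddCommMonoid R]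
    (F : (Σ e, Fin (S.num e + 1)) × Bool → R) :
    ∑ h, F h = ∑ h, F (subdivideEnd S h) +
      ∑ q : Σ e, Fin (S.num e), (F (⟨q.1, q.2.succ⟩, false) + F (⟨q.1, q.2.castSucc⟩, true)) := by
  rw [Fintype.sum_prod_type, Fintype.sum_sigma, Fintype.sum_prod_type, Fintype.sum_sigma,
    ← Finset.sum_add_distrib]
  refine Finset.sum_congr rfl fun e _ => ?_
  simp only [Fintype.sum_bool, Finset.sum_add_distrib, subdivideEnd, if_true, Bool.false_eq_true,
    if_false]
  rw [Fin.sum_univ_castSucc fun i => F (⟨e, i⟩, true), Fin.sum_univ_succ fun i => F (⟨e, i⟩, false)]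
  abel

variable {S} {μ : ℝ} {f : E → ℝ → ℂ} {a d : E → ℂ}
  {f' : (Σ e, Fin (S.num e + 1)) → ℝ → ℂ}

/-- The initial values on the parts of subdivided edges. -/
noncomputable def subdivideVal (S : G.Subdivision) (μ : ℝ) (a d : E → ℂ)
    (p : Σ e, Fin (S.num e + 1)) : ℂ := sol μ (a p.1) (d p.1) (S.left p.1 p.2)

/-- The initial derivatives on the parts of subdivided edges. -/
noncomputable def subdivideDer (S : G.Subdivision) (μ : ℝ) (a d : E → ℂ)
    (p : Σ e, Fin (S.num e + 1)) : ℂ := solDeriv μ (a p.1) (d p.1) (S.left p.1 p.2)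

theorem IsSol.subdivide (hf : G.IsSol μ f a d)
    (h : ∀ p, ∀ t ∈ Icc 0 ((G.subdivide S).len p), f' p t = f p.1 (S.left p.1 p.2 + t)) :
    (G.subdivide S).IsSol μ f' (subdivideVal S μ a d) (subdivideDer S μ a d) := by
  rintro ⟨e, i⟩ t ht
  rw [h _ t ht, subdivideVal, subdivideDer, ← (sol_add _ _ ht.1).1]
  refine hf e _ ⟨add_nonneg (S.left_nonneg e i) ht.1, ?_⟩
  have h1 : t ≤ S.right e i - S.left e i := ht.2
  have := S.right_le e i
  change S.left e i + t ≤ _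
  linarith

theorem IsSol.endValue_subdivide
    (hf : (G.subdivide S).IsSol μ f' (subdivideVal S μ a d) (subdivideDer S μ a d))
    (h : (Σ e, Fin (S.num e + 1)) × Bool) :
    (G.subdivide S).endValue f' h = sol μ (a h.1.1) (d h.1.1) (S.pos h) := by
  obtain ⟨⟨e, i⟩, b⟩ := h
  rw [hf.endValue]
  cases b
  · rfl
  · simp only [if_true, subdivideVal, subdivideDer, Subdivision.pos]
    rw [← (sol_add _ _ ((G.subdivide S).len_pos _).le).1]
    change sol μ (a e) (d e) (S.left e i + (S.right e i - S.left e i)) = _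
    rw [add_sub_cancel]

theorem IsSol.outDeriv_subdivide
    (hf : (G.subdivide S).IsSol μ f' (subdivideVal S μ a d) (subdivideDer S μ a d))
    (h : (Σ e, Fin (S.num e + 1)) × Bool) :
    (G.subdivide S).outDeriv f' h =
      (if h.2 then -1 else 1) * solDeriv μ (a h.1.1) (d h.1.1) (S.pos h) := by
  obtain ⟨⟨e, i⟩, b⟩ := h
  rw [hf.outDeriv]
  cases b
  · simp [Subdivision.pos, subdivideDer]
  · simp only [if_true, subdivideVal, subdivideDer, Subdivision.pos]
    rw [← (sol_add _ _ ((G.subdivide S).len_pos _).le).2]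
    change -solDeriv μ (a e) (d e) (S.left e i + (S.right e i - S.left e i)) = _
    rw [add_sub_cancel, neg_one_mul]

theorem IsSol.endValue_subdivideEnd (hf : G.IsSol μ f a d)
    (hf' : (G.subdivide S).IsSol μ f' (subdivideVal S μ a d) (subdivideDer S μ a d))
    (h : E × Bool) : (G.subdivide S).endValue f' (subdivideEnd S h) = G.endValue f h := by
  rw [hf'.endValue_subdivide, hf.endValue]
  obtain ⟨e, b⟩ := h
  cases b <;> simp [subdivideEnd, Subdivision.pos]

theorem IsSol.outDeriv_subdivideEnd (hf : G.IsSol μ f a d)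
    (hf' : (G.subdivide S).IsSol μ f' (subdivideVal S μ a d) (subdivideDer S μ a d))
    (h : E × Bool) : (G.subdivide S).outDeriv f' (subdivideEnd S h) = G.outDeriv f h := by
  rw [hf'.outDeriv_subdivide, hf.outDeriv]
  obtain ⟨e, b⟩ := h
  cases b <;> simp [subdivideEnd, Subdivision.pos]

theorem IsSol.continuous_subdivide (hf : G.IsSol μ f a d)
    (hf' : (G.subdivide S).IsSol μ f' (subdivideVal S μ a d) (subdivideDer S μ a d)) :
    (∀ h h', (G.subdivide S).endpoint h = (G.subdivide S).endpoint h' →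
      (G.subdivide S).endValue f' h = (G.subdivide S).endValue f' h') ↔
    ∀ h h', G.endpoint h = G.endpoint h' → G.endValue f h = G.endValue f h' := by
  constructor
  · intro H h h' hh
    rw [← hf.endValue_subdivideEnd hf', ← hf.endValue_subdivideEnd hf']
    exact H _ _ (by rw [endpoint_subdivideEnd, endpoint_subdivideEnd, hh])
  · intro H
    -- End values factor through the vertices: `Function.extend` picks out the common value at an
    -- old vertex, and both parts meeting at a new vertex carry the same solution.
    have key : ∀ h, (G.subdivide S).endValue f' h = Sum.elim
        (fun v => Function.extend G.endpoint (G.endValue f) 0 v)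
        (fun q => sol μ (a q.1) (d q.1) (S.pt q.1 q.2)) ((G.subdivide S).endpoint h) := by
      intro h
      induction h using subdivide_end_cases with
      | h1 h =>
        rw [hf.endValue_subdivideEnd hf', endpoint_subdivideEnd, Sum.elim_inl]
        exact (Function.FactorsThrough.extend_apply (fun h h' hh => H h h' hh) _ _).symm
      | h2 e j => rw [endpoint_succ, hf'.endValue_subdivide]; rfl
      | h3 e j => rw [endpoint_castSucc, hf'.endValue_subdivide]; simp [Subdivision.pos]
    intro h h' hh
    rw [key, key, hh]

variable [Fintype E]

theorem outDerivSum_subdivide_inl (f' : (Σ e, Fin (S.num e + 1)) → ℝ → ℂ) (v : V) :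
    (G.subdivide S).outDerivSum f' (Sum.inl v) =
      ∑ h, open Classical in
        if G.endpoint h = v then (G.subdivide S).outDeriv f' (subdivideEnd S h) else 0 := by
  classical
  rw [outDerivSum, Finset.sum_filter, sum_subdivide_ends]
  simp only [endpoint_subdivideEnd, endpoint_succ, endpoint_castSucc, Sum.inl.injEq, reduceCtorEq,
    if_false, add_zero, Finset.sum_const_zero]

theorem outDerivSum_subdivide_inr (f' : (Σ e, Fin (S.num e + 1)) → ℝ → ℂ)
    (q : Σ e, Fin (S.num e)) :
    (G.subdivide S).outDerivSum f' (Sum.inr q) =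
      (G.subdivide S).outDeriv f' (⟨q.1, q.2.succ⟩, false) +
        (G.subdivide S).outDeriv f' (⟨q.1, q.2.castSucc⟩, true) := by
  classical
  rw [outDerivSum, Finset.sum_filter, sum_subdivide_ends]
  simp only [endpoint_subdivideEnd, endpoint_succ, endpoint_castSucc, Sum.inr.injEq, reduceCtorEq,
    if_false, Finset.sum_const_zero, zero_add]
  rw [Finset.sum_eq_single q]
  · simp
  · rintro q' _ hq
    have : ¬ (⟨q'.1, q'.2⟩ : Σ e, Fin (S.num e)) = q := hq
    simp [this]
  · simp

theorem IsSol.outDerivSum_subdivide_inl (hf : G.IsSol μ f a d)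
    (hf' : (G.subdivide S).IsSol μ f' (subdivideVal S μ a d) (subdivideDer S μ a d)) (v : V) :
    (G.subdivide S).outDerivSum f' (Sum.inl v) = G.outDerivSum f v := by
  classical
  rw [MetricGraph.outDerivSum_subdivide_inl, outDerivSum, Finset.sum_filter]
  simp only [hf.outDeriv_subdivideEnd hf']

theorem IsSol.outDerivSum_subdivide_inr
    (hf' : (G.subdivide S).IsSol μ f' (subdivideVal S μ a d) (subdivideDer S μ a d))
    (q : Σ e, Fin (S.num e)) : (G.subdivide S).outDerivSum f' (Sum.inr q) = 0 := by
  rw [MetricGraph.outDerivSum_subdivide_inr, hf'.outDeriv_subdivide, hf'.outDeriv_subdivide]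
  simp [Subdivision.pos]

/-- A solution on the subdivided graph that satisfies the conditions at the additional vertices
is a solution on the original graph. -/
theorem IsSol.eq_subdivide {a' d' : (Σ e, Fin (S.num e + 1)) → ℂ}
    (hf' : (G.subdivide S).IsSol μ f' a' d')
    (hc : ∀ h h', (G.subdivide S).endpoint h = (G.subdivide S).endpoint h' →
      (G.subdivide S).endValue f' h = (G.subdivide S).endValue f' h')
    (hk : ∀ q, (G.subdivide S).outDerivSum f' (Sum.inr q) = 0) :
    a' = subdivideVal S μ (fun e => a' ⟨e, 0⟩) (fun e => d' ⟨e, 0⟩) ∧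
      d' = subdivideDer S μ (fun e => a' ⟨e, 0⟩) (fun e => d' ⟨e, 0⟩) := by
  have key : ∀ e i, a' ⟨e, i⟩ = sol μ (a' ⟨e, 0⟩) (d' ⟨e, 0⟩) (S.left e i) ∧
      d' ⟨e, i⟩ = solDeriv μ (a' ⟨e, 0⟩) (d' ⟨e, 0⟩) (S.left e i) := by
    intro e i
    -- Along an edge, continuity and the Kirchhoff condition at a new vertex match value and
    -- derivative, so each part continues the solution of the previous one.
    induction i using Fin.induction with
    | zero => simp
    | succ j ih =>
      have h1 := hc (⟨e, j.succ⟩, false) (⟨e, j.castSucc⟩, true)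
        (by rw [endpoint_succ, endpoint_castSucc])
      have h2 := hk ⟨e, j⟩
      rw [MetricGraph.outDerivSum_subdivide_inr, hf'.outDeriv, hf'.outDeriv] at h2
      rw [hf'.endValue, hf'.endValue] at h1
      simp only [Bool.false_eq_true, if_false, if_true] at h1 h2
      have h3 := sol_add (μ := μ) (x := S.left e j.castSucc) (a' ⟨e, 0⟩) (d' ⟨e, 0⟩)
        ((G.subdivide S).len_pos ⟨e, j.castSucc⟩).le
      rw [← ih.1, ← ih.2] at h3
      have h4 : S.left e j.castSucc + (G.subdivide S).len ⟨e, j.castSucc⟩ = S.left e j.succ := by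
        change S.left e j.castSucc + (S.right e j.castSucc - S.left e j.castSucc) = _
        simp
      rw [h4] at h3
      refine ⟨by rw [h1, h3.1], ?_⟩
      rw [h3.2]
      linear_combination h2
  exact ⟨funext fun p => (key p.1 p.2).1, funext fun p => (key p.1 p.2).2⟩

/-- Additional vertices of degree two do not change the eigenvalues. -/
theorem multiplicity_subdivide (S : G.Subdivision) (μ : ℝ) :
    (G.subdivide S).multiplicity μ = G.multiplicity μ := by
  classical
  let R : (E → ℝ → ℂ) →ₗ[ℂ] ((Σ e, Fin (S.num e + 1)) → ℝ → ℂ) :=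
    { toFun := fun f p t => if t ∈ Icc 0 ((G.subdivide S).len p) then
        f p.1 (S.left p.1 p.2 + t) else 0
      map_add' := fun f g => by
        ext p t
        by_cases ht : t ∈ Icc 0 ((G.subdivide S).len p)
        · simp only [if_pos ht, Pi.add_apply]
        · simp only [if_neg ht, Pi.add_apply, add_zero]
      map_smul' := fun c f => by
        ext p t
        by_cases ht : t ∈ Icc 0 ((G.subdivide S).len p)
        · simp only [if_pos ht, Pi.smul_apply, RingHom.id_apply]
        · simp only [if_neg ht, Pi.smul_apply, RingHom.id_apply, smul_zero] }
  have hR : ∀ f p, ∀ t ∈ Icc 0 ((G.subdivide S).len p), R f p t = f p.1 (S.left p.1 p.2 + t) :=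
    fun f p t ht => if_pos ht
  have hmem : ∀ f ∈ G.eigenspace μ, R f ∈ (G.subdivide S).eigenspace μ := by
    intro f hf
    obtain ⟨-, ⟨a, d, had⟩, hc, hk⟩ := mem_eigenspace_iff.mp hf
    have had' := had.subdivide (hR f)
    refine mem_eigenspace_iff.mpr ⟨fun p t ht => if_neg ht, ⟨_, _, had'⟩,
      (had.continuous_subdivide had').mpr hc, ?_⟩
    rintro (v | q)
    · rw [had.outDerivSum_subdivide_inl had', hk]
    · exact had'.outDerivSum_subdivide_inr q
  let Φ : G.eigenspace μ →ₗ[ℂ] (G.subdivide S).eigenspace μ := R.restrict hmem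
  have hΦ : Function.Bijective Φ := by
    constructor
    · rw [← LinearMap.ker_eq_bot, LinearMap.ker_eq_bot']
      intro f hf
      obtain ⟨h0, ⟨a, d, had⟩, -⟩ := mem_eigenspace_iff.mp f.2
      have had' := had.subdivide (hR f)
      have hRf : R f = 0 := congrArg Subtype.val hf
      have ha : ∀ e, a e = 0 := fun e => by
        have := had.endValue_subdivideEnd had' (e, false)
        rw [had.endValue, hRf] at this
        simpa [endValue] using this.symm
      have hd : ∀ e, d e = 0 := fun e => by
        have := had.outDeriv_subdivideEnd had' (e, false)
        rw [had.outDeriv, hRf] at this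
        simpa [outDeriv] using this.symm
      ext e t
      by_cases ht : t ∈ Icc 0 (G.len e)
      · rw [had e t ht, ha, hd]
        simp [sol]
      · rw [h0 e t ht]
        rfl
    · rintro ⟨f', hf'⟩
      obtain ⟨h0, ⟨a', d', had'⟩, hc, hk⟩ := mem_eigenspace_iff.mp hf'
      obtain ⟨h1, h2⟩ := had'.eq_subdivide hc fun q => hk _
      -- The initial data of the first part of each edge determine the preimage.
      set a : E → ℂ := fun e => a' ⟨e, 0⟩
      set d : E → ℂ := fun e => d' ⟨e, 0⟩
      rw [h1, h2] at had'
      have had : G.IsSol μ (G.solFun μ a d) a d := isSol_solFun μ a d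
      refine ⟨⟨G.solFun μ a d, mem_eigenspace_iff.mpr ⟨fun e t ht => solFun_of_notMem μ a d e ht,
        ⟨a, d, had⟩, (had.continuous_subdivide had').mp hc, fun v => ?_⟩⟩, ?_⟩
      · rw [← had.outDerivSum_subdivide_inl had', hk]
      · refine Subtype.ext (funext fun p => funext fun t => ?_)
        change R (G.solFun μ a d) p t = f' p t
        by_cases ht : t ∈ Icc 0 ((G.subdivide S).len p)
        · rw [had.subdivide (hR _) p t ht, had' p t ht]
        · rw [h0 p t ht]
          exact if_neg ht
  rw [multiplicity, multiplicity, (LinearEquiv.ofBijective Φ hΦ).rank_eq]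

end Subdivide

/-! ### Euler characteristic and cutting -/

section Betti

variable {V E : Type*} {G : MetricGraph V E}

theorem numComponents_of_connected (hG : G.Connected) : G.numComponents = 1 := by
  obtain ⟨⟨v⟩, h⟩ := hG
  rw [numComponents, Nat.card_eq_one_iff_unique]
  refine ⟨⟨fun p q => ?_⟩, ⟨Quot.mk _ v⟩⟩
  induction p using Quot.ind
  induction q using Quot.ind
  exact Quot.eqvGen_sound (h _ _)

variable [Fintype E] (G)

theorem degree_eq_sum [DecidableEq V] (v : V) :
    G.degree v = ∑ h : E × Bool, if G.endpoint h = v then 1 else 0 := by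
  classical
  rw [degree, Nat.card_eq_fintype_card, Fintype.card_subtype, Finset.card_filter]

variable {G}

theorem degree_subdivide_inl (S : G.Subdivision) (v : V) :
    (G.subdivide S).degree (Sum.inl v) = G.degree v := by
  classical
  rw [degree_eq_sum, degree_eq_sum, sum_subdivide_ends]
  simp only [endpoint_subdivideEnd, endpoint_succ, endpoint_castSucc, Sum.inl.injEq, reduceCtorEq,
    if_false, add_zero, Finset.sum_const_zero]

theorem degree_subdivide_inr (S : G.Subdivision) (q : Σ e, Fin (S.num e)) :
    (G.subdivide S).degree (Sum.inr q) = 2 := by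
  classical
  rw [degree_eq_sum, sum_subdivide_ends]
  simp only [endpoint_subdivideEnd, endpoint_succ, endpoint_castSucc, Sum.inr.injEq, reduceCtorEq,
    if_false, Finset.sum_const_zero, zero_add]
  rw [Finset.sum_eq_single q]
  · simp
  · rintro q' _ hq
    have : ¬ (⟨q'.1, q'.2⟩ : Σ e, Fin (S.num e)) = q := hq
    simp [this]
  · simp

theorem card_ends_of_degree_eq_two {B : Finset V} (hB : ∀ v ∈ B, G.degree v = 2) :
    Nat.card {h : E × Bool // G.endpoint h ∈ B} = 2 * B.card := by
  classical
  rw [Nat.card_eq_fintype_card, Fintype.card_subtype,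
    Finset.card_eq_sum_card_fiberwise (f := G.endpoint) (t := B) (fun h hh => by simpa using hh)]
  rw [Finset.sum_congr rfl (g := fun _ => 2), Finset.sum_const, smul_eq_mul, mul_comm]
  intro v hv
  rw [← hB v hv, degree_eq_sum, Finset.filter_filter, Finset.card_filter]
  refine Finset.sum_congr rfl fun h _ => if_congr ⟨fun hh => hh.2, fun hh => ⟨hh ▸ hv, hh⟩⟩ rfl rfl

variable [Fintype V] (G)

/-- The Euler characteristic of a graph. -/
theorem betti_add_card : G.betti + Fintype.card V = Fintype.card E + G.numComponents := by
  classical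
  have : Fintype (Quot G.Joined) := Fintype.ofFinite _
  -- Functions on the set of components are identified with the kernel of the dual of the boundary
  -- map; rank-nullity for the boundary map and its dual then gives the formula.
  let Ξ : (Quot G.Joined → ℚ) →ₗ[ℚ] Module.Dual ℚ (V →₀ ℚ) :=
    (Finsupp.llift ℚ ℚ ℚ V).toLinearMap ∘ₗ LinearMap.funLeft ℚ ℚ (Quot.mk G.Joined)
  have hinj : Function.Injective Ξ :=
    (Finsupp.llift ℚ ℚ ℚ V).injective.comp
      (LinearMap.funLeft_injective_of_surjective ℚ ℚ _ Quot.mk_surjective)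
  have hΞ : ∀ g v, Ξ g (Finsupp.single v 1) = g (Quot.mk _ v) := fun g v => by
    simp [Ξ, LinearMap.funLeft_apply]
  have hbd : ∀ e, G.boundary (Finsupp.single e 1) =
      Finsupp.single (G.tgt e) 1 - Finsupp.single (G.src e) 1 := fun e => by
    simp [boundary]
  have hrange : LinearMap.range Ξ = LinearMap.ker G.boundary.dualMap := by
    ext φ
    rw [LinearMap.mem_range, LinearMap.mem_ker]
    constructor
    · rintro ⟨g, rfl⟩
      refine Finsupp.lhom_ext' fun e => LinearMap.ext_ring ?_
      simp only [LinearMap.comp_apply, Finsupp.lsingle_apply, LinearMap.dualMap_apply]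
      have hq : Quot.mk G.Joined (G.src e) = Quot.mk G.Joined (G.tgt e) :=
        Quot.sound ⟨e, rfl, rfl⟩
      rw [hbd, map_sub, hΞ, hΞ, hq, sub_self]
      simp
    · intro hφ
      refine ⟨Quot.lift (fun v => φ (Finsupp.single v 1)) ?_, ?_⟩
      · rintro _ _ ⟨e, rfl, rfl⟩
        have := congrArg (fun ψ => ψ (Finsupp.single e 1)) hφ
        simp only [LinearMap.dualMap_apply] at this
        rw [hbd, map_sub] at this
        exact (sub_eq_zero.mp this).symm
      · refine Finsupp.lhom_ext' fun v => LinearMap.ext_ring ?_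
        simp only [LinearMap.comp_apply, Finsupp.lsingle_apply]
        rw [hΞ]
  have h1 := LinearMap.finrank_range_add_finrank_ker G.boundary
  have h2 := LinearMap.finrank_range_add_finrank_ker G.boundary.dualMap
  rw [LinearMap.finrank_range_dualMap_eq_finrank_range, Subspace.dual_finrank_eq, ← hrange,
    LinearMap.finrank_range_of_inj hinj] at h2
  rw [Module.finrank_finsupp_self] at h1 h2
  rw [Module.finrank_fintype_fun_eq_card, ← Nat.card_eq_fintype_card] at h2
  unfold betti numComponents
  omega

variable {G}

/-- The first Betti number after cutting a subdivided connected graph at points of degree two. -/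
theorem betti_cut_subdivide (hG : G.Connected) (S : G.Subdivision)
    (B : Finset (V ⊕ Σ e, Fin (S.num e))) (hB : ∀ v ∈ B, (G.subdivide S).degree v = 2) :
    (((G.subdivide S).cut B).betti : ℤ) =
      G.betti - 1 - B.card + ((G.subdivide S).cut B).numComponents := by
  classical
  -- Subdividing adds equally many vertices and edges, and cutting replaces each vertex of `B` by
  -- two without changing the edges.
  have h1 := G.betti_add_card
  rw [numComponents_of_connected hG] at h1
  have h2 := ((G.subdivide S).cut B).betti_add_card
  have h3 := card_ends_of_degree_eq_two hB
  rw [Nat.card_eq_fintype_card] at h3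
  have h4 : Fintype.card {v // v ∉ B} + B.card = Fintype.card V + ∑ e, S.num e := by
    rw [Fintype.card_subtype_compl, Fintype.card_coe, Nat.sub_add_cancel B.card_le_univ,
      Fintype.card_sum, Fintype.card_sigma]
    simp
  have h5 : Fintype.card (Σ e, Fin (S.num e + 1)) = Fintype.card E + ∑ e, S.num e := by
    rw [Fintype.card_sigma]
    simp [Finset.sum_add_distrib, add_comm]
  rw [Fintype.card_sum, h3, h5] at h2
  omega

end Betti

/-! ### Ground states of the Dirichlet block and nodal domains -/

section GroundState

open Matrix

variable {V E : Type*} {G : MetricGraph V E} {B : Finset V}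

theorem endpoint_cut_of_mem {h : E × Bool} (hb : G.endpoint h ∈ B) :
    (G.cut B).endpoint h = Sum.inr ⟨h, hb⟩ := by
  obtain ⟨e, b⟩ := h
  cases b
  · exact dif_pos hb
  · exact dif_pos hb

theorem endpoint_cut_of_notMem {h : E × Bool} (hb : G.endpoint h ∉ B) :
    (G.cut B).endpoint h = Sum.inl ⟨G.endpoint h, hb⟩ := by
  obtain ⟨e, b⟩ := h
  cases b
  · exact dif_neg hb
  · exact dif_neg hb

theorem mk_endpoint {V' E' : Type*} (H : MetricGraph V' E') (h : E' × Bool) :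
    Quot.mk H.Joined (H.endpoint h) = Quot.mk H.Joined (H.src h.1) := by
  obtain ⟨e, b⟩ := h
  cases b
  · rfl
  · exact (Quot.sound ⟨e, rfl, rfl⟩).symm

/-- The vertices outside of `B` and the midpoints of the edges. -/
def innerPoint (B : Finset V) : {v // v ∉ B} ⊕ E → V ⊕ E := Sum.map Subtype.val id

theorem innerPoint_injective (B : Finset V) :
    Function.Injective (innerPoint (E := E) B) :=
  Subtype.val_injective.sumMap Function.injective_id

theorem extend_innerPoint_inl_of_mem (x : {v // v ∉ B} ⊕ E → ℂ) {v : V} (hv : v ∈ B) :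
    Function.extend (innerPoint B) x 0 (Sum.inl v) = 0 := by
  refine Function.extend_apply' _ _ _ ?_
  rintro ⟨v' | e, h⟩
  · exact v'.2 (Sum.inl_injective h ▸ hv)
  · cases h

variable [Fintype E]

/-- The block of the vertex matrix that belongs to Dirichlet conditions at the vertices of `B`. -/
noncomputable def innerMatrix (G : MetricGraph V E) (B : Finset V) (μ : ℝ) :
    Matrix ({v // v ∉ B} ⊕ E) ({v // v ∉ B} ⊕ E) ℂ :=
  (G.vertexMatrix μ).submatrix (innerPoint B) (innerPoint B)

variable [Fintype V] {μ : ℝ} {u : V ⊕ E → ℝ}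

/-- A solution of the problem at `μ` that vanishes exactly at the vertices of `B` and has constant
sign on every edge. -/
structure IsGroundState (G : MetricGraph V E) (μ : ℝ) (B : Finset V) (u : V ⊕ E → ℝ) : Prop where
  sol : G.vertexMatrix μ *ᵥ (fun i => (u i : ℂ)) = 0
  zero : ∀ v ∈ B, u (Sum.inl v) = 0
  ne_zero : ∀ e, u (Sum.inr e) ≠ 0
  pos : ∀ h, G.endpoint h ∉ B → 0 < u (Sum.inl (G.endpoint h)) * u (Sum.inr h.1)

open Classical in
/-- The ground state representation of the quadratic form. -/
theorem IsGroundState.quadForm_eq (hu : IsGroundState G μ B u) {x : V ⊕ E → ℂ}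
    (hx : ∀ v ∈ B, x (Sum.inl v) = 0) :
    quadForm (G.vertexMatrix μ) x = ∑ h : E × Bool, if G.endpoint h ∈ B then 0 else
      G.offCoef μ h.1 * (u (Sum.inl (G.endpoint h)) * u (Sum.inr h.1)) *
        ‖x (Sum.inl (G.endpoint h)) / u (Sum.inl (G.endpoint h)) -
          x (Sum.inr h.1) / u (Sum.inr h.1)‖ ^ 2 := by
  -- Testing `M u = 0` against `|x|² / u` adds zero to the form and completes a square on every half
  -- edge. At the vertices of `B` the quotient is `0 / 0 = 0`.
  let g : V ⊕ E → ℝ := fun i => ‖x i‖ ^ 2 / u i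
  have h0 : ∑ h : E × Bool,
      ((G.diagCoef μ h.1 * u (Sum.inl (G.endpoint h)) - G.offCoef μ h.1 * u (Sum.inr h.1)) *
          g (Sum.inl (G.endpoint h)) +
        (G.diagCoef μ h.1 * u (Sum.inr h.1) - G.offCoef μ h.1 * u (Sum.inl (G.endpoint h))) *
          g (Sum.inr h.1)) = 0 := by
    have h1 : ∑ i, (G.vertexMatrix μ *ᵥ (fun i => (u i : ℂ))) i * (g i : ℂ) = 0 := by
      rw [hu.sol]
      simp
    simp only [vertexMatrix_mulVec, Finset.sum_mul] at h1
    rw [Finset.sum_comm] at h1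
    simp only [add_mul, Finset.sum_add_distrib, mul_assoc, ite_mul, one_mul, zero_mul, mul_ite,
      mul_zero, Finset.sum_ite_eq', Finset.mem_univ, if_true] at h1
    have h2 := h1
    rw [← Finset.sum_add_distrib] at h2
    exact_mod_cast h2
  rw [quadForm_vertexMatrix, ← add_zero (∑ h : E × Bool, ite _ _ _)]
  nth_rewrite 2 [← h0]
  rw [← Finset.sum_add_distrib]
  refine Finset.sum_congr rfl fun h _ => ?_
  have hsq : ∀ z w : ℂ, ‖z + w‖ ^ 2 = ‖z‖ ^ 2 + ‖w‖ ^ 2 + 2 * (z * star w).re := fun z w => by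
    simp only [← Complex.normSq_eq_norm_sq, Complex.normSq_add]
    rfl
  have hsq' : ∀ z w : ℂ, ‖z - w‖ ^ 2 = ‖z‖ ^ 2 + ‖w‖ ^ 2 - 2 * (z * star w).re := fun z w => by
    simp only [← Complex.normSq_eq_norm_sq, Complex.normSq_sub]
    rfl
  have hm := hu.ne_zero h.1
  simp only [g]
  split_ifs with hb
  · rw [hx _ hb, hu.zero _ hb]
    simp only [zero_add, zero_sub, norm_neg, norm_zero, diagCoef, offCoef]
    field_simp
    ring
  · have hv : u (Sum.inl (G.endpoint h)) ≠ 0 := left_ne_zero_of_mul (hu.pos h hb).ne'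
    rw [hsq, hsq', hsq']
    have hre : (x (Sum.inl (G.endpoint h)) / u (Sum.inl (G.endpoint h)) *
        star (x (Sum.inr h.1) / u (Sum.inr h.1))).re =
        (x (Sum.inl (G.endpoint h)) * star (x (Sum.inr h.1))).re /
          (u (Sum.inl (G.endpoint h)) * u (Sum.inr h.1)) := by
      rw [← Complex.div_ofReal_re]
      congr 1
      simp only [Complex.star_def, map_div₀, Complex.conj_ofReal]
      push_cast
      rw [div_mul_div_comm]
    rw [hre, norm_div, norm_div, Complex.norm_real, Complex.norm_real, div_pow, div_pow,
      Real.norm_eq_abs, Real.norm_eq_abs, sq_abs, sq_abs]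
    simp only [diagCoef, offCoef]
    field_simp
    ring

variable [DecidableEq V]

theorem quadForm_innerMatrix (x : {v // v ∉ B} ⊕ E → ℂ) :
    quadForm (G.innerMatrix B μ) x =
      quadForm (G.vertexMatrix μ) (Function.extend (innerPoint B) x 0) :=
  quadForm_submatrix_of_injective _ (innerPoint_injective B) x

/-- In the ground state representation all squares have nonnegative weights, because `u` keeps its
sign on each half edge. -/
theorem IsGroundState.quadForm_innerMatrix_nonneg (hu : IsGroundState G μ B u)
    (hμ : G.IsSubcritical μ) (x : {v // v ∉ B} ⊕ E → ℂ) : 0 ≤ quadForm (G.innerMatrix B μ) x := by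
  rw [quadForm_innerMatrix, hu.quadForm_eq fun v hv => extend_innerPoint_inl_of_mem x hv]
  refine Finset.sum_nonneg fun h _ => ?_
  split_ifs with hb
  · exact le_rfl
  · exact mul_nonneg (mul_nonneg (offCoef_pos hμ h.1).le (hu.pos h hb).le) (sq_nonneg _)

/-- On the kernel the form vanishes, hence so does each square: `x / u` does not change along half
edges ending outside of `B`. -/
theorem IsGroundState.div_eq_of_mem_ker (hu : IsGroundState G μ B u) (hμ : G.IsSubcritical μ)
    {x : {v // v ∉ B} ⊕ E → ℂ} (hx : G.innerMatrix B μ *ᵥ x = 0) (h : E × Bool)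
    (hb : G.endpoint h ∉ B) : x (Sum.inl ⟨G.endpoint h, hb⟩) / u (Sum.inl (G.endpoint h)) =
      x (Sum.inr h.1) / u (Sum.inr h.1) := by
  classical
  have h0 : quadForm (G.innerMatrix B μ) x = 0 := by simp [quadForm, hx]
  rw [quadForm_innerMatrix, hu.quadForm_eq fun v hv => extend_innerPoint_inl_of_mem x hv,
    Finset.sum_eq_zero_iff_of_nonneg] at h0
  · have h1 := h0 h (Finset.mem_univ h)
    rw [if_neg hb, mul_eq_zero, or_iff_right
      (mul_pos (offCoef_pos hμ h.1) (hu.pos h hb)).ne', sq_eq_zero_iff, norm_eq_zero,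
      sub_eq_zero] at h1
    have h2 := (innerPoint_injective (E := E) B).extend_apply x 0 (Sum.inl ⟨G.endpoint h, hb⟩)
    have h3 := (innerPoint_injective (E := E) B).extend_apply x 0 (Sum.inr h.1)
    change Function.extend (innerPoint B) x 0 (Sum.inl (G.endpoint h)) = _ at h2
    change Function.extend (innerPoint B) x 0 (Sum.inr h.1) = _ at h3
    rwa [h2, h3] at h1
  · intro h _
    split_ifs with hb
    · exact le_rfl
    · exact mul_nonneg (mul_nonneg (offCoef_pos hμ h.1).le (hu.pos h hb).le) (sq_nonneg _)

theorem innerMatrix_mulVec (x : {v // v ∉ B} ⊕ E → ℂ) (i : {v // v ∉ B} ⊕ E) :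
    (G.innerMatrix B μ *ᵥ x) i =
      (G.vertexMatrix μ *ᵥ Function.extend (innerPoint B) x 0) (innerPoint B i) := by
  classical
  simp only [innerMatrix, mulVec, dotProduct, submatrix_apply]
  rw [← Finset.sum_subset (Finset.subset_univ (Finset.univ.image (innerPoint B)))]
  · rw [Finset.sum_image (innerPoint_injective B).injOn]
    exact Finset.sum_congr rfl fun j _ => by rw [(innerPoint_injective B).extend_apply]
  · intro k _ hk
    rw [Function.extend_apply', Pi.zero_apply, mul_zero]
    rintro ⟨j, rfl⟩
    exact hk (Finset.mem_image_of_mem _ (Finset.mem_univ j))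

/-- The multiplicity of a ground state is the number of components. -/
theorem IsGroundState.nullity_innerMatrix (hu : IsGroundState G μ B u) (hμ : G.IsSubcritical μ)
    (hI : ∀ v, ∃ h, G.endpoint h = v) :
    nullity (G.innerMatrix B μ) = (G.cut B).numComponents := by
  classical
  set C := G.cut B with hC
  have : Fintype (Quot C.Joined) := Fintype.ofFinite _
  have hune : ∀ v ∉ B, u (Sum.inl v) ≠ 0 := fun v hv => by
    obtain ⟨h, rfl⟩ := hI v
    exact left_ne_zero_of_mul (hu.pos h hv).ne'
  have huE : ∀ e, (u (Sum.inr e) : ℂ) ≠ 0 := fun e => by exact_mod_cast hu.ne_zero e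
  have huV : ∀ v ∉ B, (u (Sum.inl v) : ℂ) ≠ 0 := fun v hv => by exact_mod_cast hune v hv
  -- The kernel consists of the multiples `φ * u` with `φ` constant on each component of the cut
  -- graph.
  let Ξ : (Quot C.Joined → ℂ) →ₗ[ℂ] ({v // v ∉ B} ⊕ E → ℂ) :=
    { toFun := fun φ => Sum.elim (fun v => φ (Quot.mk _ (Sum.inl v)) * u (Sum.inl v))
        fun e => φ (Quot.mk _ (C.src e)) * u (Sum.inr e)
      map_add' := fun φ ψ => by
        ext i
        rcases i with v | e <;> simp [add_mul]
      map_smul' := fun c φ => by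
        ext i
        rcases i with v | e <;> simp [mul_assoc] }
  have hinj : Function.Injective Ξ := by
    rw [← LinearMap.ker_eq_bot, LinearMap.ker_eq_bot']
    intro φ hφ
    have hE : ∀ e, φ (Quot.mk _ (C.src e)) = 0 := fun e => by
      have : φ (Quot.mk _ (C.src e)) * u (Sum.inr e) = 0 := congrFun hφ (Sum.inr e)
      exact (mul_eq_zero.mp this).resolve_right (huE e)
    funext q
    induction q using Quot.ind with
    | mk p =>
      rcases p with v | h
      · have : φ (Quot.mk _ (Sum.inl v)) * u (Sum.inl v) = 0 := congrFun hφ (Sum.inl v)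
        exact (mul_eq_zero.mp this).resolve_right (huV v v.2)
      · rw [← endpoint_cut_of_mem h.2, mk_endpoint]
        exact hE h.1.1
  have hrange : LinearMap.range Ξ = LinearMap.ker (G.innerMatrix B μ).mulVecLin := by
    ext x
    rw [LinearMap.mem_range, LinearMap.mem_ker, mulVecLin_apply]
    constructor
    · rintro ⟨φ, rfl⟩
      let x' := Function.extend (innerPoint B) (Ξ φ) 0
      have hxE : ∀ e, x' (Sum.inr e) = φ (Quot.mk _ (C.src e)) * u (Sum.inr e) := fun e =>
        (innerPoint_injective B).extend_apply (Ξ φ) 0 (Sum.inr e)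
      have hxV : ∀ v (hv : v ∉ B), x' (Sum.inl v) =
          φ (Quot.mk _ (Sum.inl ⟨v, hv⟩)) * u (Sum.inl v) := fun v hv =>
        (innerPoint_injective B).extend_apply (Ξ φ) 0 (Sum.inl ⟨v, hv⟩)
      have hxh : ∀ h : E × Bool, x' (Sum.inl (G.endpoint h)) =
          φ (Quot.mk _ (C.src h.1)) * u (Sum.inl (G.endpoint h)) := fun h => by
        by_cases hb : G.endpoint h ∈ B
        · rw [hu.zero _ hb]
          simpa using extend_innerPoint_inl_of_mem _ hb
        · rw [hxV _ hb, ← endpoint_cut_of_notMem hb, mk_endpoint]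
      funext i
      rw [innerMatrix_mulVec]
      rcases i with v | e
      · have h1 := congrFun hu.sol (Sum.inl v.1)
        rw [vertexMatrix_mulVec_inl] at h1
        change (G.vertexMatrix μ *ᵥ x') (Sum.inl v.1) = 0
        rw [vertexMatrix_mulVec_inl]
        rw [Pi.zero_apply] at h1
        rw [← mul_zero (φ (Quot.mk _ (Sum.inl v))), ← h1, Finset.mul_sum]
        refine Finset.sum_congr rfl fun h hh => ?_
        have hv : G.endpoint h = v.1 := (Finset.mem_filter.mp hh).2
        have hb : G.endpoint h ∉ B := hv ▸ v.2
        have hφ : φ (Quot.mk _ (C.src h.1)) = φ (Quot.mk _ (Sum.inl v)) := by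
          rw [← mk_endpoint, endpoint_cut_of_notMem hb]
          congr 3
          exact Subtype.ext hv
        rw [hxh, hxE, hφ]
        ring
      · have h1 := congrFun hu.sol (Sum.inr e)
        rw [vertexMatrix_mulVec_inr] at h1
        change (G.vertexMatrix μ *ᵥ x') (Sum.inr e) = 0
        rw [vertexMatrix_mulVec_inr]
        rw [Pi.zero_apply] at h1
        rw [← mul_zero (φ (Quot.mk _ (C.src e))), ← h1, Finset.mul_sum]
        refine Finset.sum_congr rfl fun b _ => ?_
        rw [hxh, hxE]
        ring
    · intro hx
      -- The quotient `x / u` as a function on the vertices of the cut graph. Since `u` vanishes on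
      -- `B`, a cut end takes the quotient at the midpoint of its edge.
      let g : {v // v ∉ B} ⊕ {h : E × Bool // G.endpoint h ∈ B} → ℂ :=
        Sum.elim (fun v => x (Sum.inl v) / u (Sum.inl v))
          fun h => x (Sum.inr h.1.1) / u (Sum.inr h.1.1)
      have hg : ∀ h : E × Bool, g (C.endpoint h) = x (Sum.inr h.1) / u (Sum.inr h.1) := fun h => by
        by_cases hb : G.endpoint h ∈ B
        · rw [hC, endpoint_cut_of_mem hb]; rfl
        · rw [hC, endpoint_cut_of_notMem hb]
          exact hu.div_eq_of_mem_ker hμ hx h hb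
      refine ⟨Quot.lift g ?_, ?_⟩
      · rintro _ _ ⟨e, rfl, rfl⟩
        exact (hg (e, false)).trans (hg (e, true)).symm
      · funext i
        rcases i with v | e
        · exact div_mul_cancel₀ _ (huV v v.2)
        · change g (C.endpoint (e, false)) * _ = _
          rw [hg]
          exact div_mul_cancel₀ _ (huE e)
  rw [nullity, ← hrange, LinearMap.finrank_range_of_inj hinj, Module.finrank_fintype_fun_eq_card,
    numComponents, Nat.card_eq_fintype_card]

end GroundState

/-! ### Zeros of solutions and unique continuation -/

section Nodal

open Set Filter Topology

theorem eq_zero_of_sol_eq_zero {μ x : ℝ} {a d : ℂ} (h1 : sol μ a d x = 0)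
    (h2 : solDeriv μ a d x = 0) : a = 0 ∧ d = 0 := by
  have e3 : (cosSol μ x : ℂ) ^ 2 + μ * (sinSol μ x : ℂ) ^ 2 = 1 := by
    exact_mod_cast cosSol_sq_add μ x
  unfold sol at h1
  unfold solDeriv at h2
  constructor
  · linear_combination (cosSol μ x : ℂ) * h1 - (sinSol μ x : ℂ) * h2 - a * e3
  · linear_combination μ * (sinSol μ x : ℂ) * h1 + (cosSol μ x : ℂ) * h2 - d * e3

/-- At an accumulation point of zeros both the solution and its derivative vanish, so the solution
is zero. -/
theorem finite_zeros_sol {μ ℓ : ℝ} {a d : ℂ} (h : a ≠ 0 ∨ d ≠ 0) :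
    {x ∈ Icc 0 ℓ | sol μ a d x = 0}.Finite := by
  by_contra hinf
  obtain ⟨x, hx, hacc⟩ := Set.Infinite.exists_accPt_of_subset_isCompact hinf isCompact_Icc
    (fun x hx => hx.1)
  have hfreq := accPt_iff_frequently_nhdsNE.mp hacc
  have h1 : sol μ a d x = 0 := by
    have hcl : IsClosed {y | sol μ a d y = 0} := isClosed_eq (continuous_sol μ a d) continuous_const
    exact hcl.closure_subset (mem_closure_iff_frequently.mpr
      ((hfreq.filter_mono nhdsWithin_le_nhds).mono fun y hy => hy.2))
  have h2 : solDeriv μ a d x = 0 := by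
    by_contra h2
    have := (hasDerivAt_sol μ a d x).eventually_ne (c := 0) h2
    exact hfreq (this.mono fun y hy hy' => hy hy'.2)
  have := eq_zero_of_sol_eq_zero h1 h2
  tauto

theorem mul_pos_of_continuousOn {g : ℝ → ℝ} {s t : ℝ} (hg : ContinuousOn g (uIcc s t))
    (h0 : ∀ x ∈ uIcc s t, g x ≠ 0) : 0 < g s * g t := by
  by_contra h
  have h1 : (0 : ℝ) ∈ uIcc (g s) (g t) := by
    rw [mem_uIcc]
    by_contra h2
    push Not at h2
    refine h ?_
    rcases lt_or_ge (g s) 0 with h3 | h3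
    · exact mul_pos_of_neg_of_neg h3 (h2.1 h3.le)
    · have h4 : 0 < g s := lt_of_le_of_ne h3 (h0 s left_mem_uIcc).symm
      refine mul_pos h4 ?_
      by_contra h5
      exact absurd (h2.2 (not_lt.mp h5)) (not_lt.mpr h3)
  obtain ⟨x, hx, hx0⟩ := intermediate_value_uIcc hg h1
  exact h0 x hx hx0

/-- A real solution without zeros inside the interval cannot live on a long interval. -/
theorem mul_sq_le_of_ne_zero {μ ℓ : ℝ} {a d : ℂ} {g : ℝ → ℝ} (hℓ : 0 < ℓ)
    (hg : ∀ x ∈ Icc 0 ℓ, (g x : ℂ) = sol μ a d x) (h0 : ∀ x ∈ Ioo 0 ℓ, g x ≠ 0) :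
    μ * (ℓ / 4) ^ 2 < (Real.pi / 2) ^ 2 := by
  rcases le_or_gt μ 0 with hμ | hμ
  · exact (mul_nonpos_of_nonpos_of_nonneg hμ (sq_nonneg _)).trans_lt (by positivity)
  have hsq : 0 < √μ := Real.sqrt_pos.mpr hμ
  -- The half period: solutions change sign under translation by `w`.
  set w : ℝ := Real.pi / √μ with hw
  have hwpos : 0 < w := by positivity
  have hsw : √μ * w = Real.pi := by rw [hw]; field_simp
  have hlw : ℓ ≤ w := by
    by_contra hlt
    push Not at hlt
    have hc : cosSol μ w = -1 := by
      rw [cosSol, hsw, Real.sqrt_eq_zero_of_nonpos (by linarith : -μ ≤ 0)]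
      simp
    have hs : sinSol μ w = 0 := by
      have := cosSol_sq_add μ w
      rw [hc] at this
      have h1 : μ * sinSol μ w ^ 2 = 0 := by linarith
      simpa [hμ.ne'] using h1
    -- Centred so that both `t` and `t + w` are interior points; opposite values there force a zero
    -- between them.
    set t : ℝ := (ℓ - w) / 2 with ht
    have ht0 : 0 < t := by rw [ht]; linarith
    have htw : t + w < ℓ := by rw [ht]; linarith
    have h1 : g (t + w) = -g t := by
      have h2 := (sol_add (μ := μ) (x := t) a d hwpos.le).1
      rw [← hg _ ⟨by linarith, htw.le⟩, ← hg t ⟨ht0.le, by linarith⟩, sol, hc, hs] at h2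
      have h3 : (g (t + w) : ℂ) = ((-g t : ℝ) : ℂ) := by
        rw [h2]
        push_cast
        ring
      exact_mod_cast h3
    have hsub : uIcc t (t + w) ⊆ Ioo 0 ℓ := by
      rw [uIcc_of_le (by linarith)]
      exact fun x hx => ⟨by linarith [hx.1], by linarith [hx.2]⟩
    have hcont : ContinuousOn g (uIcc t (t + w)) := by
      refine (Complex.continuous_re.comp (continuous_sol μ a d)).continuousOn.congr fun x hx => ?_
      have := hg x (Ioo_subset_Icc_self (hsub hx))
      simp [← this]
    have h4 := mul_pos_of_continuousOn hcont fun x hx => h0 x (hsub hx)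
    rw [h1] at h4
    nlinarith [sq_nonneg (g t)]
  -- The bound is half of what is needed, `√μ * ℓ < 2 * π`; this slack is the gain from the
  -- midpoints.
  have h5 : √μ * ℓ ≤ Real.pi := hsw ▸ mul_le_mul_of_nonneg_left hlw hsq.le
  have h6 : √μ * (ℓ / 4) < Real.pi / 2 := by linarith [Real.pi_pos]
  have h7 : (√μ * (ℓ / 4)) ^ 2 < (Real.pi / 2) ^ 2 := by gcongr
  rwa [mul_pow, Real.sq_sqrt hμ.le] at h7

variable {V E : Type*} {G : MetricGraph V E}

theorem Connected.exists_end (hG : G.Connected) [hE : Nonempty E] (v : V) :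
    ∃ h, G.endpoint h = v := by
  obtain ⟨e⟩ := hE
  have key : ∀ u w, Relation.EqvGen G.Joined u w →
      ((∃ h, G.endpoint h = u) ↔ ∃ h, G.endpoint h = w) := by
    intro u w h
    induction h with
    | rel u w h =>
      obtain ⟨e, rfl, rfl⟩ := h
      exact ⟨fun _ => ⟨(e, true), rfl⟩, fun _ => ⟨(e, false), rfl⟩⟩
    | refl => exact Iff.rfl
    | symm _ _ _ ih => exact ih.symm
    | trans _ _ _ _ _ ih ih' => exact ih.trans ih'
  exact (key _ _ (hG.2 (G.src e) v)).mp ⟨(e, false), rfl⟩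

theorem endValue_ofReal (f : E → ℝ → ℝ) (h : E × Bool) :
    G.endValue (fun e x => (f e x : ℂ)) h = ((G.endValue f h : ℝ) : ℂ) := by
  unfold endValue
  split_ifs <;> rfl

theorem IsSol.eq_zero_of_end {μ : ℝ} {f : E → ℝ → ℂ} {a d : E → ℂ} (hf : G.IsSol μ f a d)
    {h : E × Bool} (h1 : G.endValue f h = 0) (h2 : G.outDeriv f h = 0) :
    a h.1 = 0 ∧ d h.1 = 0 := by
  rw [hf.endValue] at h1
  rw [hf.outDeriv] at h2
  split_ifs at h1 h2
  · exact eq_zero_of_sol_eq_zero h1 (neg_eq_zero.mp h2)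
  · exact ⟨h1, h2⟩

theorem IsSol.end_eq_zero {μ : ℝ} {f : E → ℝ → ℂ} {a d : E → ℂ} (hf : G.IsSol μ f a d)
    {h : E × Bool} (h1 : a h.1 = 0) (h2 : d h.1 = 0) :
    G.endValue f h = 0 ∧ G.outDeriv f h = 0 := by
  rw [hf.endValue, hf.outDeriv, h1, h2]
  simp [sol, solDeriv]

theorem Subdivision.left_mono (S : G.Subdivision) (e : E) : Monotone (S.left e) := by
  refine Fin.monotone_iff_le_succ.mpr fun i => ?_
  have := S.left_lt_right e i.castSucc
  rw [S.right_castSucc, ← S.left_succ] at this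
  exact this.le

theorem Subdivision.right_mono (S : G.Subdivision) (e : E) : Monotone (S.right e) := by
  refine Fin.monotone_iff_le_succ.mpr fun i => ?_
  have := S.left_lt_right e i.succ
  rw [S.left_succ, ← S.right_castSucc] at this
  exact this.le

theorem Subdivision.pt_notMem_Ioo (S : G.Subdivision) (e : E) (i : Fin (S.num e + 1))
    (j : Fin (S.num e)) : S.pt e j ∉ Ioo (S.left e i) (S.right e i) := by
  rintro ⟨h1, h2⟩
  rcases le_or_gt i j.castSucc with h | h
  · have := S.right_mono e h
    rw [S.right_castSucc] at this
    linarith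
  · have := S.left_mono e (Fin.castSucc_lt_iff_succ_le.mp h)
    rw [S.left_succ] at this
    linarith

variable [Fintype E] {μ : ℝ} {f : E → ℝ → ℂ} {a d : E → ℂ}

/-- If `h'` is a second end at the vertex, the Kirchhoff sum has exactly these two terms. -/
theorem outDeriv_eq_zero_of_degree_le_two {h h' : E × Bool} (hh : G.endpoint h' = G.endpoint h)
    (hdeg : G.degree (G.endpoint h) ≤ 2) (hk : G.outDerivSum f (G.endpoint h) = 0)
    (h0 : G.outDeriv f h = 0) : G.outDeriv f h' = 0 := by
  classical
  by_cases heq : h' = h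
  · rwa [heq]
  rw [degree_eq_sum, ← Finset.card_filter] at hdeg
  have hsub : ({h', h} : Finset (E × Bool)) ⊆
      Finset.univ.filter fun k => G.endpoint k = G.endpoint h := by
    intro k hk
    rw [Finset.mem_insert, Finset.mem_singleton] at hk
    rcases hk with rfl | rfl <;> simp [hh]
  have hset := Finset.eq_of_subset_of_card_le hsub (by rw [Finset.card_pair heq]; exact hdeg)
  rw [outDerivSum] at hk
  have h1 : ∑ k ∈ ({h', h} : Finset (E × Bool)), G.outDeriv f k = 0 := by
    rw [hset, ← hk]
  rw [Finset.sum_pair heq, h0, add_zero] at h1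
  exact h1

/-- An eigenfunction that does not vanish at vertices of degree larger than two vanishes
identically on no edge. -/
theorem IsSol.ne_zero_of_connected (hG : G.Connected) (hf : G.IsSol μ f a d)
    (hc : ∀ h h', G.endpoint h = G.endpoint h' → G.endValue f h = G.endValue f h')
    (hk : ∀ v, G.outDerivSum f v = 0)
    (hvertex : ∀ h : E × Bool, 2 < G.degree (G.endpoint h) → G.endValue f h ≠ 0)
    (hne : ∃ e, ∃ x ∈ Icc 0 (G.len e), f e x ≠ 0) (e : E) : a e ≠ 0 ∨ d e ≠ 0 := by
  by_contra hcon
  push Not at hcon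
  -- Vanishing passes through vertices: the value there is zero, so the degree is at most two, and
  -- the Kirchhoff condition transfers the zero derivative. Zero value and derivative at an end give
  -- the zero solution.
  have hstep : ∀ h h' : E × Bool, G.endpoint h' = G.endpoint h → a h.1 = 0 ∧ d h.1 = 0 →
      a h'.1 = 0 ∧ d h'.1 = 0 := by
    rintro h h' hh ⟨ha, hd⟩
    obtain ⟨h1, h2⟩ := hf.end_eq_zero (h := h) ha hd
    refine hf.eq_zero_of_end (h := h') ((hc _ _ hh).trans h1)
      (outDeriv_eq_zero_of_degree_le_two hh ?_ (hk _) h2)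
    by_contra hdeg
    exact hvertex h (not_le.mp hdeg) h1
  have key : ∀ u w, Relation.EqvGen G.Joined u w →
      ((∀ h, G.endpoint h = u → a h.1 = 0 ∧ d h.1 = 0) ↔
        ∀ h, G.endpoint h = w → a h.1 = 0 ∧ d h.1 = 0) := by
    intro u w h
    induction h with
    | rel u w h =>
      obtain ⟨e, rfl, rfl⟩ := h
      exact ⟨fun H h hh => hstep (e, true) h hh (H (e, false) rfl),
        fun H h hh => hstep (e, false) h hh (H (e, true) rfl)⟩
    | refl => exact Iff.rfl
    | symm _ _ _ ih => exact ih.symm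
    | trans _ _ _ _ _ ih ih' => exact ih.trans ih'
  obtain ⟨e', x, hx, hfx⟩ := hne
  have h1 := (key _ _ (hG.2 (G.endpoint (e, false)) (G.endpoint (e', false)))).mp
    (fun h hh => hstep (e, false) h hh hcon) (e', false) rfl
  rw [hf e' x hx, h1.1, h1.2] at hfx
  simp [sol] at hfx

end Nodal

/-! ### The nodal graph and its ground state -/

section NodalGraph

open Set

variable {V E : Type*} {G : MetricGraph V E} {lam : ℝ} {f : E → ℝ → ℝ}
  {hfin : ∀ e, (G.edgeZeros f e).Finite} {a d : E → ℂ}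

theorem pt_nodalSubdivision (e : E) (j) : f e ((G.nodalSubdivision f hfin).pt e j) = 0 :=
  ((hfin e).mem_toFinset.mp ((hfin e).toFinset.orderEmbOfFin_mem rfl j)).2

theorem ne_zero_of_mem_part (e : E) (i) {x : ℝ} (hx : x ∈ Ioo
    ((G.nodalSubdivision f hfin).left e i) ((G.nodalSubdivision f hfin).right e i)) :
    f e x ≠ 0 := by
  intro h0
  have h1 : x ∈ (hfin e).toFinset := (hfin e).mem_toFinset.mpr
    ⟨⟨((G.nodalSubdivision f hfin).left_nonneg e i).trans_lt hx.1,
      hx.2.trans_le ((G.nodalSubdivision f hfin).right_le e i)⟩, h0⟩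
  have h2 : x ∈ Set.range ((hfin e).toFinset.orderEmbOfFin rfl) := by
    rw [Finset.range_orderEmbOfFin]
    exact h1
  obtain ⟨j, rfl⟩ := h2
  exact (G.nodalSubdivision f hfin).pt_notMem_Ioo e i j hx

/-- The function `f` on the parts of the edges between consecutive nodal points. -/
noncomputable def nodalPart (G : MetricGraph V E) (f : E → ℝ → ℝ)
    (hfin : ∀ e, (G.edgeZeros f e).Finite)
    (p : Σ e, Fin ((G.nodalSubdivision f hfin).num e + 1)) (t : ℝ) : ℝ :=
  f p.1 ((G.nodalSubdivision f hfin).left p.1 p.2 + t)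

theorem nodalPart_ne_zero (p) {t : ℝ} (ht : t ∈ Ioo 0 ((G.nodalGraph f hfin).len p)) :
    G.nodalPart f hfin p t ≠ 0 := by
  refine ne_zero_of_mem_part (G := G) (hfin := hfin) p.1 p.2 ⟨by linarith [ht.1], ?_⟩
  have : t < (G.nodalSubdivision f hfin).right p.1 p.2 -
    (G.nodalSubdivision f hfin).left p.1 p.2 := ht.2
  linarith

theorem isSol_nodalPart (hf : G.IsSol lam (fun e x => (f e x : ℂ)) a d) :
    (G.nodalGraph f hfin).IsSol lam (fun p t => (G.nodalPart f hfin p t : ℂ))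
      (subdivideVal (G.nodalSubdivision f hfin) lam a d)
      (subdivideDer (G.nodalSubdivision f hfin) lam a d) :=
  hf.subdivide fun _ _ _ => rfl

/-- A part between consecutive nodal points has no interior zero and so is at most half a wave long.
-/
theorem isSubcritical_nodalGraph (hf : G.IsSol lam (fun e x => (f e x : ℂ)) a d) :
    (G.nodalGraph f hfin).IsSubcritical lam := fun p =>
  mul_sq_le_of_ne_zero ((G.nodalGraph f hfin).len_pos p) (isSol_nodalPart hf p)
    fun _ ht => nodalPart_ne_zero p ht

theorem continuousOn_nodalPart (hf : G.IsSol lam (fun e x => (f e x : ℂ)) a d) (p) :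
    ContinuousOn (G.nodalPart f hfin p) (Icc 0 ((G.nodalGraph f hfin).len p)) := by
  refine (Complex.continuous_re.comp (continuous_sol lam
    (subdivideVal (G.nodalSubdivision f hfin) lam a d p)
    (subdivideDer (G.nodalSubdivision f hfin) lam a d p))).continuousOn.congr fun x hx => ?_
  have := isSol_nodalPart (hfin := hfin) hf p x hx
  simp only [Function.comp, ← this, Complex.ofReal_re]

theorem endValue_nodalPart_subdivideEnd (h : E × Bool) :
    (G.nodalGraph f hfin).endValue (G.nodalPart f hfin)
      (subdivideEnd (G.nodalSubdivision f hfin) h) = G.endValue f h := by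
  obtain ⟨e, b⟩ := h
  cases b
  · simp [endValue, subdivideEnd, nodalPart]
  · simp [endValue, subdivideEnd, nodalPart, subdivide]

variable [Fintype V] [Fintype E]

theorem inl_mem_nodalPoints {v : V} : Sum.inl v ∈ G.nodalPoints f hfin ↔
    ∃ h, G.endpoint h = v ∧ G.endValue f h = 0 := by
  simp [nodalPoints]

theorem inr_mem_nodalPoints (q) : Sum.inr q ∈ G.nodalPoints f hfin := by
  simp [nodalPoints]

theorem endValue_nodalPart_eq_zero_iff
    (hc : ∀ h h', G.endpoint h = G.endpoint h' → G.endValue f h = G.endValue f h') (h) :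
    (G.nodalGraph f hfin).endValue (G.nodalPart f hfin) h = 0 ↔
      (G.nodalGraph f hfin).endpoint h ∈ G.nodalPoints f hfin := by
  induction h using subdivide_end_cases with
  | h1 h =>
    rw [endValue_nodalPart_subdivideEnd, endpoint_subdivideEnd, inl_mem_nodalPoints]
    exact ⟨fun h0 => ⟨h, rfl, h0⟩, fun ⟨h', hh, h0⟩ => (hc _ _ hh).symm.trans h0⟩
  | h2 e j =>
    rw [endpoint_succ]
    refine iff_of_true ?_ (inr_mem_nodalPoints _)
    simpa [endValue, nodalPart] using pt_nodalSubdivision (G := G) (hfin := hfin) e j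
  | h3 e j =>
    rw [endpoint_castSucc]
    refine iff_of_true ?_ (inr_mem_nodalPoints _)
    simpa [endValue, nodalPart, subdivide] using pt_nodalSubdivision (G := G) (hfin := hfin) e j

/-- The eigenfunction is a ground state of the Dirichlet problem on the nodal graph. -/
theorem exists_isGroundState (hI : ∀ v, ∃ h, G.endpoint h = v)
    (hf : G.IsSol lam (fun e x => (f e x : ℂ)) a d)
    (hc : ∀ h h', G.endpoint h = G.endpoint h' → G.endValue f h = G.endValue f h')
    (hk : ∀ v, G.outDerivSum (fun e x => (f e x : ℂ)) v = 0) :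
    ∃ u, IsGroundState (G.nodalGraph f hfin) lam (G.nodalPoints f hfin) u := by
  set S := G.nodalSubdivision f hfin with hS
  choose σ hσ using exists_end_subdivide S hI
  have hf' := isSol_nodalPart (hfin := hfin) hf
  let g := G.nodalPart f hfin
  have hcC : ∀ h h', G.endpoint h = G.endpoint h' →
      G.endValue (fun e x => (f e x : ℂ)) h = G.endValue (fun e x => (f e x : ℂ)) h' :=
    fun h h' hh => by rw [endValue_ofReal, endValue_ofReal, hc h h' hh]
  have hcont := (hf.continuous_subdivide hf').mpr hcC
  have hcont' : ∀ h h', (G.subdivide S).endpoint h = (G.subdivide S).endpoint h' →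
      (G.subdivide S).endValue g h = (G.subdivide S).endValue g h' := fun h h' hh => by
    have := hcont h h' hh
    rw [endValue_ofReal, endValue_ofReal] at this
    exact_mod_cast this
  let u : (V ⊕ Σ e, Fin (S.num e)) ⊕ (Σ e, Fin (S.num e + 1)) → ℝ :=
    Sum.elim (fun v => (G.subdivide S).endValue g (σ v)) fun p => g p ((G.subdivide S).len p / 2)
  have hu : ∀ h, u (Sum.inl ((G.subdivide S).endpoint h)) = (G.subdivide S).endValue g h :=
    fun h => hcont' _ _ (hσ _)
  have hmid : ∀ p, (G.subdivide S).len p / 2 ∈ Ioo 0 ((G.subdivide S).len p) := fun p => by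
    constructor <;> linarith [(G.subdivide S).len_pos p]
  refine ⟨u, ?_, fun v hv => ?_, fun p => nodalPart_ne_zero p (hmid p), fun h hb => ?_⟩
  · obtain ⟨h1, h2⟩ := vertexMatrix_mulVec_of_isSol (isSubcritical_nodalGraph hf) hf'
      (x := fun i => (u i : ℂ)) (fun h => by rw [endValue_ofReal, hu]) (fun p => rfl)
    funext i
    rcases i with (v | q) | p
    · rw [h2, hf.outDerivSum_subdivide_inl hf', hk, neg_zero]; rfl
    · rw [h2, hf'.outDerivSum_subdivide_inr, neg_zero]; rfl
    · exact h1 p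
  · rw [← hσ v, hu, endValue_nodalPart_eq_zero_iff hc]
    exact (hσ v).symm ▸ hv
  -- There is no zero between a non-nodal end and the midpoint, so the intermediate value theorem
  -- gives equal signs.
  · have hne : (G.subdivide S).endValue g h ≠ 0 := fun h0 =>
      hb ((endValue_nodalPart_eq_zero_iff hc h).mp h0)
    rw [hu]
    obtain ⟨p, b⟩ := h
    have hp := (G.subdivide S).len_pos p
    have hcon := continuousOn_nodalPart (hfin := hfin) hf p
    have hm := hmid p
    cases b
    · change g p 0 ≠ 0 at hne
      change 0 < g p 0 * g p ((G.subdivide S).len p / 2)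
      refine mul_pos_of_continuousOn (hcon.mono ?_) fun x hx => ?_
      · rw [uIcc_of_le hm.1.le]
        exact Icc_subset_Icc_right hm.2.le
      · rw [uIcc_of_le hm.1.le] at hx
        rcases hx.1.eq_or_lt with rfl | h0
        · exact hne
        · exact nodalPart_ne_zero p ⟨h0, hx.2.trans_lt hm.2⟩
    · change g p ((G.subdivide S).len p) ≠ 0 at hne
      change 0 < g p ((G.subdivide S).len p) * g p ((G.subdivide S).len p / 2)
      refine mul_pos_of_continuousOn (hcon.mono ?_) fun x hx => ?_
      · rw [uIcc_of_ge hm.2.le]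
        exact Icc_subset_Icc_left hm.1.le
      · rw [uIcc_of_ge hm.2.le] at hx
        rcases hx.2.eq_or_lt with rfl | h0
        · exact hne
        · exact nodalPart_ne_zero p ⟨hm.1.trans_le hx.1, h0⟩

/-- Degree larger than two is excluded by `hvertex`. At a nodal point of degree one the Kirchhoff
condition would kill the derivative as well, and `f` would vanish on the edge. -/
theorem degree_nodalPoints (hf : G.IsSol lam (fun e x => (f e x : ℂ)) a d)
    (hk : ∀ v, G.outDerivSum (fun e x => (f e x : ℂ)) v = 0)
    (hvertex : ∀ h : E × Bool, 2 < G.degree (G.endpoint h) → G.endValue f h ≠ 0)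
    (hne : ∀ e, a e ≠ 0 ∨ d e ≠ 0) :
    ∀ v ∈ G.nodalPoints f hfin, (G.nodalGraph f hfin).degree v = 2 := by
  classical
  rintro (v | q) hv
  · rw [degree_subdivide_inl]
    obtain ⟨h, rfl, h0⟩ := inl_mem_nodalPoints.mp hv
    have hle : G.degree (G.endpoint h) ≤ 2 := by
      by_contra hlt
      exact hvertex h (not_le.mp hlt) h0
    have hmem : h ∈ Finset.univ.filter fun k => G.endpoint k = G.endpoint h := by simp
    have hcard : G.degree (G.endpoint h) =
        (Finset.univ.filter fun k => G.endpoint k = G.endpoint h).card := by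
      rw [degree_eq_sum, Finset.card_filter]
    have hpos : 0 < G.degree (G.endpoint h) := by
      rw [hcard]
      exact Finset.card_pos.mpr ⟨h, hmem⟩
    have h1 : G.degree (G.endpoint h) ≠ 1 := by
      intro h1
      rw [hcard, Finset.card_eq_one] at h1
      obtain ⟨k, hk1⟩ := h1
      rw [hk1, Finset.mem_singleton] at hmem
      have h2 := hk (G.endpoint h)
      have h3 : ∑ l ∈ ({h} : Finset (E × Bool)), G.outDeriv (fun e x => (f e x : ℂ)) l = 0 := by
        rw [hmem, ← hk1, ← h2, outDerivSum]
      rw [Finset.sum_singleton] at h3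
      have := hf.eq_zero_of_end (h := h) (by rw [endValue_ofReal, h0]; rfl) h3
      have := hne h.1
      tauto
    omega
  · exact degree_subdivide_inr _ q

end NodalGraph

/-! ### The two-sided Dirichlet-to-Neumann map as a Schur complement -/

section DirichletToNeumann

open Matrix Set

variable {V E : Type*} [Fintype V] [Fintype E] {G : MetricGraph V E} {B : Finset V} {μ : ℝ}

/-- With zero data on `B` the remaining vertex and midpoint values lie in the kernel of the
Dirichlet block, which is trivial. -/
theorem IsDirichletSolution.eq_zero [DecidableEq V] (hI : ∀ v, ∃ h, G.endpoint h = v)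
    (hμ : G.IsSubcritical μ) (hD : nullity (G.innerMatrix B μ) = 0) {f : E → ℝ → ℂ}
    (hf : G.IsDirichletSolution B μ 0 f) (e : E) (t : ℝ) (ht : t ∈ Icc 0 (G.len e)) :
    f e t = 0 := by
  obtain ⟨a, d, had⟩ := exists_isSol_iff.mp hf.equation
  choose σ hσ using hI
  let x : V ⊕ E → ℂ := Sum.elim (fun v => G.endValue f (σ v)) fun e => f e (G.len e / 2)
  have hxB : ∀ v ∈ B, x (Sum.inl v) = 0 := fun v hv => by
    exact hf.dirichlet (σ v) ((hσ v).symm ▸ hv)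
  have hends : ∀ h, G.endValue f h = x (Sum.inl (G.endpoint h)) := fun h => by
    by_cases hb : G.endpoint h ∈ B
    · rw [hxB _ hb]
      simpa using hf.dirichlet h hb
    · exact hf.continuous h _ hb (hσ _).symm
  obtain ⟨h1, h2⟩ := vertexMatrix_mulVec_of_isSol hμ had hends fun e => rfl
  have hext : Function.extend (innerPoint B) (x ∘ innerPoint B) 0 = x := by
    funext i
    rcases i with v | e
    · by_cases hv : v ∈ B
      · rw [extend_innerPoint_inl_of_mem _ hv, hxB v hv]
      · exact (innerPoint_injective B).extend_apply _ _ (Sum.inl ⟨v, hv⟩)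
    · exact (innerPoint_injective B).extend_apply _ _ (Sum.inr e)
  have hker : G.innerMatrix B μ *ᵥ (x ∘ innerPoint B) = 0 := by
    funext i
    rw [innerMatrix_mulVec, hext]
    rcases i with v | e
    · exact (h2 v).trans (by rw [hf.kirchhoff v v.2, neg_zero]; rfl)
    · exact h1 e
  have hx0 : x ∘ innerPoint B = 0 :=
    (bijective_mulVec_of_nullity_eq_zero hD).1 (by rw [hker, mulVec_zero])
  have hx : x = 0 := by
    rw [← hext, hx0]
    exact Function.extend_zero _
  have ha : a e = 0 := by
    have := hends (e, false)
    rw [had.endValue, hx] at this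
    simpa using this
  have hd : d e = 0 := had.eq_zero_of_midpoint hμ ha (congrFun hx (Sum.inr e))
  rw [had e t ht, ha, hd]
  simp [sol]

/-- The vertices of `B`, the other vertices and the midpoints of the edges. -/
def splitEquiv [DecidableEq V] (B : Finset V) : B ⊕ ({v // v ∉ B} ⊕ E) ≃ V ⊕ E :=
  (Equiv.sumAssoc _ _ _).symm.trans (Equiv.sumCongr (Equiv.sumCompl (· ∈ B)) (Equiv.refl E))

/-- The Dirichlet-to-Neumann map is the Schur complement of the Dirichlet block of the vertex
matrix. -/
theorem exists_isDtN [DecidableEq V] (hI : ∀ v, ∃ h, G.endpoint h = v) (hμ : G.IsSubcritical μ)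
    (hM : nullity (G.vertexMatrix μ) = 0) (hD : nullity (G.innerMatrix B μ) = 0)
    (hDh : (G.innerMatrix B μ).IsHermitian) :
    ∃ (Λ : Matrix B B ℂ) (hΛ : Λ.IsHermitian), G.IsDtN B μ Λ ∧ nullity Λ = 0 ∧
      indexOf (isHermitian_vertexMatrix (G := G) μ) (· < 0) =
        indexOf hΛ (· < 0) + indexOf hDh (· < 0) := by
  have he : ⇑(splitEquiv (E := E) B) ∘ Sum.inr = innerPoint B := by
    funext i
    rcases i with v | e <;> rfl
  have hD' : nullity ((G.vertexMatrix μ).submatrix (splitEquiv B ∘ Sum.inr)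
      (splitEquiv B ∘ Sum.inr)) = 0 := by rw [he]; exact hD
  obtain ⟨Λ, hΛ, hind, hx⟩ := exists_schur_complement (isHermitian_vertexMatrix (G := G) μ)
    (splitEquiv B) hD'
  refine ⟨Λ, hΛ, ⟨fun f hf e t ht => hf.eq_zero hI hμ hD e t ht, fun ξ => ?_⟩, ?_, ?_⟩
  · obtain ⟨x, h1, h2, h3⟩ := hx ξ
    obtain ⟨a, d, h4, h5⟩ := exists_isSol_of_mulVec_eq_zero hμ (x := x) fun e => h2 (Sum.inr e)
    obtain ⟨-, h6⟩ := vertexMatrix_mulVec_of_isSol hμ (isSol_solFun μ a d) h4 h5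
    refine ⟨G.solFun μ a d, ⟨exists_isSol_iff.mpr ⟨a, d, isSol_solFun μ a d⟩, fun h hb => ?_,
      fun h h' _ hh => by rw [h4, h4, hh], fun v hv => ?_⟩, fun v => ?_⟩
    · rw [h4]
      exact h1 ⟨_, hb⟩
    · have := h2 (Sum.inl ⟨v, hv⟩)
      change (G.vertexMatrix μ *ᵥ x) (Sum.inl v) = 0 at this
      rw [h6] at this
      exact neg_eq_zero.mp this
    · rw [← h3, ← h6]
      rfl
  · rw [nullity, Submodule.finrank_eq_zero, LinearMap.ker_eq_bot']
    intro ξ hξ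
    rw [mulVecLin_apply] at hξ
    obtain ⟨x, h1, h2, h3⟩ := hx ξ
    -- A kernel vector of `Λ` extends to a kernel vector of the whole vertex matrix.
    have hx0 : x = 0 := (bijective_mulVec_of_nullity_eq_zero hM).1 (by
      rw [mulVec_zero]
      funext i
      obtain ⟨i, rfl⟩ := (splitEquiv B).surjective i
      rcases i with i | i
      · rw [h3, hξ]; rfl
      · exact h2 i)
    funext i
    rw [← h1, hx0]
    rfl
  · rw [hind]
    congr 1
    congr! 1
    rw [he, innerMatrix]

end DirichletToNeumann

/-! ### Places of an eigenvalue in the ordered list -/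

section Places

variable {V E : Type*} [Fintype E] {G : MetricGraph V E} {lam : ℝ} {k r : ℕ}

/-- The entries up to `(lam, i)` are the `k` entries below `lam` and the copies `0, ..., i` of
`lam`; copies are numbered from zero and places from one. -/
theorem place_eq (hk : {q : ℝ × ℕ | (q.2 : ℕ∞) < G.multiplicity q.1 ∧ q.1 < lam}.encard = k)
    (hr : G.multiplicity lam = r) {i : ℕ} (hi : i < r) :
    G.place (lam, i) = ((k + (i + 1) : ℕ) : ℕ∞) := by
  have hset : {q : ℝ × ℕ | q ∈ G.spectralEntries ∧ toLex q ≤ toLex (lam, i)} =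
      {q : ℝ × ℕ | (q.2 : ℕ∞) < G.multiplicity q.1 ∧ q.1 < lam} ∪
        (fun j : ℕ => (lam, j)) '' (Finset.range (i + 1)) := by
    ext ⟨t, j⟩
    simp only [spectralEntries, Set.mem_ofPred_eq, Prod.Lex.toLex_le_toLex, Set.mem_union,
      Set.mem_image, Finset.coe_range, Set.mem_Iio, Prod.mk.injEq]
    constructor
    · rintro ⟨h1, h2 | ⟨rfl, h2⟩⟩
      · exact Or.inl ⟨h1, h2⟩
      · exact Or.inr ⟨j, by omega, rfl, rfl⟩
    · rintro (⟨h1, h2⟩ | ⟨j, h1, rfl, rfl⟩)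
      · exact ⟨h1, Or.inl h2⟩
      · refine ⟨?_, Or.inr ⟨rfl, by omega⟩⟩
        rw [hr]
        exact_mod_cast (by omega : j < r)
  rw [place, hset, Set.encard_union_eq, hk,
    Function.Injective.encard_image (fun i j h => (Prod.mk.inj h).2),
    Set.encard_coe_eq_coe_finsetCard, Finset.card_range]
  · push_cast
    rfl
  · rw [Set.disjoint_left]
    rintro ⟨t, j⟩ ⟨-, h3⟩ ⟨j', -, h4⟩
    exact h3.ne (Prod.mk.inj h4).1.symm

theorem mem_spectralEntries_iff (hr : G.multiplicity lam = r) {i : ℕ} :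
    (lam, i) ∈ G.spectralEntries ↔ i < r := by
  simp only [spectralEntries, Set.mem_ofPred_eq, hr]
  exact Nat.cast_lt

theorem firstPlace_eq
    (hk : {q : ℝ × ℕ | (q.2 : ℕ∞) < G.multiplicity q.1 ∧ q.1 < lam}.encard = k)
    (hr : G.multiplicity lam = r) (hr0 : 0 < r) : G.firstPlace lam = ((k + 1 : ℕ) : ℕ∞) := by
  refine le_antisymm ?_ ?_
  · refine (iInf₂_le (lam, 0) ⟨(mem_spectralEntries_iff hr).mpr hr0, rfl⟩).trans ?_
    rw [place_eq hk hr hr0]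
  · refine le_iInf₂ fun p hp => ?_
    obtain ⟨t, i⟩ := p
    obtain ⟨h1, rfl⟩ : (t, i) ∈ G.spectralEntries ∧ t = lam := hp
    rw [place_eq hk hr ((mem_spectralEntries_iff hr).mp h1)]
    exact_mod_cast (by omega : k + 1 ≤ k + (i + 1))

theorem lastPlace_eq
    (hk : {q : ℝ × ℕ | (q.2 : ℕ∞) < G.multiplicity q.1 ∧ q.1 < lam}.encard = k)
    (hr : G.multiplicity lam = r) (hr0 : 0 < r) : G.lastPlace lam = ((k + r : ℕ) : ℕ∞) := by
  refine le_antisymm ?_ ?_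
  · refine iSup₂_le fun p hp => ?_
    obtain ⟨t, i⟩ := p
    obtain ⟨h1, rfl⟩ : (t, i) ∈ G.spectralEntries ∧ t = lam := hp
    have h2 := (mem_spectralEntries_iff hr).mp h1
    rw [place_eq hk hr h2]
    exact_mod_cast (by omega : k + (i + 1) ≤ k + r)
  · refine le_trans ?_ (le_iSup₂ (lam, r - 1)
      ⟨(mem_spectralEntries_iff hr).mpr (by omega), rfl⟩)
    rw [place_eq hk hr (by omega), show r - 1 + 1 = r by omega]

end Places

theorem morseIndex_eq_indexOf {n : Type*} [Fintype n] {Λ : Matrix n n ℂ} (hΛ : Λ.IsHermitian) :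
    morseIndex hΛ = indexOf hΛ (· < 0) := by
  unfold morseIndex indexOf
  congr!

theorem positiveIndex_eq_indexOf {n : Type*} [Fintype n] {Λ : Matrix n n ℂ}
    (hΛ : Λ.IsHermitian) : positiveIndex hΛ = indexOf hΛ (0 < ·) := by
  unfold positiveIndex indexOf
  congr!

end MetricGraph

/-! ### Proof of the index formulas -/

theorem theorem1p1 {V E : Type*} [Fintype V] [Fintype E] (G : MetricGraph V E)
    (hG : G.Connected) (lam : ℝ) (f : E → ℝ → ℝ) (hf : G.IsRealEigenpair lam f)
    (hvertex : ∀ h : E × Bool, 2 < G.degree (G.endpoint h) → G.endValue f h ≠ 0) :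
    ∃ hfin : ∀ e, (G.edgeZeros f e).Finite,
    ∃ n N : ℕ, G.firstPlace lam = n ∧ G.lastPlace lam = N ∧
    ∃ ε₀ : ℝ, 0 < ε₀ ∧ ∀ ε : ℝ, 0 < ε → ε < ε₀ →
    ∃ Λplus Λminus : Matrix (G.nodalPoints f hfin) (G.nodalPoints f hfin) ℂ,
      (G.nodalGraph f hfin).IsDtN (G.nodalPoints f hfin) (lam + ε) Λplus ∧
      (G.nodalGraph f hfin).IsDtN (G.nodalPoints f hfin) (lam - ε) Λminus ∧
      Function.Bijective Λplus.mulVec ∧ Function.Bijective Λminus.mulVec ∧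
      ∃ (hplus : Λplus.IsHermitian) (hminus : Λminus.IsHermitian),
        (N : ℤ) - (G.nodalCut f hfin).numComponents = MetricGraph.morseIndex hplus ∧
        (n : ℤ) - 1 = MetricGraph.morseIndex hminus ∧
        (n : ℤ) - (G.nodalCut f hfin).numComponents =
          (G.betti : ℤ) - (G.nodalCut f hfin).betti - MetricGraph.positiveIndex hminus := by
  open MetricGraph in
  classical
  obtain ⟨hlap, e₀, x₀, hx₀, hfx₀⟩ := hf
  have : Nonempty E := ⟨e₀⟩
  have hI := hG.exists_end
  obtain ⟨a, d, had⟩ : ∃ a d, G.IsSol lam (fun e x => (f e x : ℂ)) a d :=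
    exists_isSol_iff.mp hlap.sobolev
  have hc : ∀ h h', G.endpoint h = G.endpoint h' → G.endValue f h = G.endValue f h' :=
    fun h h' hh => by
      have := hlap.continuous h h' hh
      rw [endValue_ofReal, endValue_ofReal] at this
      exact_mod_cast this
  have hne : ∀ e, a e ≠ 0 ∨ d e ≠ 0 :=
    had.ne_zero_of_connected hG hlap.continuous hlap.kirchhoff
      (fun h hh => by rw [endValue_ofReal]; exact_mod_cast hvertex h hh)
      ⟨e₀, x₀, hx₀, by exact_mod_cast hfx₀⟩
  have hfin : ∀ e, (G.edgeZeros f e).Finite := fun e =>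
    (finite_zeros_sol (μ := lam) (ℓ := G.len e) (hne e)).subset fun x hx =>
      ⟨Set.Ioo_subset_Icc_self hx.1, by
        rw [← had e x (Set.Ioo_subset_Icc_self hx.1)]
        exact Complex.ofReal_eq_zero.mpr hx.2⟩
  refine ⟨hfin, ?_⟩
  set B := G.nodalPoints f hfin with hB
  set H := G.nodalGraph f hfin with hH
  have hI' : ∀ v, ∃ h, H.endpoint h = v := exists_end_subdivide _ hI
  have hlam : H.IsSubcritical lam := isSubcritical_nodalGraph had
  obtain ⟨u, hu⟩ : ∃ u, IsGroundState H lam B u := exists_isGroundState hI had hc hlap.kirchhoff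
  have hM := isDecreasingFamily_vertexMatrix hI'
  have hD : IsDecreasingFamily (H.innerMatrix B) _ := hM.submatrix (innerPoint_injective B)
  have hopen := isOpen_isSubcritical (G := H)
  have hmult : ∀ t, H.IsSubcritical t → G.multiplicity t = nullity (H.vertexMatrix t) :=
    fun t ht => by rw [← multiplicity_eq_nullity hI' ht, hH, multiplicity_subdivide]
  have hneg : ∀ t < 0, nullity (H.vertexMatrix t) = 0 := fun t ht =>
    nullity_eq_zero_of_pos fun x hx => quadForm_vertexMatrix_pos hI' ht hx
  -- Any negative number can serve as `a`, since the family is positive definite there.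
  have hcount := hM.encard_eq_index hopen ordConnected_isSubcritical (m := G.multiplicity)
    hmult (a := -1) (b := lam) (isSubcritical_of_nonpos (by norm_num)) hlam
    (fun t ht => by
      have ht0 : t < 0 := by linarith
      rw [hmult t (isSubcritical_of_nonpos ht0.le), hneg t ht0]
      rfl)
    (indexOf_neg_eq_zero _ fun x => by
      by_cases hx : x = 0
      · simp [hx, quadForm]
      · exact (quadForm_vertexMatrix_pos hI' (by norm_num) hx).le)
  -- The vector of values of `f` lies in the kernel and is nonzero at the midpoints.
  have hr0 : 0 < nullity (H.vertexMatrix lam) := by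
    rw [Nat.pos_iff_ne_zero]
    intro h0
    have := (bijective_mulVec_of_nullity_eq_zero h0).1
      (hu.sol.trans (Matrix.mulVec_zero _).symm)
    exact hu.ne_zero ⟨e₀, 0⟩ (Complex.ofReal_eq_zero.mp (congrFun this (Sum.inr ⟨e₀, 0⟩)))
  -- With `k` the Morse index of the vertex matrix at `lam` and `r` its nullity, `n = k + 1` and `N
  -- = k + r`.
  refine ⟨_, _, firstPlace_eq hcount (hmult lam hlam) hr0,
    lastPlace_eq hcount (hmult lam hlam) hr0, ?_⟩
  have hgt := ((hM.eventually_gt hopen hlam).and (hD.eventually_gt hopen hlam)).and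
    (nhdsWithin_le_nhds (hopen.mem_nhds hlam))
  have hlt := ((hM.eventually_lt hopen hlam).and (hD.eventually_lt hopen hlam)).and
    (nhdsWithin_le_nhds (hopen.mem_nhds hlam))
  obtain ⟨r, hr, hgt⟩ := (mem_nhdsGT_iff_exists_Ioo_subset' (lt_add_one lam)).mp hgt
  obtain ⟨l, hl, hlt⟩ := (mem_nhdsLT_iff_exists_Ioo_subset' (sub_one_lt lam)).mp hlt
  refine ⟨min (r - lam) (lam - l), lt_min (sub_pos.mpr hr) (sub_pos.mpr hl), fun ε hε hε' => ?_⟩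
  obtain ⟨⟨⟨hM1, hM2⟩, hD1, hD2⟩, hs⟩ := @hgt (lam + ε)
    ⟨by linarith, by linarith [min_le_left (r - lam) (lam - l)]⟩
  obtain ⟨⟨⟨hM1', hM2'⟩, hD1', hD2'⟩, hs'⟩ := @hlt (lam - ε)
    ⟨by linarith [min_le_right (r - lam) (lam - l)], by linarith⟩
  obtain ⟨Λ, hΛ, hdtn, hnul, hind⟩ := exists_isDtN hI' hs hM1 hD1 (hD.herm _)
  obtain ⟨Λ', hΛ', hdtn', hnul', hind'⟩ := exists_isDtN hI' hs' hM1' hD1' (hD.herm _)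
  refine ⟨Λ, Λ', hdtn, hdtn', bijective_mulVec_of_nullity_eq_zero hnul,
    bijective_mulVec_of_nullity_eq_zero hnul', hΛ, hΛ', ?_⟩
  -- At `lam` the Dirichlet block has Morse index zero and nullity `ν₀`, so just above `lam` its
  -- Morse index is `ν₀` and just below it is zero.
  have hzero : indexOf (hD.herm lam) (· < 0) = 0 :=
    indexOf_neg_eq_zero _ (hu.quadForm_innerMatrix_nonneg hlam)
  have hcomp := hu.nullity_innerMatrix hlam hI'
  have hbetti := betti_cut_subdivide hG (G.nodalSubdivision f hfin) B
    (degree_nodalPoints had hlap.kirchhoff hvertex hne)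
  have hcard := indexOf_add_nullity_add hΛ'
  rw [Fintype.card_coe] at hcard
  rw [morseIndex_eq_indexOf, morseIndex_eq_indexOf, positiveIndex_eq_indexOf]
  change ((H.cut B).betti : ℤ) = _ - _ - _ + ((H.cut B).numComponents : ℤ) at hbetti
  change _ - ((H.cut B).numComponents : ℤ) = _ ∧ _ ∧
    _ - ((H.cut B).numComponents : ℤ) = _ - ((H.cut B).betti : ℤ) - _
  -- The first two identities subtract the Morse index of the Dirichlet block from that of the
  -- vertex matrix; the third also uses `hcard` with `hnul'` and `hbetti` to eliminate `B.card`.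
  refine ⟨?_, ?_, ?_⟩ <;> push_cast <;> omega
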